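/- Consider $n$ bosonic modes with annihilation and creation operators $a_i,a_i^\dagger$ ($[a_i,a_j^\dagger]=\delta_{ij}$) on Fock space, and put $a^\dagger(\boldsymbol z)=\sum_i z_ia_i^\dagger$, $a(\boldsymbol z)=\sum_i\bar z_ia_i$, $D(\boldsymbol z)=e^{a^\dagger(\boldsymbol z)-a(\boldsymbol z)}$ for $\boldsymbol z\in\mathbb C^n$. Let $\hat x_j=(a_j+a_j^\dagger)/\sqrt2$, $\hat p_j=-i(a_j-a_j^\dagger)/\sqrt2$ and $\hat{\boldsymbol r}=(\hat x_1,\hat p_1,\dots,\hat x_n,\hat p_n)$. For a state (density operator) $\rho$, let $\boldsymbol d$ be its displacement vector, $d_i=\langle\hat r_i\rangle=\mathrm{Tr}(\hat r_i\rho)$, and $V$ its covariance matrix, $V_{ij}=\langle\hat r_i\hat r_j+\hat r_j\hat r_i\rangle-2\langle\hat r_i\rangle\langle\hat r_j\rangle$. A state is called Gaussian if its characteristic function $\chi(\boldsymbol z)=\mathrm{Tr}\,\rho D(\boldsymbol z)$, with $z_j=\xi_{j1}+i\xi_{j2}$ and $\boldsymbol\xi=(\xi_{11},\xi_{12},\dots,\xi_{n1},\xi_{n2})^T\in\mathbb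 R^{2n}$, is $\exp\bigl(-\frac12\boldsymbol\xi^T\Omega V\Omega^T\boldsymbol\xi-i\sqrt2(\Omega\boldsymbol d)^T\boldsymbol\xi\bigr)$, where $\Omega=\bigoplus_{j=1}^n\begin{pmatrix}0&1\\-1&0\end{pmatrix}$. A state $\rho$ is called classical if it is a mixture of coherent states $|\boldsymbol z\rangle=D(\boldsymbol z)|0\rangle$, that is, $\rho=\int|\boldsymbol z\rangle\langle\boldsymbol z|\,dP(\boldsymbol z)$ for some probability measure $P$ on $\mathbb C^n$, and nonclassical otherwise. Let $\rho^{\mathrm G}$ be an $n$-mode Gaussian state with covariance matrix $V$, let $\boldsymbol c\in\mathbb C^n$, and suppose $a(\boldsymbol c)\rho^{\mathrm G}a^\dagger(\boldsymbol c)\neq0$. Then the photon-subtracted state $$\rho^{\mathrm G}_-=\frac{a(\boldsymbol c)\rho^{\mathrm G}a^\dagger(\boldsymbol c)}{\mathrm{Tr}\,[a(\boldsymbol c)\rho^{\mathrm G}a^\dagger(\boldsymbol c)]}$$ is well defined (there is exactly one density operator with these matrix elements between finite linear combinations of Fock states), and: (i) $\rho^{\mathrm G}_-$ is classical if and only if $\rho^{\mathrm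 G}$ is classical, and $\rho^{\mathrm G}_-$ is nonclassical if and only if $\rho^{\mathrm G}$ is nonclassical; (ii) $\rho^{\mathrm G}_-$ is classical if and only if $V-\mathbb I\ge0$. -/

import Mathlib

noncomputable section

namespace QuantumOptics

/-- The Hilbert space of `n` bosonic modes, in the Fock (occupation number) representation. -/
abbrev FockSpace (n : ℕ) : Type := lp (fun _ : Fin n → ℕ => ℂ) 2

/-- The finite linear combinations of Fock basis vectors: a dense subspace, invariant under all
creation and annihilation operators, on which polynomials in these operators are defined. -/
abbrev FiniteVectors (n : ℕ) : Type := (Fin n → ℕ) →₀ ℂ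

/-- The basis vector with occupation numbers `k`, as a finite vector. -/
def basisVec {n : ℕ} (k : Fin n → ℕ) : FiniteVectors n := Finsupp.single k 1

/-- The inclusion of the finite vectors in the Hilbert space; it sends `basisVec k` to the
normalized Fock state with occupation numbers `k`. -/
def incl (n : ℕ) : FiniteVectors n →ₗ[ℂ] FockSpace n :=
  Finsupp.linearCombination ℂ (fun k => lp.single 2 k (1 : ℂ))

/-- The normalized Fock state with occupation numbers `k`. -/
def fock {n : ℕ} (k : Fin n → ℕ) : FockSpace n := incl n (basisVec k)

/-- The creation operator of mode `j`: it sends the Fock state `k` to `√(k j + 1)` times the Fock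
state with one more quantum in mode `j`. -/
def creation {n : ℕ} (j : Fin n) : FiniteVectors n →ₗ[ℂ] FiniteVectors n :=
  Finsupp.linearCombination ℂ
    (fun k => ((Real.sqrt (k j + 1) : ℝ) : ℂ) • basisVec (k + Pi.single j 1))

/-- The annihilation operator of mode `j`: it sends the Fock state `k` to `√(k j)` times the Fock
state with one quantum less in mode `j` (and to `0` when `k j = 0`). -/
def annihilation {n : ℕ} (j : Fin n) : FiniteVectors n →ₗ[ℂ] FiniteVectors n :=
  Finsupp.linearCombination ℂ
    (fun k => ((Real.sqrt (k j) : ℝ) : ℂ) • basisVec (k - Pi.single j 1))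

/-- `a†(c) = ∑ i, c i • a†_i`. -/
def aDag {n : ℕ} (c : Fin n → ℂ) : FiniteVectors n →ₗ[ℂ] FiniteVectors n :=
  ∑ i, c i • creation i

/-- `a(c) = ∑ i, conj (c i) • a_i`. -/
def aOp {n : ℕ} (c : Fin n → ℂ) : FiniteVectors n →ₗ[ℂ] FiniteVectors n :=
  ∑ i, (starRingEnd ℂ) (c i) • annihilation i

/-- The displacement operator `D(z) = exp (a†(z) - a(z))` on finite vectors. These are analytic
vectors of the exponent, so the exponential series converges in norm. -/
def displacement {n : ℕ} (z : Fin n → ℂ) (φ : FiniteVectors n) : FockSpace n :=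
  ∑' m : ℕ, ((m.factorial : ℂ)⁻¹) • incl n (((aDag z - aOp z) ^ m) φ)

/-- The coherent state `|z⟩ = D(z)|0⟩`. -/
def coherent {n : ℕ} (z : Fin n → ℂ) : FockSpace n := displacement z (basisVec 0)

/-- A quantum state (density operator): a positive operator of trace one. -/
structure IsState {n : ℕ} (ρ : FockSpace n →L[ℂ] FockSpace n) : Prop where
  isPositive : ρ.IsPositive
  trace_eq_one : HasSum (fun k : Fin n → ℕ => inner ℂ (fock k) (ρ (fock k))) 1

/-- The characteristic function `χ(z) = Tr (ρ D(z))`. -/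
def charFn {n : ℕ} (ρ : FockSpace n →L[ℂ] FockSpace n) (z : Fin n → ℂ) : ℂ :=
  ∑' k : Fin n → ℕ, inner ℂ (fock k) (ρ (displacement z (basisVec k)))

/-- The quadratures: `quadrature (j, 0)` is `x_j = (a_j + a†_j) / √2` and `quadrature (j, 1)` is
`p_j = -i (a_j - a†_j) / √2`. -/
def quadrature {n : ℕ} (i : Fin n × Fin 2) : FiniteVectors n →ₗ[ℂ] FiniteVectors n :=
  if i.2 = 0 then
    (((Real.sqrt 2)⁻¹ : ℝ) : ℂ) • (annihilation i.1 + creation i.1)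
  else
    (-Complex.I * (((Real.sqrt 2)⁻¹ : ℝ) : ℂ)) • (annihilation i.1 - creation i.1)

/-- The expectation `Tr (A ρ)` of a symmetric operator `A` (a real number), the trace being
computed in the Fock basis: `⟨k, A ρ k⟩ = ⟨A k, ρ k⟩`. -/
def expectation {n : ℕ} (ρ : FockSpace n →L[ℂ] FockSpace n)
    (A : FiniteVectors n →ₗ[ℂ] FiniteVectors n) : ℝ :=
  (∑' k : Fin n → ℕ, inner ℂ (incl n (A (basisVec k))) (ρ (fock k))).re

/-- The displacement vector `d_i = ⟨r_i⟩` of a state. -/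
def meanVec {n : ℕ} (ρ : FockSpace n →L[ℂ] FockSpace n) : Fin n × Fin 2 → ℝ :=
  fun i => expectation ρ (quadrature i)

/-- The covariance matrix `V_ij = ⟨r_i r_j + r_j r_i⟩ - 2 ⟨r_i⟩ ⟨r_j⟩` of a state. -/
def covMatrix {n : ℕ} (ρ : FockSpace n →L[ℂ] FockSpace n) :
    Matrix (Fin n × Fin 2) (Fin n × Fin 2) ℝ :=
  Matrix.of fun i j =>
    expectation ρ (quadrature i ∘ₗ quadrature j + quadrature j ∘ₗ quadrature i)
      - 2 * meanVec ρ i * meanVec ρ j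

/-- The block diagonal matrix `Ω` with `n` diagonal blocks `(0, 1; -1, 0)`. -/
def symplecticForm (n : ℕ) : Matrix (Fin n × Fin 2) (Fin n × Fin 2) ℝ :=
  Matrix.of fun i j => if i.1 = j.1 then (!![0, 1; -1, 0] : Matrix (Fin 2) (Fin 2) ℝ) i.2 j.2 else 0

/-- The complex phase space point `z_j = ξ_(j,0) + i ξ_(j,1)` with real coordinates `ξ`. -/
def toComplexVec {n : ℕ} (ξ : Fin n × Fin 2 → ℝ) : Fin n → ℂ :=
  fun j => (ξ (j, 0) : ℂ) + Complex.I * (ξ (j, 1) : ℂ)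

/-- A Gaussian state: its characteristic function is the Gaussian
`exp (-(1/2) ξᵀ Ω V Ωᵀ ξ - i √2 (Ω d)ᵀ ξ)`, where `V` and `d` are the covariance matrix and the
displacement vector of the state. -/
structure IsGaussianState {n : ℕ} (ρ : FockSpace n →L[ℂ] FockSpace n) : Prop where
  isState : IsState ρ
  charFn_eq : ∀ ξ : Fin n × Fin 2 → ℝ,
    charFn ρ (toComplexVec ξ) =
      Complex.exp
        (-(1 / 2 : ℂ) *
            ((ξ ⬝ᵥ Matrix.mulVec
              (symplecticForm n * covMatrix ρ * (symplecticForm n).transpose) ξ : ℝ) : ℂ)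
          - Complex.I * ((Real.sqrt 2 * (Matrix.mulVec (symplecticForm n) (meanVec ρ) ⬝ᵥ ξ) : ℝ) : ℂ))

/-- A state is classical if it is a mixture of coherent states: `ρ = ∫ |z⟩⟨z| dP(z)` for a
probability measure `P` on phase space, the integral being understood weakly. -/
def IsClassical {n : ℕ} (ρ : FockSpace n →L[ℂ] FockSpace n) : Prop :=
  ∃ P : MeasureTheory.Measure (Fin n → ℂ), MeasureTheory.IsProbabilityMeasure P ∧
    ∀ φ ψ : FockSpace n,
      inner ℂ φ (ρ ψ) = ∫ z, inner ℂ φ (coherent z) * inner ℂ (coherent z) ψ ∂P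

/-- A state is nonclassical if it is not classical. -/
def IsNonclassical {n : ℕ} (ρ : FockSpace n →L[ℂ] FockSpace n) : Prop := ¬ IsClassical ρ

/-- The matrix elements `⟨φ, a(c) ρ a†(c) ψ⟩ = ⟨a†(c) φ, ρ a†(c) ψ⟩` of the operator
`a(c) ρ a†(c)` between finite vectors. -/
def subtractedForm {n : ℕ} (c : Fin n → ℂ) (ρ : FockSpace n →L[ℂ] FockSpace n) :
    FiniteVectors n → FiniteVectors n → ℂ :=
  fun φ ψ => inner ℂ (incl n (aDag c φ)) (ρ (incl n (aDag c ψ)))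

/-- The trace of `a(c) ρ a†(c)`. -/
def subtractedTrace {n : ℕ} (c : Fin n → ℂ) (ρ : FockSpace n →L[ℂ] FockSpace n) : ℂ :=
  ∑' k : Fin n → ℕ, subtractedForm c ρ (basisVec k) (basisVec k)

/-- `σ` is the photon-subtracted state `a(c) ρ a†(c) / Tr (a(c) ρ a†(c))`. -/
structure IsPhotonSubtracted {n : ℕ} (c : Fin n → ℂ)
    (ρ σ : FockSpace n →L[ℂ] FockSpace n) : Prop where
  isState : IsState σ
  matrix_elements : ∀ φ ψ : FiniteVectors n,
    inner ℂ (incl n φ) (σ (incl n ψ)) = (subtractedTrace c ρ)⁻¹ * subtractedForm c ρ φ ψ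

end QuantumOptics

end

noncomputable section

namespace QuantumOptics

open MeasureTheory ProbabilityTheory
open scoped ComplexConjugate ENNReal Matrix

/-! Everything is tested on the exponential vectors `expVec u`, unnormalized coherent states
depending holomorphically on `u`, with inner products `exp (∑ conj u_i v_i)`. Their normalizations
resolve the identity over phase space, and a bounded operator is determined by its diagonal coherent
matrix elements. Hence a state is known once its Husimi function `u ↦ ⟨u|ρ|u⟩` is known, and all
comparisons are made there. The Fourier transform of the Husimi function is the characteristic
function times `exp (-|z|²/2)`, so for a Gaussian state the Husimi measure is a normal law: its
variance in the direction `z` is `weylVariance + |z|²`, where `weylVariance` is the quadratic form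
of `V` at the rotated `z`.

The equivalences come from a cycle of three implications. If `V - 1 ≥ 0`, let `P` be a Gaussian
measure with covariance governed by `V - 1`. Mixing coherent states over `P` convolves it with the
vacuum Husimi function, which supplies the missing `2|z|²` in the exponent; the mixture and `ρ` have
the same Husimi function, so `ρ` is classical (`isClassical_of_posSemidef`). If `ρ` is classical,
coherent states are eigenvectors of `a(c)`, so subtraction only reweights `P` by a squared
eigenvalue, and the subtracted state is classical (`IsClassical.photonSubtracted`).

The remaining implication, from `σ` classical to `V - 1 ≥ 0`, compares growth rates of Laplace
transforms of Husimi functions (`sum_norm_sq_le_weylVariance`). A mixture of coherent states has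
Laplace transform at `t z` at least of order `exp (t²|z|² - O(t))`. The Husimi function of `σ`
involves the derivative of `B (expVec u)` along `c`, with `B` the square root of `ρ`; Cauchy's
estimate dominates it by a circle average of shifted Husimi functions of `ρ`. The shifts change the
exponent only to first order in `t`, so the growth is at most `exp (t² (weylVariance + |z|²)/2 +
O(t))`. Thus `|z|² ≤ weylVariance` for every `z`.

Existence of `σ` needs finite mean photon numbers, which follow from the finite second moments of
the Gaussian Husimi law. They make `B a†(c)` Hilbert–Schmidt, so it extends to a bounded `T`, and
`σ` is `T* T` divided by its trace. -/

/-! ### Monomials, exponential vectors and the Fock basis. -/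

/-- Absolutely convergent families indexed by occupation numbers multiply mode by mode. -/
lemma hasSum_prod_modes {n : ℕ} (f : Fin n → ℕ → ℂ) (hf : ∀ i, Summable fun m => ‖f i m‖) :
    (Summable fun k : Fin n → ℕ => ‖∏ i, f i (k i)‖) ∧
      HasSum (fun k : Fin n → ℕ => ∏ i, f i (k i)) (∏ i, ∑' m, f i m) := by
  induction n with
  | zero =>
    refine ⟨Summable.of_finite, ?_⟩
    simpa only [Finset.univ_eq_empty, Finset.prod_empty] using
      hasSum_unique (fun _ : Fin 0 → ℕ => (1 : ℂ))
  | succ n ih =>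
    obtain ⟨h1, h2⟩ := ih (fun i => f i.succ) (fun i => hf i.succ)
    have key := (Summable.mul_norm (hf 0) h1)
    let e : ℕ × (Fin n → ℕ) ≃ (Fin (n + 1) → ℕ) := Fin.consEquiv (fun _ => ℕ)
    have he : ∀ x, ∏ i, f i (e x i) = f 0 x.1 * ∏ i : Fin n, f i.succ (x.2 i) := fun x => by
      rw [Fin.prod_univ_succ]; rfl
    refine ⟨?_, ?_⟩
    · rw [← e.summable_iff]
      refine key.congr fun x => ?_
      rw [Function.comp_apply, he]
    · rw [← e.hasSum_iff]
      have hsum : Summable fun x : ℕ × (Fin n → ℕ) => f 0 x.1 * ∏ i : Fin n, f i.succ (x.2 i) :=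
        key.of_norm
      have := ((hf 0).of_norm.hasSum).mul h2 hsum
      rw [Fin.prod_univ_succ]
      have hfun : ((fun k => ∏ i, f i (k i)) ∘ e) =
          fun x : ℕ × (Fin n → ℕ) => f 0 x.1 * ∏ i : Fin n, f i.succ (x.2 i) := funext he
      rw [hfun]
      exact this

/-- The normalized monomial `∏ i, u i ^ k i / √(k i)!`. -/
def mono {n : ℕ} (k : Fin n → ℕ) (u : Fin n → ℂ) : ℂ :=
  ∏ i, (u i ^ k i / ((Real.sqrt (k i).factorial : ℝ) : ℂ))

lemma summable_pow_div_sqrt_factorial (r : ℝ) (hr : 0 ≤ r) :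
    Summable fun m : ℕ => r ^ m / Real.sqrt m.factorial := by
  -- The square of the term to be bounded is the product of these two nonnegative summands, hence at
  -- most the square of their sum.
  have h1 : Summable fun m : ℕ => (2 * r ^ 2) ^ m / (m.factorial : ℝ) + (1 / 2 : ℝ) ^ m :=
    (Real.summable_pow_div_factorial _).add summable_geometric_two
  refine Summable.of_nonneg_of_le (fun m => by positivity) (fun m => ?_) h1
  have hp : (0 : ℝ) < m.factorial := by positivity
  have hs : (r ^ m / Real.sqrt m.factorial) ^ 2 = (2 * r ^ 2) ^ m / m.factorial * (1 / 2) ^ m := by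
    rw [div_pow, Real.sq_sqrt hp.le, div_mul_eq_mul_div, ← mul_pow]
    ring_nf
  have ha : 0 ≤ (2 * r ^ 2) ^ m / (m.factorial : ℝ) := by positivity
  have hb : (0 : ℝ) ≤ (1 / 2) ^ m := by positivity
  refine abs_le_of_sq_le_sq' ?_ (by positivity) |>.2
  rw [hs]
  nlinarith [mul_nonneg ha hb]

/-- This is ℓ¹ decay, more than membership in Fock space requires; it drives the Weierstrass test in
`differentiable_expVec`. -/
lemma summable_norm_mono {n : ℕ} (u : Fin n → ℂ) :
    Summable fun k : Fin n → ℕ => ‖mono k u‖ := by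
  refine (hasSum_prod_modes (fun i m => u i ^ m / ((Real.sqrt m.factorial : ℝ) : ℂ))
    (fun i => ?_)).1
  refine (summable_pow_div_sqrt_factorial ‖u i‖ (norm_nonneg _)).congr fun m => ?_
  simp [abs_of_nonneg (Real.sqrt_nonneg _)]

lemma norm_mono_le {n : ℕ} (k : Fin n → ℕ) (u : Fin n → ℂ) (r : ℝ) (h : ∀ i, ‖u i‖ ≤ r) :
    ‖mono k u‖ ≤ ‖mono k (fun _ => (r : ℂ))‖ := by
  simp only [mono, norm_prod]
  refine Finset.prod_le_prod (fun i _ => norm_nonneg _) fun i _ => ?_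
  rw [norm_div, norm_div, norm_pow, norm_pow]
  gcongr
  refine (h i).trans ?_
  simpa using le_abs_self r

lemma conj_mono_mul_mono {n : ℕ} (k : Fin n → ℕ) (u v : Fin n → ℂ) :
    conj (mono k u) * mono k v = ∏ i, ((conj (u i) * v i) ^ k i / ((k i).factorial : ℂ)) := by
  simp only [mono, map_prod, ← Finset.prod_mul_distrib]
  refine Finset.prod_congr rfl fun i _ => ?_
  have h : (((Real.sqrt (k i).factorial : ℝ) : ℂ)) * ((Real.sqrt (k i).factorial : ℝ) : ℂ)
      = ((k i).factorial : ℂ) := by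
    rw [← Complex.ofReal_mul, Real.mul_self_sqrt (by positivity)]; simp
  rw [map_div₀, map_pow, Complex.conj_ofReal, div_mul_div_comm, h, mul_pow]

lemma hasSum_conj_mono_mul_mono {n : ℕ} (u v : Fin n → ℂ) :
    HasSum (fun k => conj (mono k u) * mono k v) (Complex.exp (∑ i, conj (u i) * v i)) := by
  have h := (hasSum_prod_modes (fun (i : Fin n) m => (conj (u i) * v i) ^ m / (m.factorial : ℂ))
    (fun i => by
      simpa using Real.summable_pow_div_factorial (‖conj (u i) * v i‖))).2
  rw [Complex.exp_sum]
  convert h using 2 with k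
  · rw [conj_mono_mul_mono]
  · rw [Complex.exp_eq_exp_ℂ, NormedSpace.exp_eq_tsum_div]

/-- The exponential vector `∑ k, mono k u |k⟩`, an unnormalized coherent state. -/
def expVec {n : ℕ} (u : Fin n → ℂ) : FockSpace n :=
  ⟨fun k => mono k u, by
    refine memℓp_gen ?_
    have := (hasSum_conj_mono_mul_mono u u).summable.norm
    refine this.congr fun k => ?_
    simp [sq]⟩

@[simp] lemma expVec_apply {n : ℕ} (u : Fin n → ℂ) (k : Fin n → ℕ) : expVec u k = mono k u := rfl

lemma inner_expVec_expVec {n : ℕ} (u v : Fin n → ℂ) :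
    inner ℂ (expVec u) (expVec v) = Complex.exp (∑ i, conj (u i) * v i) := by
  have h := lp.hasSum_inner (𝕜 := ℂ) (expVec u) (expVec v)
  have hf : (fun k => inner ℂ (expVec u k) (expVec v k)) =
      fun k => conj (mono k u) * mono k v := funext fun k => mul_comm _ _
  rw [hf] at h
  exact h.unique (hasSum_conj_mono_mul_mono u v)

lemma fock_eq_single {n : ℕ} (k : Fin n → ℕ) : fock k = lp.single 2 k (1 : ℂ) := by
  simp [fock, incl, basisVec]

lemma inner_fock_left {n : ℕ} (k : Fin n → ℕ) (ψ : FockSpace n) : inner ℂ (fock k) ψ = ψ k := by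
  rw [fock_eq_single, lp.inner_single_left]; simp

lemma inner_fock_right {n : ℕ} (k : Fin n → ℕ) (ψ : FockSpace n) :
    inner ℂ ψ (fock k) = conj (ψ k) := by
  rw [← inner_conj_symm, inner_fock_left]

@[simp] lemma norm_fock {n : ℕ} (k : Fin n → ℕ) : ‖fock k‖ = 1 := by
  rw [fock_eq_single, lp.norm_single (by norm_num)]; simp

@[simp] lemma incl_apply {n : ℕ} (φ : FiniteVectors n) (k : Fin n → ℕ) : incl n φ k = φ k := by
  rw [← inner_fock_left]
  induction φ using Finsupp.induction_linear with
  | zero => simp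
  | add f g hf hg => simp [hf, hg]
  | single l c =>
    have : incl n (Finsupp.single l c) = c • fock l := by simp [incl, fock, basisVec]
    rw [this, inner_smul_right, inner_fock_left, fock_eq_single, lp.single_apply,
      Finsupp.single_apply]
    by_cases h : l = k
    · subst h; simp
    · simp [h, Ne.symm h]

/-- The Fock states as a Hilbert basis. -/
def fockBasis (n : ℕ) : HilbertBasis (Fin n → ℕ) ℂ (FockSpace n) :=
  HilbertBasis.ofRepr (LinearIsometryEquiv.refl ℂ _)

lemma fockBasis_apply {n : ℕ} (k : Fin n → ℕ) : fockBasis n k = fock k := by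
  rw [fock_eq_single, ← HilbertBasis.repr_symm_single]; rfl

lemma hasSum_fock {n : ℕ} (ψ : FockSpace n) : HasSum (fun k => ψ k • fock k) ψ := by
  have h := (fockBasis n).hasSum_repr_symm ψ
  simp only [fockBasis_apply] at h
  exact h

lemma denseRange_incl (n : ℕ) : DenseRange (incl n) := by
  intro ψ
  refine mem_closure_of_tendsto (hasSum_fock ψ) (Filter.Eventually.of_forall fun s => ?_)
  refine ⟨∑ k ∈ s, ψ k • basisVec k, ?_⟩
  simp only [map_sum, map_smul]
  rfl

lemma ext_fock {n : ℕ} {S T : FockSpace n →L[ℂ] FockSpace n}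
    (h : ∀ k l, inner ℂ (fock k) (S (fock l)) = inner ℂ (fock k) (T (fock l))) : S = T := by
  have hl : ∀ l, S (fock l) = T (fock l) := fun l => by
    ext k
    simpa only [inner_fock_left] using h k l
  ext1 ψ
  exact ((hasSum_fock ψ).mapL S).unique (by simpa [hl] using (hasSum_fock ψ).mapL T)

lemma hasSum_inner_mul_inner {n : ℕ} (φ ψ : FockSpace n) :
    HasSum (fun k => inner ℂ φ (fock k) * inner ℂ (fock k) ψ) (inner ℂ φ ψ) := by
  simpa only [fockBasis_apply] using (fockBasis n).hasSum_inner_mul_inner φ ψ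

lemma hasSum_norm_sq {n : ℕ} (ψ : FockSpace n) :
    HasSum (fun k => ‖inner ℂ (fock k) ψ‖ ^ 2) (‖ψ‖ ^ 2) := by
  have h := hasSum_inner_mul_inner ψ ψ
  rw [inner_self_eq_norm_sq_to_K] at h
  rw [← Complex.hasSum_ofReal]
  push_cast
  refine h.congr_fun fun k => ?_
  rw [← inner_conj_symm ψ, ← Complex.conj_mul']

lemma norm_expVec_sq {n : ℕ} (u : Fin n → ℂ) :
    ‖expVec u‖ ^ 2 = Real.exp (∑ i, ‖u i‖ ^ 2) := by
  have h := inner_self_eq_norm_sq_to_K (𝕜 := ℂ) (expVec u)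
  rw [inner_expVec_expVec] at h
  apply Complex.ofReal_injective
  push_cast
  rw [← Complex.coe_algebraMap] at *
  simpa [Complex.conj_mul'] using h.symm

/-- The squared distance of two exponential vectors expands, by the kernel `inner_expVec_expVec`,
into an explicit continuous function. -/
lemma continuous_expVec (n : ℕ) : Continuous (expVec : (Fin n → ℂ) → FockSpace n) := by
  rw [continuous_iff_continuousAt]
  intro u
  rw [ContinuousAt, tendsto_iff_norm_sub_tendsto_zero]
  have h : ∀ v : Fin n → ℂ, ‖expVec v - expVec u‖ ^ 2 =
      Real.exp (∑ i, ‖v i‖ ^ 2) - 2 * (Complex.exp (∑ i, conj (v i) * u i)).re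
        + Real.exp (∑ i, ‖u i‖ ^ 2) := fun v => by
    rw [norm_sub_sq (𝕜 := ℂ), norm_expVec_sq, norm_expVec_sq, inner_expVec_expVec]; rfl
  have h2 : Filter.Tendsto (fun v : Fin n → ℂ => ‖expVec v - expVec u‖ ^ 2) (nhds u) (nhds 0) := by
    simp only [h]
    have hc : Continuous fun v : Fin n → ℂ => Real.exp (∑ i, ‖v i‖ ^ 2)
        - 2 * (Complex.exp (∑ i, conj (v i) * u i)).re + Real.exp (∑ i, ‖u i‖ ^ 2) := by
      have := Complex.continuous_conj
      fun_prop
    have h0 := h u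
    convert hc.tendsto u
    rw [← h0]; simp
  have h3 := (Real.continuous_sqrt.tendsto 0).comp h2
  simpa [Function.comp_def, Real.sqrt_sq (norm_nonneg _)] using h3

lemma hasSum_mono_smul_fock {n : ℕ} (u : Fin n → ℂ) :
    HasSum (fun k => mono k u • fock k) (expVec u) := hasSum_fock (expVec u)

/-! ### Holomorphy of exponential vectors and the action of creation operators on them. -/

lemma differentiable_mono {n : ℕ} (k : Fin n → ℕ) (u w : Fin n → ℂ) :
    Differentiable ℂ fun s : ℂ => mono k (u + s • w) := by
  unfold mono
  simp only [Pi.add_apply, Pi.smul_apply, smul_eq_mul]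
  fun_prop

/-- On each ball the monomials are dominated by their values at a constant vector, so the
Weierstrass test applies in norm. This holomorphy is what Cauchy's estimate and the analytic
continuation arguments rest on. -/
lemma differentiable_expVec {n : ℕ} (u w : Fin n → ℂ) :
    Differentiable ℂ fun s : ℂ => expVec (u + s • w) := by
  intro s
  set R : ℝ := ‖s‖ + 1
  set r : ℝ := ‖u‖ + R * ‖w‖
  have h := Complex.differentiableOn_tsum_of_summable_norm (U := Metric.ball (0 : ℂ) R)
    (F := fun k s => mono k (u + s • w) • fock k) (summable_norm_mono (fun _ : Fin n => (r : ℂ)))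
    (fun k => ((differentiable_mono k u w).smul_const _).differentiableOn) Metric.isOpen_ball
    (fun k t ht => by
      rw [norm_smul, norm_fock, mul_one]
      refine norm_mono_le k _ r fun i => ?_
      have ht' : ‖t‖ ≤ R := by simpa using (mem_ball_zero_iff.1 ht).le
      calc ‖(u + t • w) i‖ ≤ ‖u i‖ + ‖t‖ * ‖w i‖ := by
            simpa using norm_add_le (u i) (t * w i)
        _ ≤ r := by
            exact add_le_add (norm_le_pi_norm u i) (mul_le_mul ht' (norm_le_pi_norm w i)
              (norm_nonneg _) ((norm_nonneg _).trans ht')))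
  simp only [(hasSum_mono_smul_fock _).tsum_eq] at h
  exact h.differentiableAt (Metric.isOpen_ball.mem_nhds (by simp [R]))

/-- In the Bargmann representation creation is multiplication by a coordinate; `hasDerivAt_mono` is
the companion fact that annihilation is differentiation. -/
lemma mul_mono {n : ℕ} (k : Fin n → ℕ) (j : Fin n) (u : Fin n → ℂ) :
    u j * mono k u = ((Real.sqrt (k j + 1) : ℝ) : ℂ) * mono (k + Pi.single j 1) u := by
  obtain ⟨l, hl⟩ : ∃ l, l = k + Pi.single j 1 := ⟨_, rfl⟩
  have hlj : l j = k j + 1 := by simp [hl]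
  have hlx : ∀ x, x ≠ j → l x = k x := fun x hx => by simp [hl, hx]
  rw [← hl, mono, mono, ← Finset.mul_prod_erase _ _ (Finset.mem_univ j),
    ← Finset.mul_prod_erase _ (fun i => u i ^ l i / ((Real.sqrt (l i).factorial : ℝ) : ℂ))
      (Finset.mem_univ j)]
  have h1 : ∏ x ∈ Finset.univ.erase j, (u x ^ l x / ((Real.sqrt (l x).factorial : ℝ) : ℂ))
      = ∏ x ∈ Finset.univ.erase j, (u x ^ k x / ((Real.sqrt (k x).factorial : ℝ) : ℂ)) :=
    Finset.prod_congr rfl fun x hx => by rw [hlx x (Finset.ne_of_mem_erase hx)]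
  rw [h1, hlj]
  have h2 : ((Real.sqrt (k j + 1).factorial : ℝ) : ℂ)
      = ((Real.sqrt (k j + 1) : ℝ) : ℂ) * ((Real.sqrt (k j).factorial : ℝ) : ℂ) := by
    rw [← Complex.ofReal_mul, ← Real.sqrt_mul (by positivity)]
    push_cast [Nat.factorial_succ]; rfl
  have h3 : ((Real.sqrt (k j + 1) : ℝ) : ℂ) ≠ 0 := by
    rw [Complex.ofReal_ne_zero]; positivity
  have h4 : ((Real.sqrt (k j).factorial : ℝ) : ℂ) ≠ 0 := by
    rw [Complex.ofReal_ne_zero]; positivity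
  rw [h2]
  field_simp
  ring

lemma hasDerivAt_mono {n : ℕ} (k : Fin n → ℕ) (u w : Fin n → ℂ) (s : ℂ) :
    HasDerivAt (fun s : ℂ => mono k (u + s • w))
      (∑ j, w j * (((Real.sqrt (k j) : ℝ) : ℂ) * mono (k - Pi.single j 1) (u + s • w))) s := by
  have h : ∀ i ∈ (Finset.univ : Finset (Fin n)), HasDerivAt
      (fun s : ℂ => (u + s • w) i ^ k i / ((Real.sqrt (k i).factorial : ℝ) : ℂ))
      ((k i * (u + s • w) i ^ (k i - 1) * w i) / ((Real.sqrt (k i).factorial : ℝ) : ℂ)) s := by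
    intro i _
    refine HasDerivAt.div_const ?_ _
    refine HasDerivAt.pow ?_ _
    simpa using ((hasDerivAt_id s).mul_const (w i)).const_add (u i)
  refine (HasDerivAt.fun_finsetProd h).congr_deriv ?_
  refine Finset.sum_congr rfl fun j _ => ?_
  generalize u + s • w = v
  rw [mono, ← Finset.mul_prod_erase _ _ (Finset.mem_univ j), smul_eq_mul]
  have h1 : ∏ x ∈ Finset.univ.erase j,
        (v x ^ (k - Pi.single j 1 : Fin n → ℕ) x /
          ((Real.sqrt ((k - Pi.single j 1 : Fin n → ℕ) x).factorial : ℝ) : ℂ))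
      = ∏ x ∈ Finset.univ.erase j, (v x ^ k x / ((Real.sqrt (k x).factorial : ℝ) : ℂ)) :=
    Finset.prod_congr rfl fun x hx => by simp [Finset.ne_of_mem_erase hx]
  rw [h1]
  simp only [Pi.sub_apply, Pi.single_eq_same]
  -- When `k j = 0` the truncated subtraction leaves `k` unchanged, but both sides carry a vanishing
  -- factor.
  rcases Nat.eq_zero_or_pos (k j) with h0 | h0
  · simp [h0]
  · obtain ⟨m, hm⟩ := Nat.exists_eq_succ_of_ne_zero h0.ne'
    have h2 : ((Real.sqrt (m + 1).factorial : ℝ) : ℂ)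
        = ((Real.sqrt (m + 1) : ℝ) : ℂ) * ((Real.sqrt m.factorial : ℝ) : ℂ) := by
      rw [← Complex.ofReal_mul, ← Real.sqrt_mul (by positivity)]
      push_cast [Nat.factorial_succ]; rfl
    have h3 : ((Real.sqrt (m + 1) : ℝ) : ℂ) ≠ 0 := by
      rw [Complex.ofReal_ne_zero]; positivity
    have h4 : ((Real.sqrt m.factorial : ℝ) : ℂ) ≠ 0 := by
      rw [Complex.ofReal_ne_zero]; positivity
    have h5 : ((Real.sqrt (m + 1) : ℝ) : ℂ) ^ 2 = m + 1 := by
      rw [← Complex.ofReal_pow, Real.sq_sqrt (by positivity)]; push_cast; rfl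
    rw [hm]
    simp only [Nat.succ_eq_add_one, Nat.add_sub_cancel, Nat.cast_add, Nat.cast_one]
    rw [h2]
    field_simp
    rw [h5]
    ring

lemma creation_basisVec {n : ℕ} (j : Fin n) (k : Fin n → ℕ) :
    creation j (basisVec k) = ((Real.sqrt (k j + 1) : ℝ) : ℂ) • basisVec (k + Pi.single j 1) := by
  simp [creation, basisVec]

lemma annihilation_basisVec {n : ℕ} (j : Fin n) (k : Fin n → ℕ) :
    annihilation j (basisVec k) =
      ((Real.sqrt (k j) : ℝ) : ℂ) • basisVec (k - Pi.single j 1) := by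
  simp [annihilation, basisVec]

lemma incl_basisVec {n : ℕ} (k : Fin n → ℕ) : incl n (basisVec k) = fock k := rfl

lemma linearMap_ext_basisVec {n : ℕ} {E : Type*} [AddCommMonoid E] [Module ℂ E]
    {S T : FiniteVectors n →ₗ[ℂ] E} (h : ∀ k, S (basisVec k) = T (basisVec k)) : S = T := by
  refine Finsupp.lhom_ext' fun k => LinearMap.ext_ring ?_
  exact h k

lemma fock_apply {n : ℕ} (k l : Fin n → ℕ) : (fock k : FockSpace n) l = if l = k then 1 else 0 := by
  rw [fock_eq_single, lp.single_apply, Pi.single_apply]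

lemma inner_expVec_fock {n : ℕ} (u : Fin n → ℂ) (k : Fin n → ℕ) :
    inner ℂ (expVec u) (fock k) = conj (mono k u) := by
  rw [inner_fock_right]; rfl

/-- Exponential vectors are eigenvectors of annihilation operators. -/
lemma inner_expVec_aDag {n : ℕ} (c u : Fin n → ℂ) (φ : FiniteVectors n) :
    inner ℂ (expVec u) (incl n (aDag c φ)) =
      (∑ i, c i * conj (u i)) * inner ℂ (expVec u) (incl n φ) := by
  have h : (innerₛₗ ℂ (expVec u)).comp ((incl n).comp (aDag c)) =
      (∑ i, c i * conj (u i)) • (innerₛₗ ℂ (expVec u)).comp (incl n) := by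
    refine linearMap_ext_basisVec fun k => ?_
    simp only [aDag, LinearMap.comp_apply, LinearMap.sum_apply, LinearMap.smul_apply,
      creation_basisVec, map_sum, map_smul, incl_basisVec, innerₛₗ_apply_apply, inner_expVec_fock,
      smul_eq_mul, Finset.sum_mul]
    refine Finset.sum_congr rfl fun j _ => ?_
    have := congrArg conj (mul_mono k j u)
    simp only [map_mul, Complex.conj_ofReal] at this
    rw [← this]; ring
  simpa using LinearMap.congr_fun h φ

/-- The derivative of the exponential vectors at `u` in the direction `w`. -/
def expVecDeriv {n : ℕ} (u w : Fin n → ℂ) : FockSpace n :=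
  deriv (fun s : ℂ => expVec (u + s • w)) 0

lemma hasDerivAt_inner_expVec {n : ℕ} (ψ : FockSpace n) (u w : Fin n → ℂ) :
    HasDerivAt (fun s : ℂ => inner ℂ ψ (expVec (u + s • w)))
      (inner ℂ ψ (expVecDeriv u w)) 0 :=
  (innerSL ℂ ψ).hasFDerivAt.comp_hasDerivAt (0 : ℂ)
    ((differentiable_expVec u w) 0).hasDerivAt

lemma expVecDeriv_apply {n : ℕ} (u w : Fin n → ℂ) (k : Fin n → ℕ) :
    expVecDeriv u w k =
      ∑ j, w j * (((Real.sqrt (k j) : ℝ) : ℂ) * mono (k - Pi.single j 1) u) := by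
  have h1 := hasDerivAt_inner_expVec (fock k) u w
  simp only [inner_fock_left] at h1
  have h2 := hasDerivAt_mono k u w 0
  simp only [zero_smul, add_zero] at h2
  exact h1.unique h2

lemma sqrt_succ_le (m : ℕ) : Real.sqrt (m + 1) ≤ 2 ^ m := by
  rw [Real.sqrt_le_left (by positivity)]
  have h : (m + 1 : ℝ) ≤ 2 ^ m := by exact_mod_cast Nat.lt_two_pow_self
  have h1 : (1 : ℝ) ≤ 2 ^ m := one_le_pow₀ (by norm_num)
  nlinarith

/-- Doubling `u` multiplies the monomial by `2 ^ ∑ k`, which dominates the square root. -/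
lemma summable_norm_mono_mul_sqrt {n : ℕ} (u : Fin n → ℂ) (j : Fin n) :
    Summable fun k : Fin n → ℕ => ‖mono k u‖ * Real.sqrt (k j + 1) := by
  refine Summable.of_nonneg_of_le (fun k => by positivity) (fun k => ?_)
    (summable_norm_mono (fun i => 2 * u i))
  have h : mono k (fun i => 2 * u i) = mono k u * ∏ i, (2 : ℂ) ^ k i := by
    simp only [mono, ← Finset.prod_mul_distrib]
    refine Finset.prod_congr rfl fun i _ => ?_
    rw [mul_pow]; ring
  rw [h, norm_mul]
  refine mul_le_mul_of_nonneg_left ?_ (norm_nonneg _)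
  refine (sqrt_succ_le _).trans ?_
  rw [norm_prod]
  simp only [norm_pow, Complex.norm_ofNat]
  rw [Finset.prod_pow_eq_pow_sum]
  exact pow_le_pow_right₀ (by norm_num)
    (Finset.single_le_sum (f := k) (fun i _ => Nat.zero_le _) (Finset.mem_univ j))

/-- Formally `a†(c) expVec u` is the derivative of `expVec` along `c`. Since `a†(c)` lives only on
finite vectors, this is expressed by applying it to the truncated expansions and passing to the
limit; the matrix elements of the subtracted state are later continued this way. -/
lemma hasSum_mono_smul_aDag {n : ℕ} (c u : Fin n → ℂ) :
    HasSum (fun k => mono k u • incl n (aDag c (basisVec k))) (expVecDeriv u c) := by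
  have hs : Summable fun k => mono k u • incl n (aDag c (basisVec k)) := by
    have h : ∀ k : Fin n → ℕ, mono k u • incl n (aDag c (basisVec k)) =
        ∑ j, (c j * (mono k u * ((Real.sqrt (k j + 1) : ℝ) : ℂ))) • fock (k + Pi.single j 1) := by
      intro k
      simp only [aDag, LinearMap.sum_apply, LinearMap.smul_apply, creation_basisVec, map_sum,
        map_smul, incl_basisVec, Finset.smul_sum, smul_smul]
      refine Finset.sum_congr rfl fun j _ => ?_
      congr 1; ring
    simp only [h]
    refine summable_sum fun j _ => Summable.of_norm ?_
    refine ((summable_norm_mono_mul_sqrt u j).mul_left ‖c j‖).congr fun k => ?_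
    rw [norm_smul, norm_fock, mul_one, norm_mul, norm_mul, Complex.norm_real, Real.norm_eq_abs,
      abs_of_nonneg (Real.sqrt_nonneg _)]
  obtain ⟨v, hv⟩ := hs
  convert hv
  ext l
  have h1 := hv.mapL (innerSL ℂ (fock l))
  simp only [innerSL_apply_apply, inner_fock_left] at h1
  refine HasSum.unique ?_ h1
  rw [expVecDeriv_apply]
  have h2 : ∀ k : Fin n → ℕ, (mono k u • incl n (aDag c (basisVec k))) l =
      ∑ j, c j * (mono k u * ((Real.sqrt (k j + 1) : ℝ) : ℂ) *
        if l = k + Pi.single j 1 then 1 else 0) := by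
    intro k
    rw [← inner_fock_left, inner_smul_right]
    simp only [aDag, LinearMap.sum_apply, LinearMap.smul_apply, creation_basisVec, map_sum,
      map_smul, incl_basisVec, inner_sum, inner_smul_right, inner_fock_left, fock_apply,
      Finset.mul_sum]
    refine Finset.sum_congr rfl fun j _ => ?_
    ring
  simp only [h2]
  refine hasSum_sum fun j _ => HasSum.mul_left _ ?_
  -- If `l j = 0` no occupation vector is raised to `l`, and the other side vanishes through `√(l j)
  -- = 0`; otherwise exactly one is.
  by_cases h0 : l j = 0
  · have h3 : ∀ k : Fin n → ℕ, l ≠ k + Pi.single j 1 := fun k hk => by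
      have := congrFun hk j
      simp [h0] at this
    simp [h3, h0]
  · have h3 : ∀ k : Fin n → ℕ, l = k + Pi.single j 1 ↔ k = l - Pi.single j 1 := fun k => by
      constructor
      · rintro rfl; ext i; simp
      · rintro rfl
        ext i
        by_cases hi : i = j
        · subst hi; simp; omega
        · simp [hi]
    have h4 : ((l - Pi.single j 1 : Fin n → ℕ) j : ℝ) + 1 = l j := by
      have : (l - Pi.single j 1 : Fin n → ℕ) j + 1 = l j := by simp; omega
      exact_mod_cast this
    have h5 := hasSum_ite_eq (l - Pi.single j 1)
      (((Real.sqrt (l j) : ℝ) : ℂ) * mono (l - Pi.single j 1) u)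
    refine (congrArg (fun f => HasSum f _) (funext fun k => ?_)).mp h5
    by_cases hk : k = l - Pi.single j 1
    · rw [if_pos hk, if_pos ((h3 k).2 hk), hk, h4]; ring
    · rw [if_neg hk, if_neg (fun h => hk ((h3 k).1 h)), mul_zero]

/-! ### Gaussian integrals on phase space and the resolution of the identity. -/

/-- The measure `d²u / π` on the phase space of one mode. -/
def modeMeasure : Measure ℂ := ENNReal.ofReal Real.pi⁻¹ • volume

instance : IsFiniteMeasureOnCompacts modeMeasure := ⟨fun K hK => by
  simpa [modeMeasure] using ENNReal.mul_lt_top ENNReal.ofReal_lt_top hK.measure_lt_top⟩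

instance : modeMeasure.IsOpenPosMeasure :=
  Measure.isOpenPosMeasure_smul volume (by simp [Real.pi_pos])

instance : SigmaFinite modeMeasure := by infer_instance
instance : modeMeasure.IsAddLeftInvariant := by unfold modeMeasure; infer_instance

/-- The measure `d²ⁿu / πⁿ` on phase space. -/
def phaseMeasure (n : ℕ) : Measure (Fin n → ℂ) := Measure.pi fun _ => modeMeasure

instance (n : ℕ) : SigmaFinite (phaseMeasure n) := by unfold phaseMeasure; infer_instance
instance (n : ℕ) : (phaseMeasure n).IsAddLeftInvariant := by unfold phaseMeasure; infer_instance
instance (n : ℕ) : (phaseMeasure n).IsOpenPosMeasure := by unfold phaseMeasure; infer_instance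

/-- In real coordinates the integral splits into two one-dimensional Gaussians with linear
coefficients `a + b` and `i (a - b)`; their exponents add up to `a b`, and the two factors `√π`
cancel the normalization of the measure. -/
lemma gaussian_mode (a b : ℂ) :
    Integrable (fun u : ℂ => Complex.exp (a * u + b * conj u - ‖u‖ ^ 2)) modeMeasure ∧
      ∫ u, Complex.exp (a * u + b * conj u - ‖u‖ ^ 2) ∂modeMeasure = Complex.exp (a * b) := by
  have hre : (-1 : ℂ).re < 0 := by simp
  have hf : ∀ p : ℝ × ℝ, Complex.exp (a * (Complex.measurableEquivRealProd.symm p) +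
        b * conj (Complex.measurableEquivRealProd.symm p)
        - ‖Complex.measurableEquivRealProd.symm p‖ ^ 2) =
      Complex.exp (-1 * (p.1 : ℂ) ^ 2 + (a + b) * p.1 + 0) *
        Complex.exp (-1 * (p.2 : ℂ) ^ 2 + (Complex.I * (a - b)) * p.2 + 0) := by
    rintro ⟨x, y⟩
    rw [← Complex.exp_add]
    congr 1
    have h1 : Complex.measurableEquivRealProd.symm (x, y) = x + y * Complex.I := by
      apply Complex.ext <;> simp [Complex.measurableEquivRealProd]
    rw [h1, ← Complex.ofReal_pow, Complex.sq_norm, Complex.normSq_add_mul_I]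
    simp only [map_add, map_mul, Complex.conj_ofReal, Complex.conj_I]
    push_cast
    ring
  have hi1 := integrable_cexp_quadratic' hre (a + b) 0
  have hi2 := integrable_cexp_quadratic' hre (Complex.I * (a - b)) 0
  have hint := hi1.mul_prod hi2
  have hval := integral_prod_mul (μ := (volume : Measure ℝ)) (ν := (volume : Measure ℝ))
    (fun x : ℝ => Complex.exp (-1 * (x : ℂ) ^ 2 + (a + b) * x + 0))
    (fun y : ℝ => Complex.exp (-1 * (y : ℂ) ^ 2 + (Complex.I * (a - b)) * y + 0))
  have hmp := Complex.volume_preserving_equiv_real_prod.symm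
  constructor
  · refine Integrable.smul_measure ?_ ENNReal.ofReal_ne_top
    rw [← hmp.integrable_comp_emb (MeasurableEquiv.measurableEmbedding _)]
    simp only [Function.comp_def, hf]
    exact hint
  · rw [modeMeasure, integral_smul_measure,
      ← hmp.integral_comp (MeasurableEquiv.measurableEmbedding _)]
    simp only [hf]
    rw [← Measure.volume_eq_prod] at hval
    rw [hval, integral_cexp_quadratic hre, integral_cexp_quadratic hre]
    have hpi : (Real.pi / -(-1) : ℂ) ^ (1 / 2 : ℂ) * (Real.pi / -(-1) : ℂ) ^ (1 / 2 : ℂ)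
        = Real.pi := by
      have h0 : (Real.pi / -(-1) : ℂ) ≠ 0 := by simp [Real.pi_ne_zero]
      rw [← Complex.cpow_add _ _ h0]
      norm_num
    rw [mul_mul_mul_comm, hpi, ← Complex.exp_add]
    have he : (0 - (a + b) ^ 2 / (4 * -1) + (0 - (Complex.I * (a - b)) ^ 2 / (4 * -1))) = a * b := by
      rw [mul_pow, Complex.I_sq]; ring
    rw [he, ENNReal.toReal_ofReal (by positivity), Complex.real_smul, ← mul_assoc]
    rw [← Complex.ofReal_mul, inv_mul_cancel₀ Real.pi_ne_zero]
    simp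

lemma gaussian_phase {n : ℕ} (a b : Fin n → ℂ) :
    Integrable (fun u : Fin n → ℂ =>
        Complex.exp (∑ i, a i * u i + ∑ i, b i * conj (u i) - ∑ i, (‖u i‖ : ℂ) ^ 2))
        (phaseMeasure n) ∧
      ∫ u, Complex.exp (∑ i, a i * u i + ∑ i, b i * conj (u i) - ∑ i, (‖u i‖ : ℂ) ^ 2)
        ∂phaseMeasure n = Complex.exp (∑ i, a i * b i) := by
  have h : ∀ u : Fin n → ℂ,
      Complex.exp (∑ i, a i * u i + ∑ i, b i * conj (u i) - ∑ i, (‖u i‖ : ℂ) ^ 2) =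
        ∏ i, Complex.exp (a i * u i + b i * conj (u i) - ‖u i‖ ^ 2) := fun u => by
    rw [← Complex.exp_sum, Finset.sum_sub_distrib, Finset.sum_add_distrib]
  simp only [h]
  constructor
  · exact Integrable.fintype_prod (fun i => (gaussian_mode (a i) (b i)).1)
  · rw [phaseMeasure, integral_fintype_prod_eq_prod
      (fun i (u : ℂ) => Complex.exp (a i * u + b i * conj u - ‖u‖ ^ 2)), Complex.exp_sum]
    exact Finset.prod_congr rfl fun i _ => (gaussian_mode (a i) (b i)).2

lemma integral_norm_pow_mode (m : ℕ) :
    ∫ u : ℂ, ‖u‖ ^ m * Real.exp (-‖u‖ ^ 2) = Real.pi * Real.Gamma ((m + 2) / 2) := by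
  have h := Complex.integral_rpow_mul_exp_neg_rpow (p := 2) (q := m) (by norm_num)
    (by linarith [(Nat.cast_nonneg m : (0:ℝ) ≤ m)])
  simpa using h

/-- A non-integrable function has Bochner integral zero, while the Gamma value computed for this one
is positive. -/
lemma integrable_norm_pow_mode (m : ℕ) :
    Integrable (fun u : ℂ => ‖u‖ ^ m * Real.exp (-‖u‖ ^ 2)) := by
  by_contra h
  have h1 := integral_norm_pow_mode m
  rw [integral_undef h] at h1
  have : 0 < Real.pi * Real.Gamma (((m : ℝ) + 2) / 2) :=
    mul_pos Real.pi_pos (Real.Gamma_pos_of_pos (by positivity))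
  linarith

lemma orthogonality_mode (k l : ℕ) :
    Integrable (fun u : ℂ => conj u ^ l * u ^ k * Real.exp (-‖u‖ ^ 2)) modeMeasure ∧
      ∫ u : ℂ, conj u ^ l * u ^ k * Real.exp (-‖u‖ ^ 2) ∂modeMeasure =
        if k = l then (k.factorial : ℂ) else 0 := by
  constructor
  · refine Integrable.smul_measure ?_ ENNReal.ofReal_ne_top
    refine (integrable_norm_pow_mode (l + k)).mono' ?_ (Filter.Eventually.of_forall fun u => ?_)
    · have := Complex.continuous_conj
      exact (by fun_prop : Continuous fun u : ℂ =>
        conj u ^ l * u ^ k * (Real.exp (-‖u‖ ^ 2) : ℂ)).aestronglyMeasurable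
    · rw [norm_mul, norm_mul, norm_pow, norm_pow, RCLike.norm_conj, ← pow_add, Complex.norm_real,
        Real.norm_eq_abs, abs_of_pos (Real.exp_pos _)]
  · rw [modeMeasure, integral_smul_measure, ENNReal.toReal_ofReal (by positivity)]
    split_ifs with hkl
    · subst hkl
      have h1 : ∀ u : ℂ, conj u ^ k * u ^ k * (Real.exp (-‖u‖ ^ 2) : ℂ) =
          ((‖u‖ ^ (2 * k) * Real.exp (-‖u‖ ^ 2) : ℝ) : ℂ) := fun u => by
        rw [← mul_pow, Complex.conj_mul', pow_mul]; push_cast; rfl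
      simp only [h1]
      rw [integral_complex_ofReal, integral_norm_pow_mode]
      have h2 : (((2 * k : ℕ) : ℝ) + 2) / 2 = k + 1 := by push_cast; ring
      rw [h2, Real.Gamma_nat_eq_factorial, Complex.real_smul, ← Complex.ofReal_mul, ← mul_assoc,
        inv_mul_cancel₀ Real.pi_ne_zero, one_mul]
      simp
    · set f : ℂ → ℂ := fun u => conj u ^ l * u ^ k * (Real.exp (-‖u‖ ^ 2) : ℂ) with hf
      have hrot : ∀ θ : ℝ, ∫ u, f u = Complex.exp (θ * Complex.I * (k - l)) * ∫ u, f u := by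
        intro θ
        have h1 := (rotation (Circle.exp θ)).measurePreserving.integral_comp
          (rotation (Circle.exp θ)).toHomeomorph.measurableEmbedding f
        conv_lhs => rw [← h1]
        rw [← integral_const_mul]
        congr 1
        ext u
        simp only [hf, rotation_apply, map_mul, norm_mul, mul_pow, Circle.coe_exp,
          Complex.norm_exp_ofReal_mul_I, one_mul]
        have h2 : conj (Complex.exp (θ * Complex.I)) ^ l * Complex.exp (θ * Complex.I) ^ k
            = Complex.exp (θ * Complex.I * (k - l)) := by
          rw [← Complex.exp_conj, ← Complex.exp_nat_mul, ← Complex.exp_nat_mul, ← Complex.exp_add]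
          congr 1
          simp only [map_mul, Complex.conj_ofReal, Complex.conj_I]
          ring
        rw [← h2]; ring
      have hne : ((k : ℝ) - l) ≠ 0 := sub_ne_zero.2 (by exact_mod_cast hkl)
      -- Rotating by this angle multiplies the integral by `exp (iπ) = -1`, so it vanishes.
      have h3 := hrot (Real.pi / (k - l))
      have h4 : ((Real.pi / (k - l) : ℝ) : ℂ) * Complex.I * (k - l) = Real.pi * Complex.I := by
        have : ((k : ℂ) - l) ≠ 0 := by exact_mod_cast hne
        push_cast
        field_simp
      rw [h4, Complex.exp_pi_mul_I] at h3
      have h5 : ∫ u, f u = 0 := by linear_combination h3 / 2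
      rw [h5, smul_zero]

/-- The normalized exponential vector. -/
def cohVec {n : ℕ} (u : Fin n → ℂ) : FockSpace n :=
  ((Real.exp (-(∑ i, ‖u i‖ ^ 2) / 2) : ℝ) : ℂ) • expVec u

lemma norm_cohVec {n : ℕ} (u : Fin n → ℂ) : ‖cohVec u‖ = 1 := by
  have h : ‖cohVec u‖ ^ 2 = 1 := by
    rw [cohVec, norm_smul, mul_pow, norm_expVec_sq, Complex.norm_real, Real.norm_eq_abs, sq_abs,
      ← Real.exp_nat_mul, ← Real.exp_add]
    simp only [Real.exp_eq_one_iff]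
    push_cast
    ring
  exact (pow_eq_one_iff_of_nonneg (norm_nonneg _) two_ne_zero).1 h

lemma continuous_cohVec (n : ℕ) : Continuous (cohVec : (Fin n → ℂ) → FockSpace n) := by
  unfold cohVec
  have := continuous_expVec n
  fun_prop

lemma orthogonality_phase {n : ℕ} (k l : Fin n → ℕ) :
    Integrable (fun u : Fin n → ℂ => inner ℂ (fock k) (cohVec u) * inner ℂ (cohVec u) (fock l))
        (phaseMeasure n) ∧
      ∫ u, inner ℂ (fock k) (cohVec u) * inner ℂ (cohVec u) (fock l) ∂phaseMeasure n =
        inner ℂ (fock k) (fock l) := by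
  have h : ∀ u : Fin n → ℂ, inner ℂ (fock k) (cohVec u) * inner ℂ (cohVec u) (fock l) =
      ∏ i, ((((Real.sqrt (k i).factorial : ℝ) : ℂ) * ((Real.sqrt (l i).factorial : ℝ) : ℂ))⁻¹ *
        (conj (u i) ^ l i * u i ^ k i * Real.exp (-‖u i‖ ^ 2))) := by
    intro u
    rw [cohVec, inner_smul_right, inner_smul_left, inner_expVec_fock, inner_fock_left,
      expVec_apply, Complex.conj_ofReal, mul_mul_mul_comm, ← Complex.ofReal_mul, ← Real.exp_add]
    have h1 : -(∑ i, ‖u i‖ ^ 2) / 2 + -(∑ i, ‖u i‖ ^ 2) / 2 = ∑ i, -‖u i‖ ^ 2 := by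
      rw [Finset.sum_neg_distrib]; ring
    rw [h1, Real.exp_sum, mono, mono, map_prod, Complex.ofReal_prod, ← Finset.prod_mul_distrib,
      ← Finset.prod_mul_distrib]
    refine Finset.prod_congr rfl fun i _ => ?_
    rw [map_div₀, map_pow, Complex.conj_ofReal]
    field_simp
  simp only [h]
  constructor
  · exact Integrable.fintype_prod (fun i => ((orthogonality_mode (k i) (l i)).1.const_mul _))
  · rw [phaseMeasure, integral_fintype_prod_eq_prod (fun i (u : ℂ) =>
      (((Real.sqrt (k i).factorial : ℝ) : ℂ) * ((Real.sqrt (l i).factorial : ℝ) : ℂ))⁻¹ *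
        (conj u ^ l i * u ^ k i * (Real.exp (-‖u‖ ^ 2) : ℂ)))]
    simp only [integral_const_mul, (orthogonality_mode _ _).2]
    rw [inner_fock_left, fock_apply]
    split_ifs with hkl
    · subst hkl
      refine Finset.prod_eq_one fun i _ => ?_
      rw [if_pos rfl, ← Complex.ofReal_mul, Real.mul_self_sqrt (by positivity)]
      have : ((k i).factorial : ℂ) ≠ 0 := by exact_mod_cast (Nat.factorial_ne_zero _)
      simp [this]
    · obtain ⟨i, hi⟩ := Function.ne_iff.1 hkl
      exact Finset.prod_eq_zero (Finset.mem_univ i) (by simp [hi])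

/-- The analysis operator `ψ ↦ (x ↦ ⟨v x, ψ⟩)` of a Bessel family of vectors. -/
lemma exists_analysisOperator {X H : Type*} [MeasurableSpace X] {ν : Measure X}
    [NormedAddCommGroup H] [InnerProductSpace ℂ H] {v : X → H} (hv : AEStronglyMeasurable v ν)
    {C : ℝ} (hb : ∀ ψ, eLpNorm (fun x => inner ℂ (v x) ψ) 2 ν ≤ ENNReal.ofReal (C * ‖ψ‖)) :
    ∃ T : H →L[ℂ] Lp ℂ 2 ν, ∀ ψ, T ψ =ᵐ[ν] fun x => inner ℂ (v x) ψ := by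
  have hmem : ∀ ψ, MemLp (fun x => inner ℂ (v x) ψ) 2 ν := fun ψ =>
    ⟨hv.inner aestronglyMeasurable_const, (hb ψ).trans_lt ENNReal.ofReal_lt_top⟩
  let T₀ : H →ₗ[ℂ] Lp ℂ 2 ν :=
    { toFun := fun ψ => (hmem ψ).toLp _
      map_add' := fun φ ψ => by
        rw [← MemLp.toLp_add]
        exact MemLp.toLp_congr _ _ (Filter.Eventually.of_forall fun x => inner_add_right _ _ _)
      map_smul' := fun c ψ => by
        rw [RingHom.id_apply, ← MemLp.toLp_const_smul]
        exact MemLp.toLp_congr _ _ (Filter.Eventually.of_forall fun x => inner_smul_right _ _ _) }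
  have hbound : ∀ ψ, ‖T₀ ψ‖ ≤ max C 0 * ‖ψ‖ := fun ψ => by
    change ‖(hmem ψ).toLp _‖ ≤ _
    rw [Lp.norm_toLp]
    refine ENNReal.toReal_le_of_le_ofReal (by positivity) ((hb ψ).trans ?_)
    exact ENNReal.ofReal_le_ofReal
      (mul_le_mul_of_nonneg_right (le_max_left _ _) (norm_nonneg _))
  exact ⟨T₀.mkContinuous _ hbound, fun ψ => (hmem ψ).coeFn_toLp⟩

/-- The operator `∫ |v x⟩⟨w x| dν(x)` of two Bessel families. -/
lemma exists_frameOperator {X H : Type*} [MeasurableSpace X] {ν : Measure X}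
    [NormedAddCommGroup H] [InnerProductSpace ℂ H] [CompleteSpace H] {v w : X → H}
    (hv : AEStronglyMeasurable v ν) (hw : AEStronglyMeasurable w ν) {C D : ℝ}
    (hbv : ∀ ψ, eLpNorm (fun x => inner ℂ (v x) ψ) 2 ν ≤ ENNReal.ofReal (C * ‖ψ‖))
    (hbw : ∀ ψ, eLpNorm (fun x => inner ℂ (w x) ψ) 2 ν ≤ ENNReal.ofReal (D * ‖ψ‖)) :
    ∃ S : H →L[ℂ] H, ∀ φ ψ, Integrable (fun x => inner ℂ φ (v x) * inner ℂ (w x) ψ) ν ∧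
      inner ℂ φ (S ψ) = ∫ x, inner ℂ φ (v x) * inner ℂ (w x) ψ ∂ν := by
  obtain ⟨T, hT⟩ := exists_analysisOperator hv hbv
  obtain ⟨U, hU⟩ := exists_analysisOperator hw hbw
  refine ⟨T.adjoint ∘L U, fun φ ψ => ?_⟩
  have hae : (fun x => inner ℂ (T φ x) (U ψ x)) =ᵐ[ν]
      fun x => inner ℂ φ (v x) * inner ℂ (w x) ψ := by
    filter_upwards [hT φ, hU ψ] with x h1 h2
    rw [h1, h2, RCLike.inner_apply, inner_conj_symm, mul_comm]
  refine ⟨(L2.integrable_inner (𝕜 := ℂ) (T φ) (U ψ)).congr hae, ?_⟩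
  rw [ContinuousLinearMap.comp_apply, ContinuousLinearMap.adjoint_inner_right, L2.inner_def]
  exact integral_congr_ae hae

/-- Over a probability measure boundedness alone gives the Bessel property, which is how mixtures of
coherent states become bounded operators. -/
lemma eLpNorm_inner_of_norm_le_one {X H : Type*} [MeasurableSpace X] {ν : Measure X}
    [IsProbabilityMeasure ν] [NormedAddCommGroup H] [InnerProductSpace ℂ H] {v : X → H}
    (hv : ∀ x, ‖v x‖ ≤ 1) (ψ : H) :
    eLpNorm (fun x => inner ℂ (v x) ψ) 2 ν ≤ ENNReal.ofReal (1 * ‖ψ‖) := by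
  refine (eLpNorm_le_of_ae_bound (C := 1 * ‖ψ‖) (Filter.Eventually.of_forall fun x =>
    (norm_inner_le_norm _ _).trans
      (mul_le_mul_of_nonneg_right (hv x) (norm_nonneg _)))).trans ?_
  simp

lemma resolution_finite {n : ℕ} (φ ψ : FiniteVectors n) :
    Integrable (fun u : Fin n → ℂ => inner ℂ (incl n φ) (cohVec u) * inner ℂ (cohVec u) (incl n ψ))
        (phaseMeasure n) ∧
      ∫ u, inner ℂ (incl n φ) (cohVec u) * inner ℂ (cohVec u) (incl n ψ) ∂phaseMeasure n =
        inner ℂ (incl n φ) (incl n ψ) := by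
  have hsm : ∀ (k : Fin n → ℕ) (c : ℂ), incl n (Finsupp.single k c) = c • fock k := fun k c => by
    simp [incl, fock, basisVec]
  induction φ using Finsupp.induction_linear with
  | zero => simp
  | add f g hf hg =>
    simp only [map_add, inner_add_left, add_mul]
    exact ⟨hf.1.add hg.1, by rw [integral_add hf.1 hg.1, hf.2, hg.2]⟩
  | single k c =>
    induction ψ using Finsupp.induction_linear with
    | zero => simp
    | add f g hf hg =>
      simp only [map_add, inner_add_right, mul_add]
      exact ⟨hf.1.add hg.1, by rw [integral_add hf.1 hg.1, hf.2, hg.2]⟩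
    | single l d =>
      have h := orthogonality_phase k l
      simp only [hsm, inner_smul_left, inner_smul_right]
      have h1 : ∀ u : Fin n → ℂ,
          conj c * inner ℂ (fock k) (cohVec u) * (d * inner ℂ (cohVec u) (fock l)) =
            (conj c * d) * (inner ℂ (fock k) (cohVec u) * inner ℂ (cohVec u) (fock l)) :=
        fun u => by ring
      simp only [h1]
      refine ⟨h.1.const_mul _, ?_⟩
      rw [integral_const_mul, h.2]; ring

lemma eLpNorm_two_eq_ofReal {X : Type*} [MeasurableSpace X] {ν : Measure X} {f : X → ℂ} {a : ℝ}
    (ha : 0 ≤ a) (hi : Integrable (fun x => conj (f x) * f x) ν)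
    (h : ∫ x, conj (f x) * f x ∂ν = (a : ℂ) ^ 2) :
    eLpNorm f 2 ν = ENNReal.ofReal a := by
  have h1 : ∀ x, conj (f x) * f x = ((‖f x‖ ^ 2 : ℝ) : ℂ) := fun x => by
    rw [Complex.conj_mul']; push_cast; rfl
  simp only [h1] at hi h
  rw [integral_complex_ofReal] at h
  have h2 : ∫ x, ‖f x‖ ^ 2 ∂ν = a ^ 2 := by exact_mod_cast h
  have h3 : ∫⁻ x, ‖f x‖ₑ ^ (2 : ℝ) ∂ν = ENNReal.ofReal (a ^ 2) := by
    rw [← h2, ofReal_integral_eq_lintegral_ofReal]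
    · refine lintegral_congr fun x => ?_
      rw [ENNReal.ofReal_pow (norm_nonneg _), ofReal_norm]
      norm_cast
    · exact hi.re.congr (Filter.Eventually.of_forall fun x => Complex.ofReal_re _)
    · exact Filter.Eventually.of_forall fun x => by positivity
  rw [eLpNorm_eq_lintegral_rpow_enorm_toReal (by norm_num) (by norm_num)]
  simp only [ENNReal.toReal_ofNat]
  rw [h3, ENNReal.ofReal_rpow_of_nonneg (by positivity) (by norm_num), ← Real.sqrt_eq_rpow,
    Real.sqrt_sq ha]

/-- Coherent states form a Bessel family. -/
lemma eLpNorm_inner_cohVec_le {n : ℕ} (ψ : FockSpace n) :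
    eLpNorm (fun u => inner ℂ (cohVec u) ψ) 2 (phaseMeasure n) ≤ ENNReal.ofReal (1 * ‖ψ‖) := by
  have hfin : ∀ φ : FiniteVectors n, eLpNorm (fun u => inner ℂ (cohVec u) (incl n φ)) 2
      (phaseMeasure n) = ENNReal.ofReal ‖incl n φ‖ := fun φ => by
    have h := resolution_finite φ φ
    refine eLpNorm_two_eq_ofReal (norm_nonneg _) ?_ ?_
    · simpa only [inner_conj_symm] using h.1
    · simp only [inner_conj_symm]
      rw [h.2, inner_self_eq_norm_sq_to_K]; rfl
  obtain ⟨x, hx, hlim⟩ := mem_closure_iff_seq_limit.1 (denseRange_incl n ψ)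
  choose φ hφ using hx
  have hm : ∀ χ : FockSpace n, Continuous fun u : Fin n → ℂ => inner ℂ (cohVec u) χ := fun χ =>
    (continuous_cohVec n).inner continuous_const
  -- Fatou's lemma carries the bound from finite vectors, where it is an equality, to their limits.
  refine (Lp.eLpNorm_lim_le_liminf_eLpNorm (f := fun m u => inner ℂ (cohVec u) (x m))
    (fun m => (hm _).aestronglyMeasurable) _ (Filter.Eventually.of_forall fun u =>
      Filter.Tendsto.inner tendsto_const_nhds hlim)).trans ?_
  have h1 : ∀ m, eLpNorm (fun u => inner ℂ (cohVec u) (x m)) 2 (phaseMeasure n)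
      = ENNReal.ofReal ‖x m‖ := fun m => by rw [← hφ m]; exact hfin _
  simp only [h1, one_mul]
  exact (ENNReal.tendsto_ofReal hlim.norm).liminf_eq.le

/-- The resolution of the identity by coherent states. -/
lemma resolution_of_identity {n : ℕ} (φ ψ : FockSpace n) :
    Integrable (fun u : Fin n → ℂ => inner ℂ φ (cohVec u) * inner ℂ (cohVec u) ψ)
        (phaseMeasure n) ∧
      ∫ u, inner ℂ φ (cohVec u) * inner ℂ (cohVec u) ψ ∂phaseMeasure n = inner ℂ φ ψ := by
  have hm := (continuous_cohVec n).aestronglyMeasurable (μ := phaseMeasure n)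
  obtain ⟨S, hS⟩ := exists_frameOperator hm hm eLpNorm_inner_cohVec_le eLpNorm_inner_cohVec_le
  have h1 : S = ContinuousLinearMap.id ℂ _ := ext_fock fun k l => by
    rw [(hS _ _).2, (orthogonality_phase k l).2]; rfl
  refine ⟨(hS φ ψ).1, ?_⟩
  rw [← (hS φ ψ).2, h1]; rfl

/-- By the resolution of the identity, a vector orthogonal to every exponential vector has norm
zero. -/
lemma ext_inner_expVec {n : ℕ} {φ ψ : FockSpace n}
    (h : ∀ u, inner ℂ (expVec u) φ = inner ℂ (expVec u) ψ) : φ = ψ := by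
  rw [← sub_eq_zero, ← inner_self_eq_zero (𝕜 := ℂ), ← (resolution_of_identity _ _).2]
  have h1 : ∀ u : Fin n → ℂ, inner ℂ (cohVec u) (φ - ψ) = 0 := fun u => by
    rw [cohVec, inner_smul_left, inner_sub_right, h, sub_self, mul_zero]
  simp [h1]

lemma ext_expVec {n : ℕ} {S T : FockSpace n →L[ℂ] FockSpace n}
    (h : ∀ u v, inner ℂ (expVec u) (S (expVec v)) = inner ℂ (expVec u) (T (expVec v))) :
    S = T := by
  have h1 : ∀ u, S.adjoint (expVec u) = T.adjoint (expVec u) := fun u => by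
    refine ext_inner_expVec fun v => ?_
    rw [ContinuousLinearMap.adjoint_inner_right, ContinuousLinearMap.adjoint_inner_right,
      ← inner_conj_symm, h, inner_conj_symm]
  ext1 ψ
  refine ext_inner_expVec fun u => ?_
  rw [← ContinuousLinearMap.adjoint_inner_left, h1, ContinuousLinearMap.adjoint_inner_left]

/-! ### Displacement operators and coherent states. -/

/-- The exponent of the displacement operator. -/
def displacementExponent {n : ℕ} (z : Fin n → ℂ) : Module.End ℂ (FiniteVectors n) :=
  aDag z - aOp z

lemma displacementExponent_basisVec {n : ℕ} (z : Fin n → ℂ) (k : Fin n → ℕ) :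
    displacementExponent z (basisVec k) =
      ∑ j, (z j * ((Real.sqrt (k j + 1) : ℝ) : ℂ)) • basisVec (k + Pi.single j 1) -
        ∑ j, (conj (z j) * ((Real.sqrt (k j) : ℝ) : ℂ)) • basisVec (k - Pi.single j 1) := by
  simp only [displacementExponent, aDag, aOp, LinearMap.sub_apply, LinearMap.sum_apply,
    LinearMap.smul_apply, creation_basisVec, annihilation_basisVec, smul_smul]

/-- One application of the exponent raises the total occupation by at most one and costs a factor `2
∑ ‖z j‖ √(N + 1)`. Allowing `∑ k ≤ N` instead of equality lets raised and lowered terms share one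
induction hypothesis. -/
lemma norm_displacementExponent_pow_le {n : ℕ} (z : Fin n → ℂ) (m : ℕ) :
    ∀ (N : ℕ) (k : Fin n → ℕ), ∑ i, k i ≤ N →
      ‖incl n ((displacementExponent z ^ m) (basisVec k))‖ ≤
        (2 * ∑ j, ‖z j‖) ^ m * ∏ j ∈ Finset.range m, Real.sqrt (N + 1 + j) := by
  induction m with
  | zero => intro N k _; simp [incl_basisVec]
  | succ m ih =>
    intro N k hk
    set P : ℝ := (2 * ∑ j, ‖z j‖) ^ m * ∏ j ∈ Finset.range m, Real.sqrt ((N + 1 : ℕ) + 1 + j)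
      with hP
    have hkj : ∀ j, k j ≤ N := fun j =>
      (Finset.single_le_sum (f := k) (fun _ _ => Nat.zero_le _) (Finset.mem_univ j)).trans hk
    have h1 : ∀ j, ‖incl n ((displacementExponent z ^ m) (basisVec (k + Pi.single j 1)))‖ ≤ P :=
      fun j => ih (N + 1) _ (by
        simp only [Pi.add_apply, Finset.sum_add_distrib]
        have : ∑ i, (Pi.single j 1 : Fin n → ℕ) i = 1 := by simp
        omega)
    have h2 : ∀ j, ‖incl n ((displacementExponent z ^ m) (basisVec (k - Pi.single j 1)))‖ ≤ P :=
      fun j => ih (N + 1) _ (by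
        have : ∑ i, (k - Pi.single j 1 : Fin n → ℕ) i ≤ ∑ i, k i :=
          Finset.sum_le_sum fun i _ => Nat.sub_le _ _
        omega)
    have hs1 : ∀ j, Real.sqrt (k j + 1) ≤ Real.sqrt (N + 1) := fun j =>
      Real.sqrt_le_sqrt (by have := hkj j; gcongr)
    have hs2 : ∀ j, Real.sqrt (k j) ≤ Real.sqrt (N + 1) := fun j =>
      (Real.sqrt_le_sqrt (by linarith)).trans (hs1 j)
    rw [pow_succ, Module.End.mul_apply, displacementExponent_basisVec]
    simp only [map_sub, map_sum, map_smul]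
    refine (norm_sub_le _ _).trans ?_
    have h3 : ‖∑ j, (z j * ((Real.sqrt (k j + 1) : ℝ) : ℂ)) •
        incl n ((displacementExponent z ^ m) (basisVec (k + Pi.single j 1)))‖ ≤
          ∑ j, ‖z j‖ * Real.sqrt (N + 1) * P := by
      refine norm_sum_le_of_le _ fun j _ => ?_
      rw [norm_smul, norm_mul, Complex.norm_real, Real.norm_eq_abs,
        abs_of_nonneg (Real.sqrt_nonneg _)]
      have := hs1 j
      have := h1 j
      gcongr
    have h4 : ‖∑ j, (conj (z j) * ((Real.sqrt (k j) : ℝ) : ℂ)) •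
        incl n ((displacementExponent z ^ m) (basisVec (k - Pi.single j 1)))‖ ≤
          ∑ j, ‖z j‖ * Real.sqrt (N + 1) * P := by
      refine norm_sum_le_of_le _ fun j _ => ?_
      rw [norm_smul, norm_mul, RCLike.norm_conj, Complex.norm_real, Real.norm_eq_abs,
        abs_of_nonneg (Real.sqrt_nonneg _)]
      have := hs2 j
      have := h2 j
      gcongr
    refine (add_le_add h3 h4).trans (le_of_eq ?_)
    rw [← Finset.sum_mul, ← Finset.sum_mul, hP, Finset.prod_range_succ']
    have h5 : ∀ j : ℕ, ((N + 1 : ℕ) : ℝ) + 1 + j = N + 1 + (j + 1 : ℕ) := fun j => by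
      push_cast; ring
    simp only [h5]
    push_cast
    ring_nf

lemma summable_displacement {n : ℕ} (z : Fin n → ℂ) (φ : FiniteVectors n) :
    Summable fun m : ℕ => ((m.factorial : ℂ)⁻¹) • incl n ((displacementExponent z ^ m) φ) := by
  induction φ using Finsupp.induction_linear with
  | zero => simp
  | add f g hf hg => simpa only [map_add, smul_add] using hf.add hg
  | single k c =>
    have hk : (Finsupp.single k c : FiniteVectors n) = c • basisVec k := by simp [basisVec]
    simp only [hk, map_smul, smul_comm _ c]
    refine Summable.const_smul c (Summable.of_norm_bounded (summable_pow_div_sqrt_factorial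
      ((2 * ∑ j, ‖z j‖) * Real.sqrt (∑ i, k i + 1 : ℕ)) (by positivity)) fun m => ?_)
    set N := ∑ i, k i
    have h1 := norm_displacementExponent_pow_le z m N k le_rfl
    have h2 : ∏ j ∈ Finset.range m, Real.sqrt (N + 1 + j) ≤
        Real.sqrt (N + 1 : ℕ) ^ m * Real.sqrt m.factorial := by
      clear h1
      induction m with
      | zero => simp
      | succ m ih =>
        rw [Finset.prod_range_succ, Nat.factorial_succ, Nat.cast_mul,
          Real.sqrt_mul (by positivity), pow_succ]
        -- Uses `N + 1 + m ≤ (N + 1) (m + 1)`. The product of roots thus costs only `√m!`, and the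
        -- factor `1 / m!` leaves the summable `r ^ m / √m!`.
        have h3 : Real.sqrt (N + 1 + m) ≤ Real.sqrt (N + 1 : ℕ) * Real.sqrt (m + 1 : ℕ) := by
          rw [← Real.sqrt_mul (by positivity)]
          refine Real.sqrt_le_sqrt ?_
          push_cast
          nlinarith [(Nat.cast_nonneg N : (0:ℝ) ≤ N), (Nat.cast_nonneg m : (0:ℝ) ≤ m),
            mul_nonneg (Nat.cast_nonneg N : (0:ℝ) ≤ N) (Nat.cast_nonneg m : (0:ℝ) ≤ m)]
        calc _ ≤ (Real.sqrt (N + 1 : ℕ) ^ m * Real.sqrt m.factorial) *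
              (Real.sqrt (N + 1 : ℕ) * Real.sqrt (m + 1 : ℕ)) := by gcongr
          _ = _ := by ring
    have h4 : (0 : ℝ) < m.factorial := by positivity
    rw [norm_smul, norm_inv, Complex.norm_natCast]
    calc (m.factorial : ℝ)⁻¹ * ‖incl n ((displacementExponent z ^ m) (basisVec k))‖
        ≤ (m.factorial : ℝ)⁻¹ * ((2 * ∑ j, ‖z j‖) ^ m *
            (Real.sqrt (N + 1 : ℕ) ^ m * Real.sqrt m.factorial)) := by
          gcongr
          exact h1.trans (by gcongr)
      _ = ((2 * ∑ j, ‖z j‖) * Real.sqrt (N + 1 : ℕ)) ^ m / Real.sqrt m.factorial := by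
          have h5 : Real.sqrt m.factorial ≠ 0 := by positivity
          rw [mul_pow _ (Real.sqrt _)]
          nth_rewrite 1 [← Real.mul_self_sqrt h4.le]
          field_simp

/-- The polynomial function `φ ↦ ∑ k, φ k * mono k w` of a finite vector. -/
def polyEval {n : ℕ} (w : Fin n → ℂ) : FiniteVectors n →ₗ[ℂ] ℂ :=
  Finsupp.linearCombination ℂ fun k => mono k w

lemma polyEval_basisVec {n : ℕ} (w : Fin n → ℂ) (k : Fin n → ℕ) :
    polyEval w (basisVec k) = mono k w := by simp [polyEval, basisVec]

lemma conj_mono {n : ℕ} (k : Fin n → ℕ) (u : Fin n → ℂ) :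
    conj (mono k u) = mono k (fun i => conj (u i)) := by
  simp [mono, map_prod, map_div₀]

lemma inner_expVec_incl {n : ℕ} (u : Fin n → ℂ) (φ : FiniteVectors n) :
    inner ℂ (expVec u) (incl n φ) = polyEval (fun i => conj (u i)) φ := by
  have h : (innerₛₗ ℂ (expVec u)).comp (incl n) = polyEval (fun i => conj (u i)) :=
    linearMap_ext_basisVec fun k => by
      rw [LinearMap.comp_apply, incl_basisVec, innerₛₗ_apply_apply, inner_expVec_fock, conj_mono,
        polyEval_basisVec]
  exact LinearMap.congr_fun h φ

/-- The overlap of the displaced vector with an exponential vector, along `t ↦ D(t z)`. -/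
def displacementCurve {n : ℕ} (u z : Fin n → ℂ) (φ : FiniteVectors n) (t : ℂ) : ℂ :=
  Complex.exp (t * ∑ i, z i * conj (u i) - t ^ 2 / 2 * ∑ i, z i * conj (z i)) *
    polyEval ((fun i => conj (u i)) + t • fun i => -conj (z i)) φ

/-- In the Bargmann variable `w = conj u`, the exponent acts as multiplication by `z · w` minus
differentiation along `conj z`. The curve is the explicit solution of the resulting evolution
equation: the exponential factor produces the multiplication and the shifted argument the
differentiation. -/
lemma hasDerivAt_displacementCurve {n : ℕ} (u z : Fin n → ℂ) (φ : FiniteVectors n) (t : ℂ) :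
    HasDerivAt (displacementCurve u z φ)
      (displacementCurve u z (displacementExponent z φ) t) t := by
  set ub : Fin n → ℂ := fun i => conj (u i)
  set zb : Fin n → ℂ := fun i => -conj (z i)
  induction φ using Finsupp.induction_linear with
  | zero =>
    have : displacementCurve u z 0 = fun _ => 0 := by ext; simp [displacementCurve]
    rw [this, map_zero]
    simpa [displacementCurve] using hasDerivAt_const t (0 : ℂ)
  | add f g hf hg =>
    have h : ∀ f g : FiniteVectors n, displacementCurve u z (f + g) =
        displacementCurve u z f + displacementCurve u z g := fun f g => by
      ext; simp [displacementCurve, mul_add]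
    rw [map_add, h, h]
    exact hf.add hg
  | single k c =>
    have hk : (Finsupp.single k c : FiniteVectors n) = c • basisVec k := by simp [basisVec]
    have h : ∀ f : FiniteVectors n, displacementCurve u z (c • f) =
        fun t => c * displacementCurve u z f t := fun f => by
      ext; simp only [displacementCurve, map_smul, smul_eq_mul]; ring
    rw [hk, map_smul, h, h]
    refine HasDerivAt.const_mul c ?_
    have hexp : HasDerivAt (fun t : ℂ => t * ∑ i, z i * conj (u i) -
        t ^ 2 / 2 * ∑ i, z i * conj (z i)) (∑ i, z i * conj (u i) - t * ∑ i, z i * conj (z i)) t := by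
      have h1 := ((hasDerivAt_id t).mul_const (∑ i, z i * conj (u i)))
      have h2 := (((hasDerivAt_id t).pow 2).div_const 2).mul_const (∑ i, z i * conj (z i))
      refine (h1.sub h2).congr_deriv ?_
      simp
    have hm := hexp.cexp.mul (hasDerivAt_mono k ub zb t)
    have hcurve : displacementCurve u z (basisVec k) =
        (fun t => Complex.exp (t * ∑ i, z i * conj (u i) - t ^ 2 / 2 * ∑ i, z i * conj (z i))) *
          fun s => mono k (ub + s • zb) := by
      ext t
      rw [displacementCurve, polyEval_basisVec]
      rfl
    rw [hcurve]
    refine hm.congr_deriv ?_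
    rw [displacementCurve]
    rw [displacementExponent_basisVec]
    simp only [map_sub, map_sum, map_smul, polyEval_basisVec, smul_eq_mul]
    change _ = _ * (∑ j, z j * ((Real.sqrt (k j + 1) : ℝ) : ℂ) *
      mono (k + Pi.single j 1) (ub + t • zb) - ∑ j, conj (z j) * ((Real.sqrt (k j) : ℝ) : ℂ) *
      mono (k - Pi.single j 1) (ub + t • zb))
    have h3 : ∑ j, z j * ((Real.sqrt (k j + 1) : ℝ) : ℂ) * mono (k + Pi.single j 1) (ub + t • zb)
        = (∑ i, z i * conj (u i) - t * ∑ i, z i * conj (z i)) * mono k (ub + t • zb) := by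
      rw [Finset.mul_sum, ← Finset.sum_sub_distrib, Finset.sum_mul]
      refine Finset.sum_congr rfl fun j _ => ?_
      rw [mul_assoc, ← mul_mono, Pi.add_apply, Pi.smul_apply, smul_eq_mul]
      simp only [ub, zb]
      ring
    have h4 : ∑ j, zb j * (((Real.sqrt (k j) : ℝ) : ℂ) * mono (k - Pi.single j 1) (ub + t • zb))
        = -∑ j, conj (z j) * ((Real.sqrt (k j) : ℝ) : ℂ) *
          mono (k - Pi.single j 1) (ub + t • zb) := by
      rw [← Finset.sum_neg_distrib]
      refine Finset.sum_congr rfl fun j _ => ?_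
      simp only [zb]; ring
    rw [h3, h4]
    ring

lemma iteratedDeriv_displacementCurve {n : ℕ} (u z : Fin n → ℂ) (φ : FiniteVectors n) (m : ℕ) :
    iteratedDeriv m (displacementCurve u z φ) =
      displacementCurve u z ((displacementExponent z ^ m) φ) := by
  induction m with
  | zero => simp
  | succ m ih =>
    rw [iteratedDeriv_succ, ih, pow_succ', Module.End.mul_apply]
    ext t
    exact (hasDerivAt_displacementCurve u z _ t).deriv

lemma inner_expVec_displacement {n : ℕ} (u z : Fin n → ℂ) (φ : FiniteVectors n) :
    inner ℂ (expVec u) (displacement z φ) =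
      Complex.exp (∑ i, z i * conj (u i) - 1 / 2 * ∑ i, z i * conj (z i)) *
        inner ℂ (expVec (u - z)) (incl n φ) := by
  have h1 : HasSum (fun m : ℕ => ((m.factorial : ℂ)⁻¹) •
      inner ℂ (expVec u) (incl n ((displacementExponent z ^ m) φ)))
      (inner ℂ (expVec u) (displacement z φ)) := by
    have h := (summable_displacement z φ).hasSum.mapL (innerSL ℂ (expVec u))
    simp only [innerSL_apply_apply, inner_smul_right] at h
    exact h
  have hd : Differentiable ℂ (displacementCurve u z φ) := fun t =>
    (hasDerivAt_displacementCurve u z φ t).differentiableAt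
  -- The Taylor series of the entire curve at `0`, evaluated at `1`, is term by term the defining
  -- exponential series of the displacement.
  have h2 := Complex.hasSum_taylorSeries_of_entire hd 0 1
  simp only [iteratedDeriv_displacementCurve, sub_zero, one_pow, one_smul] at h2
  have h3 : ∀ ψ : FiniteVectors n, displacementCurve u z ψ 0 = inner ℂ (expVec u) (incl n ψ) :=
    fun ψ => by
      rw [inner_expVec_incl]; simp [displacementCurve]
  simp only [h3] at h2
  rw [h1.unique h2, displacementCurve, inner_expVec_incl]
  congr 2
  · ring
  · congr 1
    ext i
    simp [sub_eq_add_neg]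

lemma coherent_eq_cohVec {n : ℕ} (z : Fin n → ℂ) : coherent z = cohVec z := by
  refine ext_inner_expVec fun u => ?_
  rw [coherent, inner_expVec_displacement, incl_basisVec, inner_expVec_fock, cohVec,
    inner_smul_right, inner_expVec_expVec]
  have h0 : mono (0 : Fin n → ℕ) (u - z) = 1 := by simp [mono]
  rw [h0, map_one, mul_one, Complex.ofReal_exp, ← Complex.exp_add]
  congr 1
  push_cast
  simp only [Complex.mul_conj']
  rw [Finset.sum_congr rfl fun i _ => mul_comm (z i) (conj (u i))]
  ring

/-- The real pairing `2 ∑ Im (z_i conj u_i)` on phase space. -/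
def phasePairing {n : ℕ} (z u : Fin n → ℂ) : ℝ := 2 * ∑ i, (z i * conj (u i)).im

/-- The right side is the symbol of `a†(z) - a(z)` on coherent states, so `exp (i phasePairing z u)`
is the classical counterpart of `D(z)`. -/
lemma I_mul_phasePairing {n : ℕ} (z u : Fin n → ℂ) :
    Complex.I * (phasePairing z u : ℂ) = ∑ i, z i * conj (u i) - ∑ i, conj (z i) * u i := by
  rw [phasePairing, ← Finset.sum_sub_distrib]
  push_cast
  rw [Finset.mul_sum, Finset.mul_sum]
  refine Finset.sum_congr rfl fun i _ => ?_
  have : conj (z i) * u i = conj (z i * conj (u i)) := by simp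
  rw [this]
  generalize z i * conj (u i) = w
  apply Complex.ext <;> simp
  ring

lemma continuous_phasePairing {n : ℕ} (z : Fin n → ℂ) : Continuous (phasePairing z) := by
  unfold phasePairing
  have := Complex.continuous_conj
  have := Complex.continuous_im
  fun_prop

/-- The displacement operator as a bounded operator, in antinormally ordered form. -/
lemma exists_displacementOperator {n : ℕ} (z : Fin n → ℂ) :
    ∃ D : FockSpace n →L[ℂ] FockSpace n, (∀ φ, displacement z φ = D (incl n φ)) ∧
      ∀ φ ψ, inner ℂ φ (D ψ) = Complex.exp ((∑ i, (‖z i‖ : ℂ) ^ 2) / 2) *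
        ∫ u, inner ℂ φ (cohVec u) * inner ℂ (cohVec u) ψ *
          Complex.exp (Complex.I * phasePairing z u) ∂phaseMeasure n := by
  have hcoh := continuous_cohVec n
  have hpp := continuous_phasePairing z
  set m : (Fin n → ℂ) → ℂ := fun u => Complex.exp (Complex.I * phasePairing z u) with hm
  have hmn : ∀ u, ‖m u‖ = 1 := fun u => by
    rw [hm]; simp only; rw [mul_comm, Complex.norm_exp_ofReal_mul_I]
  have hmc : Continuous m := by fun_prop
  have hw : Continuous fun u : Fin n → ℂ => conj (m u) • (cohVec u : FockSpace n) :=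
    (Complex.continuous_conj.comp hmc).smul hcoh
  have hbw : ∀ ψ : FockSpace n, eLpNorm (fun u => inner ℂ (conj (m u) • cohVec u) ψ) 2
      (phaseMeasure n) ≤ ENNReal.ofReal (1 * ‖ψ‖) := fun ψ => by
    refine le_trans (le_of_eq ?_) (eLpNorm_inner_cohVec_le ψ)
    refine eLpNorm_congr_norm_ae (Filter.Eventually.of_forall fun u => ?_)
    simp [hmn]
  obtain ⟨S, hS⟩ := exists_frameOperator (hcoh.aestronglyMeasurable (μ := phaseMeasure n))
    hw.aestronglyMeasurable eLpNorm_inner_cohVec_le hbw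
  have hS' : ∀ φ ψ, inner ℂ φ (S ψ) = ∫ u, inner ℂ φ (cohVec u) * inner ℂ (cohVec u) ψ * m u
      ∂phaseMeasure n := fun φ ψ => by
    rw [(hS φ ψ).2]
    congr 1; ext u
    rw [inner_smul_left, Complex.conj_conj]; ring
  -- On exponential vectors the phase-space integral is Gaussian. It reproduces the overlap of
  -- `D(z)` except that `|z|²` replaces `|z|²/2` in the exponent; the prefactor `exp (|z|²/2)` makes
  -- up the difference.
  have hexp : ∀ v w : Fin n → ℂ, inner ℂ (expVec v) (S (expVec w)) =
      Complex.exp (∑ i, z i * conj (v i) - ∑ i, z i * conj (z i)) *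
        inner ℂ (expVec (v - z)) (expVec w) := by
    intro v w
    have hg := (gaussian_phase (fun i => conj (v i) - conj (z i)) (fun i => w i + z i)).2
    rw [hS', inner_expVec_expVec, ← Complex.exp_add]
    convert hg using 1
    · congr 1; ext u
      rw [hm]
      simp only
      rw [I_mul_phasePairing, cohVec, inner_smul_left, inner_smul_right, inner_expVec_expVec,
        inner_expVec_expVec, Complex.conj_ofReal, Complex.ofReal_exp, ← Complex.exp_add,
        ← Complex.exp_add, ← Complex.exp_add, ← Complex.exp_add]
      congr 1
      push_cast
      have e1 : ∑ i, (conj (v i) - conj (z i)) * u i =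
          ∑ i, conj (v i) * u i - ∑ i, conj (z i) * u i := by
        rw [← Finset.sum_sub_distrib]; exact Finset.sum_congr rfl fun i _ => by ring
      have e2 : ∑ i, (w i + z i) * conj (u i) =
          ∑ i, conj (u i) * w i + ∑ i, z i * conj (u i) := by
        rw [← Finset.sum_add_distrib]; exact Finset.sum_congr rfl fun i _ => by ring
      rw [e1, e2]; ring
    · congr 1
      rw [← Finset.sum_sub_distrib, ← Finset.sum_add_distrib]
      refine Finset.sum_congr rfl fun i _ => ?_
      simp only [Pi.sub_apply, map_sub]; ring
  have hadj : ∀ v, S.adjoint (expVec v) =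
      conj (Complex.exp (∑ i, z i * conj (v i) - ∑ i, z i * conj (z i))) • expVec (v - z) := by
    intro v
    refine ext_inner_expVec fun w => ?_
    rw [ContinuousLinearMap.adjoint_inner_right, ← inner_conj_symm, hexp, map_mul, inner_conj_symm,
      inner_smul_right]
  refine ⟨Complex.exp ((∑ i, (‖z i‖ : ℂ) ^ 2) / 2) • S, fun φ => ?_, fun φ ψ => ?_⟩
  · refine ext_inner_expVec fun v => ?_
    rw [inner_expVec_displacement, smul_apply, inner_smul_right,
      ← ContinuousLinearMap.adjoint_inner_left, hadj, inner_smul_left, Complex.conj_conj,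
      ← mul_assoc, ← Complex.exp_add]
    congr 2
    simp only [Complex.mul_conj']
    ring
  · rw [smul_apply, inner_smul_right, hS']

/-! ### Square roots of states, the Husimi function and its Fourier transform. -/

lemma exists_sqrt_of_isPositive {H : Type*} [NormedAddCommGroup H] [InnerProductSpace ℂ H]
    [CompleteSpace H] {ρ : H →L[ℂ] H} (h : ρ.IsPositive) :
    ∃ B : H →L[ℂ] H, (∀ φ ψ, inner ℂ (B φ) ψ = inner ℂ φ (B ψ)) ∧ ∀ φ, ρ φ = B (B φ) := by
  have h0 := (ContinuousLinearMap.nonneg_iff_isPositive ρ).2 h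
  refine ⟨CFC.sqrt ρ, ?_, fun φ => ?_⟩
  · exact ((ContinuousLinearMap.nonneg_iff_isPositive _).1 (CFC.sqrt_nonneg ρ)).isSymmetric
  · exact congrArg (fun T => T φ) (CFC.sqrt_mul_sqrt_self ρ h0).symm

/-- Trace one means that the square root is Hilbert–Schmidt. Working with it turns diagonal matrix
elements of the state into squared norms and justifies interchanging sums and integrals. -/
lemma IsState.exists_sqrt {n : ℕ} {ρ : FockSpace n →L[ℂ] FockSpace n} (h : IsState ρ) :
    ∃ B : FockSpace n →L[ℂ] FockSpace n, (∀ φ ψ, inner ℂ (B φ) ψ = inner ℂ φ (B ψ)) ∧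
      (∀ φ, ρ φ = B (B φ)) ∧ HasSum (fun k => ‖B (fock k)‖ ^ 2) 1 := by
  obtain ⟨B, hB, hρ⟩ := exists_sqrt_of_isPositive h.isPositive
  refine ⟨B, hB, hρ, ?_⟩
  rw [← Complex.hasSum_ofReal]
  refine (congrArg₂ (fun f a => HasSum f a) (funext fun k => ?_) (by simp)).mp h.trace_eq_one
  rw [hρ, ← hB, inner_self_eq_norm_sq_to_K]
  push_cast; rfl

/-- The trace of `B² D` for a Hilbert–Schmidt operator `B`. -/
lemma tsum_inner_eq_tsum_inner {n : ℕ} (B D : FockSpace n →L[ℂ] FockSpace n)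
    (hB : ∀ φ ψ, inner ℂ (B φ) ψ = inner ℂ φ (B ψ))
    (hs : Summable fun k : Fin n → ℕ => ‖B (fock k)‖ ^ 2) :
    ∑' k : Fin n → ℕ, inner ℂ (fock k) (B (B (D (fock k)))) =
      ∑' m : Fin n → ℕ, inner ℂ (B (fock m)) (D (B (fock m))) := by
  set f : (Fin n → ℕ) → (Fin n → ℕ) → ℂ := fun m k =>
    inner ℂ (D.adjoint (B (fock m))) (fock k) * inner ℂ (fock k) (B (fock m)) with hf
  have hrow : ∀ m, HasSum (f m) (inner ℂ (B (fock m)) (D (B (fock m)))) := fun m => by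
    have := hasSum_inner_mul_inner (D.adjoint (B (fock m))) (B (fock m))
    rwa [ContinuousLinearMap.adjoint_inner_left] at this
  have hcol : ∀ k, HasSum (fun m => f m k) (inner ℂ (fock k) (B (B (D (fock k))))) := fun k => by
    have := hasSum_inner_mul_inner (B (fock k)) (B (D (fock k)))
    rw [hB] at this
    refine (congrArg (fun f => HasSum f _) (funext fun m => ?_)).mp this
    rw [hf]
    simp only
    rw [ContinuousLinearMap.adjoint_inner_left, hB (fock m), hB (fock k), mul_comm]
  have hdom : ∀ v : (Fin n → ℕ) → FockSpace n, Summable (fun m => ‖v m‖ ^ 2) →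
      Summable fun p : (Fin n → ℕ) × (Fin n → ℕ) => ‖inner ℂ (fock p.2) (v p.1)‖ ^ 2 := by
    intro v hv
    rw [summable_prod_of_nonneg (fun p => by positivity)]
    exact ⟨fun m => (hasSum_norm_sq (v m)).summable, by
      simpa only [(hasSum_norm_sq _).tsum_eq] using hv⟩
  have h1 := hdom (fun m => B (fock m)) hs
  have h2 := hdom (fun m => D.adjoint (B (fock m))) (by
    refine Summable.of_nonneg_of_le (fun m => by positivity) (fun m => ?_)
      (hs.mul_left (‖D.adjoint‖ ^ 2))
    rw [← mul_pow]
    exact pow_le_pow_left₀ (norm_nonneg _) (D.adjoint.le_opNorm _) 2)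
  -- Each term is a product of matrix elements of two Hilbert–Schmidt operators; `2xy ≤ x² + y²`
  -- gives absolute summability, so the rows and columns may be exchanged.
  have hsum : Summable (Function.uncurry f) := by
    refine Summable.of_norm_bounded ((h1.add h2).mul_left (1 / 2)) fun p => ?_
    rw [Function.uncurry, hf]
    simp only
    rw [norm_mul, norm_inner_symm (D.adjoint _)]
    nlinarith [sq_nonneg (‖inner ℂ (fock p.2) (D.adjoint (B (fock p.1)))‖ -
      ‖inner ℂ (fock p.2) (B (fock p.1))‖)]
  have h3 := hsum.tsum_comm' (fun m => (hrow m).summable) (fun k => (hcol k).summable)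
  simpa only [(hrow _).tsum_eq, (hcol _).tsum_eq] using h3

/-- The Husimi function `⟨u|ρ|u⟩`. -/
def husimi {n : ℕ} (ρ : FockSpace n →L[ℂ] FockSpace n) (u : Fin n → ℂ) : ℝ :=
  (inner ℂ (cohVec u) (ρ (cohVec u))).re

lemma continuous_husimi {n : ℕ} (ρ : FockSpace n →L[ℂ] FockSpace n) : Continuous (husimi ρ) := by
  have := continuous_cohVec n
  exact Complex.continuous_re.comp (this.inner (ρ.continuous.comp this))

/-- The Husimi function as a measure on phase space. -/
def husimiMeasure {n : ℕ} (ρ : FockSpace n →L[ℂ] FockSpace n) : Measure (Fin n → ℂ) :=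
  (phaseMeasure n).withDensity fun u => ENNReal.ofReal (husimi ρ u)

lemma husimi_eq_norm_sq {n : ℕ} {ρ B : FockSpace n →L[ℂ] FockSpace n}
    (hB : ∀ φ ψ, inner ℂ (B φ) ψ = inner ℂ φ (B ψ)) (hρ : ∀ φ, ρ φ = B (B φ)) (u : Fin n → ℂ) :
    husimi ρ u = ‖B (cohVec u)‖ ^ 2 := by
  rw [husimi, hρ, ← hB, inner_self_eq_norm_sq_to_K]
  norm_cast

lemma integral_husimiMeasure {n : ℕ} {ρ B : FockSpace n →L[ℂ] FockSpace n}
    (hB : ∀ φ ψ, inner ℂ (B φ) ψ = inner ℂ φ (B ψ)) (hρ : ∀ φ, ρ φ = B (B φ))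
    (f : (Fin n → ℂ) → ℂ) :
    ∫ u, f u ∂husimiMeasure ρ = ∫ u, (‖B (cohVec u)‖ ^ 2 : ℝ) * f u ∂phaseMeasure n := by
  rw [husimiMeasure, integral_withDensity_eq_integral_toReal_smul
    (continuous_husimi ρ).measurable.ennreal_ofReal (Filter.Eventually.of_forall fun _ =>
      ENNReal.ofReal_lt_top)]
  congr 1; ext u
  rw [husimi_eq_norm_sq hB hρ, ENNReal.toReal_ofReal (by positivity), Complex.real_smul]

lemma integral_norm_inner_cohVec_sq {n : ℕ} (ψ : FockSpace n) :
    Integrable (fun u => ‖inner ℂ (cohVec u) ψ‖ ^ 2) (phaseMeasure n) ∧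
      ∫ u, ‖inner ℂ (cohVec u) ψ‖ ^ 2 ∂phaseMeasure n = ‖ψ‖ ^ 2 := by
  have h := resolution_of_identity ψ ψ
  have h1 : ∀ u : Fin n → ℂ, inner ℂ ψ (cohVec u) * inner ℂ (cohVec u) ψ =
      ((‖inner ℂ (cohVec u) ψ‖ ^ 2 : ℝ) : ℂ) := fun u => by
    rw [← inner_conj_symm, Complex.conj_mul']; push_cast; rfl
  simp only [h1] at h
  refine ⟨h.1.re.congr (Filter.Eventually.of_forall fun x => Complex.ofReal_re _), ?_⟩
  have h2 := h.2
  rw [integral_complex_ofReal, inner_self_eq_norm_sq_to_K] at h2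
  refine Complex.ofReal_injective (h2.trans ?_)
  push_cast; rfl

lemma hasSum_norm_inner_cohVec {n : ℕ} {B : FockSpace n →L[ℂ] FockSpace n}
    (hB : ∀ φ ψ, inner ℂ (B φ) ψ = inner ℂ φ (B ψ)) (φ : FockSpace n) :
    HasSum (fun m => ‖inner ℂ φ (B (fock m))‖ ^ 2) (‖B φ‖ ^ 2) := by
  refine (congrArg (fun f => HasSum f _) (funext fun m => ?_)).mp (hasSum_norm_sq (B φ))
  rw [norm_inner_symm, hB]

/-- The Husimi function is the sum over `m` of `|⟨u, B m⟩|²`, whose integrals are `‖B m‖²` by the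
resolution of the identity; these add up to the trace. -/
lemma isProbabilityMeasure_husimiMeasure {n : ℕ} {ρ : FockSpace n →L[ℂ] FockSpace n}
    (h : IsState ρ) : IsProbabilityMeasure (husimiMeasure ρ) := by
  obtain ⟨B, hB, hρ, hs⟩ := h.exists_sqrt
  constructor
  rw [husimiMeasure, withDensity_apply _ MeasurableSet.univ, Measure.restrict_univ]
  have h1 : ∀ u, ENNReal.ofReal (husimi ρ u) =
      ∑' m, ENNReal.ofReal (‖inner ℂ (cohVec u) (B (fock m))‖ ^ 2) := fun u => by
    rw [husimi_eq_norm_sq hB hρ, ← (hasSum_norm_inner_cohVec hB (cohVec u)).tsum_eq,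
      ENNReal.ofReal_tsum_of_nonneg (fun m => by positivity)
        (hasSum_norm_inner_cohVec hB (cohVec u)).summable]
  simp only [h1]
  rw [lintegral_tsum]
  · have h2 : ∀ m, ∫⁻ u, ENNReal.ofReal (‖inner ℂ (cohVec u) (B (fock m))‖ ^ 2) ∂phaseMeasure n =
        ENNReal.ofReal (‖B (fock m)‖ ^ 2) := fun m => by
      rw [← (integral_norm_inner_cohVec_sq (B (fock m))).2, ofReal_integral_eq_lintegral_ofReal
        (integral_norm_inner_cohVec_sq (B (fock m))).1
        (Filter.Eventually.of_forall fun u => by positivity)]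
    simp only [h2]
    rw [← ENNReal.ofReal_tsum_of_nonneg (fun m => by positivity) hs.summable, hs.tsum_eq,
      ENNReal.ofReal_one]
  · intro m
    have h3 : Continuous fun u : Fin n → ℂ => ‖inner ℂ (cohVec u) (B (fock m))‖ ^ 2 :=
      ((continuous_cohVec n).inner continuous_const).norm.pow 2
    exact h3.measurable.ennreal_ofReal.aemeasurable

/-- The characteristic function is, up to a Gaussian factor, the Fourier transform of the Husimi
function. -/
lemma integral_exp_phasePairing_husimiMeasure {n : ℕ} {ρ : FockSpace n →L[ℂ] FockSpace n}
    (h : IsState ρ) (z : Fin n → ℂ) :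
    ∫ u, Complex.exp (Complex.I * phasePairing z u) ∂husimiMeasure ρ =
      Complex.exp (-(∑ i, (‖z i‖ : ℂ) ^ 2) / 2) * charFn ρ z := by
  obtain ⟨B, hB, hρ, hs⟩ := h.exists_sqrt
  -- The trace of `ρ D(z)` becomes `∑ m, ⟨B m, D B m⟩`, each term being an integral of the phase
  -- against `|⟨u, B m⟩|²`; these densities sum to the Husimi function.
  obtain ⟨D, hD1, hD2⟩ := exists_displacementOperator z
  have hchar : charFn ρ z = ∑' m : Fin n → ℕ, inner ℂ (B (fock m)) (D (B (fock m))) := by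
    rw [← tsum_inner_eq_tsum_inner B D hB hs.summable, charFn]
    refine tsum_congr fun k => ?_
    rw [hD1, incl_basisVec, hρ]
  set F : (Fin n → ℕ) → (Fin n → ℂ) → ℂ := fun m u =>
    (‖inner ℂ (cohVec u) (B (fock m))‖ ^ 2 : ℝ) * Complex.exp (Complex.I * phasePairing z u) with hF
  have hnF : ∀ m u, ‖F m u‖ = ‖inner ℂ (cohVec u) (B (fock m))‖ ^ 2 := fun m u => by
    rw [hF]
    simp only
    rw [norm_mul, mul_comm Complex.I, Complex.norm_exp_ofReal_mul_I, mul_one, Complex.norm_real,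
      Real.norm_eq_abs, abs_of_nonneg (by positivity)]
  have hcF : ∀ m, Continuous (F m) := fun m => by
    have h1 := continuous_phasePairing z
    have h2 : Continuous fun u : Fin n → ℂ => ‖inner ℂ (cohVec u) (B (fock m))‖ ^ 2 :=
      ((continuous_cohVec n).inner continuous_const).norm.pow 2
    fun_prop
  have hFi : ∀ m, Integrable (F m) (phaseMeasure n) := fun m => by
    refine ((integral_norm_inner_cohVec_sq (B (fock m))).1).mono' (hcF m).aestronglyMeasurable
      (Filter.Eventually.of_forall fun u => (hnF m u).le)
  have hsum := hasSum_integral_of_summable_integral_norm hFi (by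
    simpa only [hnF, (integral_norm_inner_cohVec_sq _).2] using hs.summable)
  have hFs : ∀ u, ∑' m, F m u =
      (‖B (cohVec u)‖ ^ 2 : ℝ) * Complex.exp (Complex.I * phasePairing z u) := fun u => by
    simp only [hF]
    rw [tsum_mul_right, ← Complex.ofReal_tsum, (hasSum_norm_inner_cohVec hB (cohVec u)).tsum_eq]
  simp only [hFs] at hsum
  rw [integral_husimiMeasure hB hρ, ← hsum.tsum_eq, hchar, ← tsum_mul_left]
  refine tsum_congr fun m => ?_
  rw [hD2, ← mul_assoc, ← Complex.exp_add]
  have h0 : -(∑ i, (‖z i‖ : ℂ) ^ 2) / 2 + (∑ i, (‖z i‖ : ℂ) ^ 2) / 2 = 0 := by ring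
  rw [h0, Complex.exp_zero, one_mul]
  congr 1; ext u
  rw [hF]
  simp only
  rw [← inner_conj_symm (B (fock m)), Complex.conj_mul']
  push_cast; rfl

/-! ### Gaussian states: normal law and moments of the Husimi measure. -/

/-- The real coordinates of a phase space point. -/
def toRealVec {n : ℕ} (z : Fin n → ℂ) : Fin n × Fin 2 → ℝ :=
  fun i => if i.2 = 0 then (z i.1).re else (z i.1).im

lemma toComplexVec_toRealVec {n : ℕ} (z : Fin n → ℂ) : toComplexVec (toRealVec z) = z := by
  ext j
  simp only [toComplexVec, toRealVec]
  rw [mul_comm]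
  simp [Complex.re_add_im]

lemma toRealVec_smul {n : ℕ} (t : ℝ) (z : Fin n → ℂ) :
    toRealVec (t • z) = t • toRealVec z := by
  ext i
  simp only [toRealVec, Pi.smul_apply, smul_eq_mul, Complex.real_smul]
  split_ifs <;> simp

lemma toRealVec_add {n : ℕ} (z w : Fin n → ℂ) :
    toRealVec (z + w) = toRealVec z + toRealVec w := by
  ext i
  simp only [toRealVec, Pi.add_apply]
  split_ifs <;> simp

/-- The quadratic form of the Gaussian characteristic function. -/
def weylVariance {n : ℕ} (ρ : FockSpace n →L[ℂ] FockSpace n) (z : Fin n → ℂ) : ℝ :=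
  toRealVec z ⬝ᵥ Matrix.mulVec
    (symplecticForm n * covMatrix ρ * (symplecticForm n).transpose) (toRealVec z)

/-- The variance of `phasePairing z` with respect to the Husimi function of a Gaussian state. -/
def husimiVariance {n : ℕ} (ρ : FockSpace n →L[ℂ] FockSpace n) (z : Fin n → ℂ) : ℝ :=
  weylVariance ρ z + ∑ i, ‖z i‖ ^ 2

/-- Minus the mean of `phasePairing z` in a Gaussian state. -/
def weylMean {n : ℕ} (ρ : FockSpace n →L[ℂ] FockSpace n) (z : Fin n → ℂ) : ℝ :=
  Real.sqrt 2 * (Matrix.mulVec (symplecticForm n) (meanVec ρ) ⬝ᵥ toRealVec z)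

lemma husimiVariance_smul {n : ℕ} (ρ : FockSpace n →L[ℂ] FockSpace n) (t : ℝ) (z : Fin n → ℂ) :
    husimiVariance ρ (t • z) = t ^ 2 * husimiVariance ρ z := by
  simp only [husimiVariance, weylVariance, toRealVec_smul, Matrix.mulVec_smul, dotProduct_smul,
    smul_dotProduct, smul_eq_mul, Pi.smul_apply, norm_smul, mul_pow, ← Finset.mul_sum,
    Real.norm_eq_abs, sq_abs]
  ring

lemma weylMean_smul {n : ℕ} (ρ : FockSpace n →L[ℂ] FockSpace n) (t : ℝ) (z : Fin n → ℂ) :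
    weylMean ρ (t • z) = t * weylMean ρ z := by
  simp only [weylMean, toRealVec_smul, dotProduct_smul, smul_eq_mul]
  ring

lemma phasePairing_smul {n : ℕ} (t : ℝ) (z u : Fin n → ℂ) :
    phasePairing (t • z) u = t * phasePairing z u := by
  simp only [phasePairing, Pi.smul_apply, Complex.real_smul, mul_assoc, Complex.im_ofReal_mul,
    ← Finset.mul_sum]
  ring

lemma phasePairing_add {n : ℕ} (z w u : Fin n → ℂ) :
    phasePairing (z + w) u = phasePairing z u + phasePairing w u := by
  simp only [phasePairing, Pi.add_apply, add_mul, Complex.add_im, Finset.sum_add_distrib]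
  ring

lemma phasePairing_add_right {n : ℕ} (z u v : Fin n → ℂ) :
    phasePairing z (u + v) = phasePairing z u + phasePairing z v := by
  simp only [phasePairing, Pi.add_apply, map_add, mul_add, Complex.add_im, Finset.sum_add_distrib]

lemma charFn_gaussian {n : ℕ} {ρ : FockSpace n →L[ℂ] FockSpace n} (h : IsGaussianState ρ)
    (z : Fin n → ℂ) :
    charFn ρ z = Complex.exp (-(weylVariance ρ z : ℂ) / 2 - Complex.I * weylMean ρ z) := by
  have h1 := h.charFn_eq (toRealVec z)
  rw [toComplexVec_toRealVec] at h1
  rw [h1, weylVariance, weylMean]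
  congr 2
  ring

lemma fourier_husimiMeasure {n : ℕ} {ρ : FockSpace n →L[ℂ] FockSpace n} (h : IsGaussianState ρ)
    (z : Fin n → ℂ) :
    ∫ u, Complex.exp (Complex.I * phasePairing z u) ∂husimiMeasure ρ =
      Complex.exp (-(husimiVariance ρ z : ℂ) / 2 - Complex.I * weylMean ρ z) := by
  rw [integral_exp_phasePairing_husimiMeasure h.isState, charFn_gaussian h, ← Complex.exp_add,
    husimiVariance]
  congr 1
  push_cast
  ring

/-- The Fourier transform of a probability measure is bounded by one, which bounds the real part of
its Gaussian exponent; no uncertainty relation is invoked. -/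
lemma husimiVariance_nonneg {n : ℕ} {ρ : FockSpace n →L[ℂ] FockSpace n} (h : IsGaussianState ρ)
    (z : Fin n → ℂ) : 0 ≤ husimiVariance ρ z := by
  have := isProbabilityMeasure_husimiMeasure h.isState
  have h1 : ‖∫ u, Complex.exp (Complex.I * phasePairing z u) ∂husimiMeasure ρ‖ ≤ 1 := by
    refine (norm_integral_le_of_norm_le_const (C := 1)
      (Filter.Eventually.of_forall fun u => ?_)).trans (by simp)
    rw [mul_comm Complex.I, Complex.norm_exp_ofReal_mul_I]
  rw [fourier_husimiMeasure h, Complex.norm_exp] at h1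
  have h2 : (-(husimiVariance ρ z : ℂ) / 2 - Complex.I * weylMean ρ z).re =
      -husimiVariance ρ z / 2 := by
    have h3 : (-(husimiVariance ρ z : ℂ) / 2 - Complex.I * weylMean ρ z) =
      ((-husimiVariance ρ z / 2 : ℝ) : ℂ) + ((-weylMean ρ z : ℝ) : ℂ) * Complex.I := by
      push_cast; ring
    rw [h3]; simp
  rw [h2, Real.exp_le_one_iff] at h1
  linarith

/-- Linear functions are normally distributed with respect to the Husimi function of a Gaussian
state. -/
lemma map_phasePairing_husimiMeasure {n : ℕ} {ρ : FockSpace n →L[ℂ] FockSpace n}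
    (h : IsGaussianState ρ) (z : Fin n → ℂ) :
    (husimiMeasure ρ).map (phasePairing z) =
      gaussianReal (-weylMean ρ z) (husimiVariance ρ z).toNNReal := by
  have := isProbabilityMeasure_husimiMeasure h.isState
  have hm := (continuous_phasePairing z).measurable
  have := Measure.isProbabilityMeasure_map (μ := husimiMeasure ρ) hm.aemeasurable
  refine Measure.ext_of_charFun (funext fun t => ?_)
  rw [charFun_gaussianReal, charFun_apply_real, integral_map hm.aemeasurable (by fun_prop)]
  have h1 := fourier_husimiMeasure h (t • z)
  simp only [phasePairing_smul, husimiVariance_smul, weylMean_smul] at h1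
  convert h1 using 1
  · congr 1; ext u; congr 1; push_cast; ring
  · congr 1
    rw [Real.coe_toNNReal _ (husimiVariance_nonneg h z)]
    push_cast
    ring

/-- The moment generating function of the normal law at `1`. It is stated in extended nonnegative
form so that it can enter Tonelli arguments directly. -/
lemma lintegral_exp_phasePairing {n : ℕ} {ρ : FockSpace n →L[ℂ] FockSpace n}
    (h : IsGaussianState ρ) (z : Fin n → ℂ) :
    ∫⁻ u, ENNReal.ofReal (Real.exp (phasePairing z u)) ∂husimiMeasure ρ =
      ENNReal.ofReal (Real.exp (-weylMean ρ z + husimiVariance ρ z / 2)) := by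
  have hm := (continuous_phasePairing z).measurable
  have hl := map_phasePairing_husimiMeasure h z
  have h1 : Integrable (fun u => Real.exp (phasePairing z u)) (husimiMeasure ρ) := by
    have h2 := integrable_exp_mul_gaussianReal (μ := -weylMean ρ z)
      (v := (husimiVariance ρ z).toNNReal) 1
    rw [← hl, integrable_map_measure (by fun_prop) hm.aemeasurable] at h2
    simpa [Function.comp_def] using h2
  rw [← ofReal_integral_eq_lintegral_ofReal h1 (Filter.Eventually.of_forall fun u =>
    (Real.exp_pos _).le)]
  have h3 := mgf_gaussianReal hl 1
  simp only [mgf, one_mul, mul_one, one_pow] at h3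
  rw [h3, Real.coe_toNNReal _ (husimiVariance_nonneg h z)]

lemma integrable_phasePairing_sq {n : ℕ} {ρ : FockSpace n →L[ℂ] FockSpace n}
    (h : IsGaussianState ρ) (z : Fin n → ℂ) :
    Integrable (fun u => phasePairing z u ^ 2) (husimiMeasure ρ) := by
  have hm := (continuous_phasePairing z).measurable
  have hl := map_phasePairing_husimiMeasure h z
  have h2 := (memLp_id_gaussianReal (μ := -weylMean ρ z)
      (v := (husimiVariance ρ z).toNNReal) 2).integrable_sq
  rw [← hl, integrable_map_measure (by fun_prop) hm.aemeasurable] at h2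
  exact h2

lemma integrable_norm_sq_husimiMeasure {n : ℕ} {ρ : FockSpace n →L[ℂ] FockSpace n}
    (h : IsGaussianState ρ) (j : Fin n) :
    Integrable (fun u : Fin n → ℂ => ‖u j‖ ^ 2) (husimiMeasure ρ) := by
  -- Pairing with these two vectors gives `-Im (u j)` and `Re (u j)`.
  have h1 := integrable_phasePairing_sq h (Pi.single j (1 / 2 : ℂ))
  have h2 := integrable_phasePairing_sq h (Pi.single j (Complex.I / 2))
  refine (h1.add h2).congr (Filter.Eventually.of_forall fun u => ?_)
  have hs : ∀ a : ℂ, phasePairing (Pi.single j a) u = 2 * (a * conj (u j)).im := fun a => by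
    rw [phasePairing, Finset.sum_eq_single j]
    · simp
    · intro b _ hb; simp [hb]
    · simp
  simp only [Pi.add_apply, hs]
  rw [Complex.sq_norm, Complex.normSq_apply]
  simp
  ring

/-! ### Diagonal coherent matrix elements determine an operator. -/

lemma entire_eq_zero_of_real {f : ℂ → ℂ} (hf : Differentiable ℂ f) (h : ∀ x : ℝ, f x = 0) :
    ∀ x, f x = 0 := by
  have h1 : AnalyticOnNhd ℂ f Set.univ := fun x _ => hf.analyticAt x
  have h2 : ∃ᶠ x in nhdsWithin (0 : ℂ) {0}ᶜ, f x = (fun _ => (0 : ℂ)) x := by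
    have ht : Filter.Tendsto (fun x : ℝ => (x : ℂ)) (nhdsWithin 0 {0}ᶜ)
        (nhdsWithin (0 : ℂ) {0}ᶜ) := by
      refine tendsto_nhdsWithin_iff.2 ⟨?_, ?_⟩
      · exact (Complex.continuous_ofReal.tendsto' 0 0 (by simp)).mono_left nhdsWithin_le_nhds
      · filter_upwards [self_mem_nhdsWithin] with x hx
        simpa using hx
    exact ht.frequently (Filter.Eventually.of_forall h).frequently
  have h3 := h1.eq_of_frequently_eq (fun x _ => analyticAt_const) h2
  exact fun x => congrFun h3 x

lemma star_expVec {n : ℕ} (u : Fin n → ℂ) : star (expVec u) = expVec (fun i => conj (u i)) := by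
  ext k
  exact conj_mono k u

/-- The complex bilinear pairing `(φ, ψ) ↦ ⟨conj φ, ψ⟩` on Fock space. -/
def conjPairing (n : ℕ) : FockSpace n →L[ℂ] FockSpace n →L[ℂ] ℂ :=
  (innerSL ℂ).comp ((starₗᵢ ℂ : FockSpace n ≃ₗᵢ⋆[ℂ] FockSpace n).toContinuousLinearEquiv :
    FockSpace n →L⋆[ℂ] FockSpace n)

lemma conjPairing_apply {n : ℕ} (φ ψ : FockSpace n) :
    conjPairing n φ ψ = inner ℂ (star φ) ψ := rfl

lemma conjPairing_expVec {n : ℕ} (u : Fin n → ℂ) (ψ : FockSpace n) :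
    conjPairing n (expVec u) ψ = inner ℂ (expVec fun i => conj (u i)) ψ := by
  rw [conjPairing_apply, star_expVec]

/-- An operator is determined by its diagonal matrix elements in exponential vectors. -/
lemma eq_zero_of_inner_expVec_self {n : ℕ} {H : FockSpace n →L[ℂ] FockSpace n}
    (h : ∀ u, inner ℂ (expVec u) (H (expVec u)) = 0) : H = 0 := by
  refine ext_expVec fun a v => ?_
  obtain ⟨b, rfl⟩ : ∃ b, v = a + b := ⟨v - a, by simp⟩
  set ab : Fin n → ℂ := fun i => conj (a i)
  set bb : Fin n → ℂ := fun i => conj (b i)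
  -- For real `x` and `y` this is the diagonal matrix element at `a + (x + iy) b`. The bilinear
  -- pairing makes it holomorphic in each variable, so its vanishing extends to complex `x`, then
  -- `y`.
  set F : ℂ → ℂ → ℂ := fun x y => conjPairing n (expVec (ab + (x - Complex.I * y) • bb))
    (H (expVec (a + (x + Complex.I * y) • b))) with hF
  have hreal : ∀ x y : ℝ, F x y = 0 := fun x y => by
    rw [← h (a + ((x : ℂ) + Complex.I * y) • b), hF]
    simp only
    rw [conjPairing_expVec]
    congr 2
    ext i
    simp only [ab, bb, Pi.add_apply, Pi.smul_apply, smul_eq_mul, map_add, map_mul,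
      Complex.conj_conj, map_sub, Complex.conj_ofReal, Complex.conj_I]
    ring
  have hd : ∀ p q : ℂ → ℂ, Differentiable ℂ p → Differentiable ℂ q → Differentiable ℂ fun x =>
      conjPairing n (expVec (ab + p x • bb)) (H (expVec (a + q x • b))) := by
    intro p q hp hq
    have h1 : Differentiable ℂ fun x => expVec (ab + p x • bb) :=
      (differentiable_expVec ab bb).comp hp
    have h2 : Differentiable ℂ fun x => expVec (a + q x • b) :=
      (differentiable_expVec a b).comp hq
    have h3 : Differentiable ℂ fun x => conjPairing n (expVec (ab + p x • bb)) :=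
      (conjPairing n).differentiable.comp h1
    have h4 : Differentiable ℂ fun x => H (expVec (a + q x • b)) := H.differentiable.comp h2
    exact h3.clm_apply h4
  have hx : ∀ (x : ℂ) (y : ℝ), F x y = 0 := fun x y =>
    entire_eq_zero_of_real (f := fun x => F x y) (hd (fun x => x - Complex.I * y)
      (fun x => x + Complex.I * y) (by fun_prop) (by fun_prop)) (fun x => hreal x y) x
  have hxy : ∀ x y : ℂ, F x y = 0 := fun x y =>
    entire_eq_zero_of_real (f := fun y => F x y) (hd (fun y => x - Complex.I * y)
      (fun y => x + Complex.I * y) (by fun_prop) (by fun_prop)) (fun y => hx x y) y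
  -- With these values `x - iy = 0` and `x + iy = 1`, which yields the off-diagonal element between
  -- `a` and `a + b`.
  have h1 := hxy (1 / 2) (-Complex.I / 2)
  have e1 : (1 / 2 - Complex.I * (-Complex.I / 2) : ℂ) = 0 := by
    linear_combination (1 / 2 : ℂ) * Complex.I_sq
  have e2 : (1 / 2 + Complex.I * (-Complex.I / 2) : ℂ) = 1 := by
    linear_combination (-1 / 2 : ℂ) * Complex.I_sq
  rw [hF] at h1
  simp only [e1, e2, zero_smul, add_zero, one_smul] at h1
  rw [conjPairing_expVec] at h1
  simpa [ab] using h1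

lemma ext_inner_cohVec_self {n : ℕ} {S T : FockSpace n →L[ℂ] FockSpace n}
    (h : ∀ u, inner ℂ (cohVec u) (S (cohVec u)) = inner ℂ (cohVec u) (T (cohVec u))) : S = T := by
  rw [← sub_eq_zero]
  refine eq_zero_of_inner_expVec_self fun u => ?_
  have h1 := h u
  simp only [cohVec, map_smul, inner_smul_left, inner_smul_right, Complex.conj_ofReal] at h1
  have h0 : ((Real.exp (-(∑ i, ‖u i‖ ^ 2) / 2) : ℝ) : ℂ) ≠ 0 := by
    exact_mod_cast (Real.exp_pos _).ne'
  rw [sub_apply, inner_sub_right, sub_eq_zero]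
  exact mul_left_cancel₀ h0 (mul_left_cancel₀ h0 h1)

/-! ### Finiteness of the mean photon numbers. -/

lemma mul_inner_cohVec_fock {n : ℕ} (j : Fin n) (k : Fin n → ℕ) (u : Fin n → ℂ) :
    conj (u j) * inner ℂ (cohVec u) (fock k) =
      ((Real.sqrt (k j + 1) : ℝ) : ℂ) * inner ℂ (cohVec u) (fock (k + Pi.single j 1)) := by
  have h := congrArg conj (mul_mono k j u)
  simp only [map_mul, Complex.conj_ofReal] at h
  rw [cohVec, inner_smul_left, inner_smul_left, inner_expVec_fock, inner_expVec_fock,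
    mul_left_comm, h]
  ring

/-- Bessel's inequality for multiplication by a coordinate in the Bargmann representation. -/
lemma sum_number_mul_norm_sq_le {n : ℕ} (j : Fin n) (ψ : FockSpace n)
    (hi : Integrable (fun u : Fin n → ℂ => ‖u j‖ ^ 2 * ‖inner ℂ (cohVec u) ψ‖ ^ 2)
      (phaseMeasure n)) (s : Finset (Fin n → ℕ)) :
    ∑ k ∈ s, ((k j : ℝ) + 1) * ‖ψ k‖ ^ 2 ≤
      ∫ u, ‖u j‖ ^ 2 * ‖inner ℂ (cohVec u) ψ‖ ^ 2 ∂phaseMeasure n := by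
  have hcoh := continuous_cohVec n
  have hc : ∀ χ : FockSpace n, Continuous fun u : Fin n → ℂ => inner ℂ (cohVec u) χ := fun χ =>
    hcoh.inner continuous_const
  obtain ⟨T, hT⟩ := exists_analysisOperator (hcoh.aestronglyMeasurable (μ := phaseMeasure n))
    eLpNorm_inner_cohVec_le
  have hTT : ∀ φ χ, inner ℂ (T φ) (T χ) = inner ℂ φ χ := fun φ χ => by
    rw [← (resolution_of_identity φ χ).2, L2.inner_def]
    refine integral_congr_ae ?_
    filter_upwards [hT φ, hT χ] with u h1 h2
    rw [h1, h2, RCLike.inner_apply, inner_conj_symm, mul_comm]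
  have hmem : ∀ χ : FockSpace n, MemLp (fun u => inner ℂ (cohVec u) χ) 2 (phaseMeasure n) :=
    fun χ => ⟨(hc χ).aestronglyMeasurable,
      (eLpNorm_inner_cohVec_le χ).trans_lt ENNReal.ofReal_lt_top⟩
  have hcj : Continuous fun u : Fin n → ℂ => conj (u j) :=
    Complex.continuous_conj.comp (continuous_apply j)
  have hg : MemLp (fun u : Fin n → ℂ => conj (u j) * inner ℂ (cohVec u) ψ) 2 (phaseMeasure n) := by
    have hm : AEStronglyMeasurable (fun u : Fin n → ℂ => conj (u j) * inner ℂ (cohVec u) ψ)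
        (phaseMeasure n) := (hcj.mul (hc ψ)).aestronglyMeasurable
    rw [memLp_two_iff_integrable_sq_norm hm]
    refine hi.congr (Filter.Eventually.of_forall fun u => ?_)
    simp only [norm_mul, RCLike.norm_conj, mul_pow]
  have hp : ∀ l : Fin n → ℕ,
      MemLp (fun u : Fin n → ℂ => u j * inner ℂ (cohVec u) (fock l)) 2 (phaseMeasure n) := by
    intro l
    refine ((hmem (fock (l + Pi.single j 1))).const_mul
      ((Real.sqrt (l j + 1) : ℝ) : ℂ)).congr_norm
      ((continuous_apply j).mul (hc _)).aestronglyMeasurable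
      (Filter.Eventually.of_forall fun u => ?_)
    rw [← mul_inner_cohVec_fock, norm_mul, norm_mul, RCLike.norm_conj]
  -- The analysis map `T` is isometric, so the images of the raised Fock states are orthonormal in
  -- L². Bessel's inequality is applied to `conj (u j) ⟨u, ψ⟩`, whose coefficients against them are
  -- `√(k j + 1) ψ k`.
  set W : (Fin n → ℕ) → Lp ℂ 2 (phaseMeasure n) := fun k => T (fock (k + Pi.single j 1))
  have hW : Orthonormal ℂ W := by
    rw [orthonormal_iff_ite]
    intro k l
    rw [hTT, inner_fock_left, fock_apply]
    simp
  -- Synthesis from `u j` times the coherent coefficients applies the annihilation operator of mode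
  -- `j`, which lowers the raised state back to `k`.
  have hadj : ∀ k, T.adjoint ((hp (k + Pi.single j 1)).toLp _) =
      ((Real.sqrt (k j + 1) : ℝ) : ℂ) • fock k := by
    intro k
    ext i
    rw [← inner_fock_left, ← inner_fock_left, ContinuousLinearMap.adjoint_inner_right,
      inner_smul_right, inner_fock_left, fock_apply, L2.inner_def]
    have h1 : (fun u => inner ℂ (T (fock i) u) ((hp (k + Pi.single j 1)).toLp _ u))
        =ᵐ[phaseMeasure n] fun u => ((Real.sqrt (i j + 1) : ℝ) : ℂ) *
          (inner ℂ (fock (i + Pi.single j 1)) (cohVec u) *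
            inner ℂ (cohVec u) (fock (k + Pi.single j 1))) := by
      filter_upwards [hT (fock i), (hp (k + Pi.single j 1)).coeFn_toLp] with u h1 h2
      have h3 := congrArg conj (mul_inner_cohVec_fock j i u)
      simp only [map_mul, Complex.conj_conj, Complex.conj_ofReal, inner_conj_symm] at h3
      rw [h1, h2, RCLike.inner_apply, inner_conj_symm, ← mul_assoc, ← h3]
      ring
    rw [integral_congr_ae h1, integral_const_mul, (orthogonality_phase _ _).2, inner_fock_left,
      fock_apply]
    by_cases hik : i = k
    · subst hik; simp
    · simp [hik]
  have hWg : ∀ k, inner ℂ (W k) (hg.toLp _) = ((Real.sqrt (k j + 1) : ℝ) : ℂ) * ψ k := by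
    intro k
    have h1 : inner ℂ (W k) (hg.toLp _) =
        inner ℂ ((hp (k + Pi.single j 1)).toLp _) (T ψ) := by
      rw [L2.inner_def, L2.inner_def]
      refine integral_congr_ae ?_
      filter_upwards [hT (fock (k + Pi.single j 1)), hT ψ, hg.coeFn_toLp,
        (hp (k + Pi.single j 1)).coeFn_toLp] with u h1 h2 h3 h4
      simp only [W]
      rw [h1, h2, h3, h4, RCLike.inner_apply, RCLike.inner_apply, map_mul]
      ring
    rw [h1, ← ContinuousLinearMap.adjoint_inner_left, hadj, inner_smul_left, inner_fock_left,
      Complex.conj_ofReal]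
  have hb := hW.sum_inner_products_le (x := hg.toLp _) (s := s)
  have hnorm : ‖hg.toLp _‖ ^ 2 =
      ∫ u, ‖u j‖ ^ 2 * ‖inner ℂ (cohVec u) ψ‖ ^ 2 ∂phaseMeasure n := by
    have h1 := inner_self_eq_norm_sq_to_K (𝕜 := ℂ) (hg.toLp _)
    rw [L2.inner_def] at h1
    have h2 : (fun u => inner ℂ (hg.toLp _ u) (hg.toLp _ u)) =ᵐ[phaseMeasure n]
        fun u => ((‖u j‖ ^ 2 * ‖inner ℂ (cohVec u) ψ‖ ^ 2 : ℝ) : ℂ) := by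
      filter_upwards [hg.coeFn_toLp] with u h1
      rw [h1, inner_self_eq_norm_sq_to_K, norm_mul, RCLike.norm_conj, ← mul_pow]
      push_cast; rfl
    rw [integral_congr_ae h2, integral_complex_ofReal] at h1
    refine Complex.ofReal_injective (Eq.trans ?_ h1.symm)
    push_cast; rfl
  rw [hnorm] at hb
  refine le_trans (le_of_eq (Finset.sum_congr rfl fun k _ => ?_)) hb
  rw [hWg, norm_mul, mul_pow, Complex.norm_real, Real.norm_eq_abs, sq_abs,
    Real.sq_sqrt (by positivity)]

/-- In extended nonnegative form the integrability assumption disappears: otherwise the right side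
is infinite. -/
lemma tsum_number_mul_norm_sq_le {n : ℕ} (j : Fin n) (ψ : FockSpace n) :
    ∑' k : Fin n → ℕ, ENNReal.ofReal (((k j : ℝ) + 1) * ‖ψ k‖ ^ 2) ≤
      ∫⁻ u, ENNReal.ofReal (‖u j‖ ^ 2 * ‖inner ℂ (cohVec u) ψ‖ ^ 2) ∂phaseMeasure n := by
  have hc : Continuous fun u : Fin n → ℂ => ‖u j‖ ^ 2 * ‖inner ℂ (cohVec u) ψ‖ ^ 2 :=
    ((continuous_apply j).norm.pow 2).mul
      (((continuous_cohVec n).inner continuous_const).norm.pow 2)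
  have h0 : ∀ u : Fin n → ℂ, 0 ≤ ‖u j‖ ^ 2 * ‖inner ℂ (cohVec u) ψ‖ ^ 2 := fun u => by positivity
  by_cases hi : Integrable (fun u : Fin n → ℂ => ‖u j‖ ^ 2 * ‖inner ℂ (cohVec u) ψ‖ ^ 2)
      (phaseMeasure n)
  · rw [← ofReal_integral_eq_lintegral_ofReal hi (Filter.Eventually.of_forall h0)]
    rw [ENNReal.tsum_eq_iSup_sum]
    refine iSup_le fun s => ?_
    rw [← ENNReal.ofReal_sum_of_nonneg fun k _ => by positivity]
    exact ENNReal.ofReal_le_ofReal (sum_number_mul_norm_sq_le j ψ hi s)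
  · have : ∫⁻ u, ENNReal.ofReal (‖u j‖ ^ 2 * ‖inner ℂ (cohVec u) ψ‖ ^ 2) ∂phaseMeasure n = ⊤ := by
      by_contra hne
      exact hi ((lintegral_ofReal_ne_top_iff_integrable hc.aestronglyMeasurable
        (Filter.Eventually.of_forall h0)).1 hne)
    rw [this]; exact le_top

/-- The mean photon numbers of a Gaussian state are finite. -/
lemma summable_number {n : ℕ} {ρ B : FockSpace n →L[ℂ] FockSpace n} (h : IsGaussianState ρ)
    (hB : ∀ φ ψ, inner ℂ (B φ) ψ = inner ℂ φ (B ψ)) (hρ : ∀ φ, ρ φ = B (B φ)) (j : Fin n) :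
    Summable fun k : Fin n → ℕ => ((k j : ℝ) + 1) * ‖B (fock k)‖ ^ 2 := by
  have hcoh := continuous_cohVec n
  have h1 : ∫⁻ u, ENNReal.ofReal (‖u j‖ ^ 2) ∂husimiMeasure ρ ≠ ⊤ :=
    ((integrable_norm_sq_husimiMeasure h j).lintegral_lt_top).ne
  have h2 : ∫⁻ u, ENNReal.ofReal (‖u j‖ ^ 2) ∂husimiMeasure ρ =
      ∑' m, ∫⁻ u, ENNReal.ofReal (‖u j‖ ^ 2 * ‖inner ℂ (cohVec u) (B (fock m))‖ ^ 2)
        ∂phaseMeasure n := by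
    rw [← lintegral_tsum]
    · rw [husimiMeasure, lintegral_withDensity_eq_lintegral_mul _
        (continuous_husimi ρ).measurable.ennreal_ofReal (by fun_prop)]
      refine lintegral_congr fun u => ?_
      have hs := hasSum_norm_inner_cohVec hB (cohVec u)
      rw [Pi.mul_apply, husimi_eq_norm_sq hB hρ, ← ENNReal.ofReal_mul (by positivity), mul_comm,
        ← hs.tsum_eq, ← tsum_mul_left,
        ENNReal.ofReal_tsum_of_nonneg (fun m => by positivity) (hs.summable.mul_left _)]
    · intro m
      have hc : Continuous fun u : Fin n → ℂ => ‖u j‖ ^ 2 * ‖inner ℂ (cohVec u) (B (fock m))‖ ^ 2 :=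
        ((continuous_apply j).norm.pow 2).mul ((hcoh.inner continuous_const).norm.pow 2)
      exact hc.measurable.ennreal_ofReal.aemeasurable
  have h3 : ∑' m, ∑' k : Fin n → ℕ, ENNReal.ofReal (((k j : ℝ) + 1) * ‖B (fock m) k‖ ^ 2) ≠ ⊤ :=
    ne_top_of_le_ne_top h1 (h2 ▸ ENNReal.tsum_le_tsum fun m => tsum_number_mul_norm_sq_le j _)
  -- For fixed `k` the squared matrix elements of `B`, summed over `m`, give `‖B k‖²`; exchanging
  -- the sums turns the Husimi second moment into a bound on the mean photon number.
  rw [ENNReal.tsum_comm] at h3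
  have h4 : ∀ k : Fin n → ℕ, ∑' m, ENNReal.ofReal (((k j : ℝ) + 1) * ‖B (fock m) k‖ ^ 2) =
      ENNReal.ofReal (((k j : ℝ) + 1) * ‖B (fock k)‖ ^ 2) := fun k => by
    have hs := hasSum_norm_inner_cohVec hB (fock k)
    simp only [inner_fock_left] at hs
    rw [← hs.tsum_eq, ← tsum_mul_left,
      ENNReal.ofReal_tsum_of_nonneg (fun m => by positivity) (hs.summable.mul_left _)]
  simp only [h4] at h3
  refine (ENNReal.summable_toReal h3).congr fun k => ?_
  rw [ENNReal.toReal_ofReal (by positivity)]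

/-- Cauchy–Schwarz over the modes reduces the trace of `a(c) ρ a†(c)` to the mean photon numbers,
after reindexing by the raised state. -/
lemma summable_norm_sq_aDag {n : ℕ} {ρ B : FockSpace n →L[ℂ] FockSpace n} (h : IsGaussianState ρ)
    (hB : ∀ φ ψ, inner ℂ (B φ) ψ = inner ℂ φ (B ψ)) (hρ : ∀ φ, ρ φ = B (B φ)) (c : Fin n → ℂ) :
    Summable fun k : Fin n → ℕ => ‖B (incl n (aDag c (basisVec k)))‖ ^ 2 := by
  have h1 : ∀ j, Summable fun k : Fin n → ℕ =>
      ‖c j‖ ^ 2 * (((k j : ℝ) + 1) * ‖B (fock (k + Pi.single j 1))‖ ^ 2) := fun j => by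
    have h2 := (summable_number h hB hρ j).comp_injective
      (i := fun k : Fin n → ℕ => k + Pi.single j 1) (add_left_injective _)
    refine Summable.mul_left _ (Summable.of_nonneg_of_le (fun k => by positivity) (fun k => ?_) h2)
    simp only [Function.comp_apply, Pi.add_apply, Pi.single_eq_same]
    refine mul_le_mul_of_nonneg_right ?_ (by positivity)
    push_cast; linarith
  refine Summable.of_nonneg_of_le (fun k => by positivity) (fun k => ?_)
    ((summable_sum (s := Finset.univ) fun j _ => h1 j).mul_left (n : ℝ))
  have h3 : B (incl n (aDag c (basisVec k))) =
      ∑ j, (c j * ((Real.sqrt (k j + 1) : ℝ) : ℂ)) • B (fock (k + Pi.single j 1)) := by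
    simp only [aDag, LinearMap.sum_apply, LinearMap.smul_apply, creation_basisVec, map_sum,
      map_smul, incl_basisVec, smul_smul]
  rw [h3]
  calc ‖∑ j, (c j * ((Real.sqrt (k j + 1) : ℝ) : ℂ)) • B (fock (k + Pi.single j 1))‖ ^ 2
      ≤ (∑ j, ‖(c j * ((Real.sqrt (k j + 1) : ℝ) : ℂ)) • B (fock (k + Pi.single j 1))‖) ^ 2 :=
        pow_le_pow_left₀ (norm_nonneg _) (norm_sum_le _ _) 2
    _ ≤ (n : ℝ) * ∑ j, ‖(c j * ((Real.sqrt (k j + 1) : ℝ) : ℂ)) •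
          B (fock (k + Pi.single j 1))‖ ^ 2 := by
        have := sq_sum_le_card_mul_sum_sq (s := (Finset.univ : Finset (Fin n)))
          (f := fun j => ‖(c j * ((Real.sqrt (k j + 1) : ℝ) : ℂ)) • B (fock (k + Pi.single j 1))‖)
        simpa using this
    _ = _ := by
        congr 1
        refine Finset.sum_congr rfl fun j _ => ?_
        rw [norm_smul, norm_mul, mul_pow, mul_pow, Complex.norm_real, Real.norm_eq_abs, sq_abs,
          Real.sq_sqrt (by positivity), mul_assoc]

/-! ### Existence and uniqueness of the photon-subtracted state. -/

lemma subtractedForm_eq {n : ℕ} {ρ B : FockSpace n →L[ℂ] FockSpace n}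
    (hB : ∀ φ ψ, inner ℂ (B φ) ψ = inner ℂ φ (B ψ)) (hρ : ∀ φ, ρ φ = B (B φ)) (c : Fin n → ℂ)
    (φ ψ : FiniteVectors n) :
    subtractedForm c ρ φ ψ = inner ℂ (B (incl n (aDag c φ))) (B (incl n (aDag c ψ))) := by
  rw [subtractedForm, hρ, hB]

lemma hasSum_subtractedTrace {n : ℕ} {ρ B : FockSpace n →L[ℂ] FockSpace n}
    (h : IsGaussianState ρ) (hB : ∀ φ ψ, inner ℂ (B φ) ψ = inner ℂ φ (B ψ))
    (hρ : ∀ φ, ρ φ = B (B φ)) (c : Fin n → ℂ) :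
    HasSum (fun k : Fin n → ℕ => subtractedForm c ρ (basisVec k) (basisVec k))
      ((∑' k : Fin n → ℕ, ‖B (incl n (aDag c (basisVec k)))‖ ^ 2 : ℝ) : ℂ) := by
  have h1 := Complex.hasSum_ofReal.2 (summable_norm_sq_aDag h hB hρ c).hasSum
  refine (congrArg (fun f => HasSum f _) (funext fun k => ?_)).mp h1
  rw [subtractedForm_eq hB hρ, inner_self_eq_norm_sq_to_K]
  push_cast; rfl

/-- If the trace vanished, `B a†(c)` would kill every Fock state and the whole form would be zero.
-/
lemma subtractedTrace_pos {n : ℕ} {ρ B : FockSpace n →L[ℂ] FockSpace n}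
    (h : IsGaussianState ρ) (hB : ∀ φ ψ, inner ℂ (B φ) ψ = inner ℂ φ (B ψ))
    (hρ : ∀ φ, ρ φ = B (B φ)) {c : Fin n → ℂ} (hc : subtractedForm c ρ ≠ 0) :
    0 < ∑' k : Fin n → ℕ, ‖B (incl n (aDag c (basisVec k)))‖ ^ 2 := by
  have hs := summable_norm_sq_aDag h hB hρ c
  refine lt_of_le_of_ne (tsum_nonneg fun k => by positivity) fun h0 => hc ?_
  have h1 : ∀ k : Fin n → ℕ, B (incl n (aDag c (basisVec k))) = 0 := fun k => by
    have h2 := (hs.hasSum_iff.2 h0.symm)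
    rw [hasSum_zero_iff_of_nonneg fun k => by positivity] at h2
    simpa using congrFun h2 k
  have h2 : (B : FockSpace n →ₗ[ℂ] FockSpace n) ∘ₗ (incl n) ∘ₗ (aDag c) = 0 :=
    linearMap_ext_basisVec h1
  funext φ ψ
  rw [subtractedForm_eq hB hρ]
  have h3 : B (incl n (aDag c φ)) = 0 := LinearMap.congr_fun h2 φ
  rw [h3, inner_zero_left]; rfl

/-- Although `a†(c)` is unbounded, `B a†(c)` has square-summable columns, so Cauchy–Schwarz bounds
it on the dense finite vectors. Then `a(c) ρ a†(c)` is realized as `T* T`. -/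
lemma exists_subtracted_factor {n : ℕ} {ρ B : FockSpace n →L[ℂ] FockSpace n}
    (h : IsGaussianState ρ) (hB : ∀ φ ψ, inner ℂ (B φ) ψ = inner ℂ φ (B ψ))
    (hρ : ∀ φ, ρ φ = B (B φ)) (c : Fin n → ℂ) :
    ∃ T : FockSpace n →L[ℂ] FockSpace n, ∀ φ, T (incl n φ) = B (incl n (aDag c φ)) := by
  have hs := summable_norm_sq_aDag h hB hρ c
  set f : FiniteVectors n →ₗ[ℂ] FockSpace n :=
    (B : FockSpace n →ₗ[ℂ] FockSpace n) ∘ₗ (incl n) ∘ₗ (aDag c) with hf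
  obtain ⟨S, hS⟩ : ∃ S, S = ∑' k : Fin n → ℕ, ‖B (incl n (aDag c (basisVec k)))‖ ^ 2 := ⟨_, rfl⟩
  refine ⟨f.extendOfNorm (incl n), fun φ => ?_⟩
  rw [LinearMap.extendOfNorm_eq (denseRange_incl n) ⟨Real.sqrt S, fun φ => ?_⟩]
  · rfl
  have h1 : φ = ∑ k ∈ φ.support, φ k • basisVec k := by
    conv_lhs => rw [← Finsupp.sum_single φ]
    simp [Finsupp.sum, basisVec]
  have h2 : f φ = ∑ k ∈ φ.support, φ k • B (incl n (aDag c (basisVec k))) := by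
    conv_lhs => rw [h1]
    simp only [map_sum, map_smul]; rfl
  have h3 : ∑ k ∈ φ.support, ‖φ k‖ ^ 2 ≤ ‖incl n φ‖ ^ 2 := by
    have := sum_le_hasSum φ.support (fun k _ => by positivity) (hasSum_norm_sq (incl n φ))
    simpa only [inner_fock_left, incl_apply] using this
  have h4 : ∑ k ∈ φ.support, ‖B (incl n (aDag c (basisVec k)))‖ ^ 2 ≤ S := by
    rw [hS]; exact hs.sum_le_tsum _ fun k _ => by positivity
  rw [h2]
  calc ‖∑ k ∈ φ.support, φ k • B (incl n (aDag c (basisVec k)))‖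
      ≤ ∑ k ∈ φ.support, ‖φ k‖ * ‖B (incl n (aDag c (basisVec k)))‖ :=
        norm_sum_le_of_le _ fun k _ => (norm_smul _ _).le
    _ ≤ Real.sqrt (∑ k ∈ φ.support, ‖φ k‖ ^ 2) *
          Real.sqrt (∑ k ∈ φ.support, ‖B (incl n (aDag c (basisVec k)))‖ ^ 2) :=
        Real.sum_mul_le_sqrt_mul_sqrt _ _ _
    _ ≤ Real.sqrt (‖incl n φ‖ ^ 2) * Real.sqrt S :=
        mul_le_mul (Real.sqrt_le_sqrt h3) (Real.sqrt_le_sqrt h4) (Real.sqrt_nonneg _)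
          (Real.sqrt_nonneg _)
    _ = Real.sqrt S * ‖incl n φ‖ := by rw [Real.sqrt_sq (norm_nonneg _)]; exact mul_comm _ _

lemma exists_isPhotonSubtracted {n : ℕ} {ρ : FockSpace n →L[ℂ] FockSpace n}
    (h : IsGaussianState ρ) {c : Fin n → ℂ} (hc : subtractedForm c ρ ≠ 0) :
    ∃ σ, IsPhotonSubtracted c ρ σ := by
  obtain ⟨B, hB, hρ, -⟩ := h.isState.exists_sqrt
  obtain ⟨T, hT⟩ := exists_subtracted_factor h hB hρ c
  have hpos := subtractedTrace_pos h hB hρ hc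
  have htr := hasSum_subtractedTrace h hB hρ c
  set N := ∑' k : Fin n → ℕ, ‖B (incl n (aDag c (basisVec k)))‖ ^ 2 with hN
  have htr' : subtractedTrace c ρ = (N : ℂ) := htr.tsum_eq
  have hform : ∀ φ ψ : FiniteVectors n,
      inner ℂ (incl n φ) ((((N⁻¹ : ℝ) : ℂ) • (T.adjoint ∘L T)) (incl n ψ)) =
        (subtractedTrace c ρ)⁻¹ * subtractedForm c ρ φ ψ := fun φ ψ => by
    rw [smul_apply, inner_smul_right, ContinuousLinearMap.comp_apply,
      ContinuousLinearMap.adjoint_inner_right, hT, hT, subtractedForm_eq hB hρ, htr',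
      Complex.ofReal_inv]
  refine ⟨((N⁻¹ : ℝ) : ℂ) • (T.adjoint ∘L T), ⟨⟨?_, ?_⟩, hform⟩⟩
  · refine ContinuousLinearMap.IsPositive.smul_of_nonneg
      (ContinuousLinearMap.isPositive_adjoint_comp_self T) ?_
    rw [Complex.zero_le_real]
    positivity
  · have h1 := htr.mul_left ((N : ℂ)⁻¹)
    rw [inv_mul_cancel₀ (by exact_mod_cast hpos.ne')] at h1
    refine (congrArg (fun f => HasSum f _) (funext fun k => ?_)).mp h1
    rw [← htr', ← hform]; rfl

lemma IsPhotonSubtracted.unique {n : ℕ} {ρ σ τ : FockSpace n →L[ℂ] FockSpace n} {c : Fin n → ℂ}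
    (hσ : IsPhotonSubtracted c ρ σ) (hτ : IsPhotonSubtracted c ρ τ) : σ = τ :=
  ext_fock fun _ _ => (hσ.matrix_elements _ _).trans (hτ.matrix_elements _ _).symm

/-! ### From `V - 1 ≥ 0` to a mixture of coherent states. -/

/-- The coordinates of a phase space point, rotated by `Ωᵀ`. -/
def rotVec {n : ℕ} (z : Fin n → ℂ) : Fin n × Fin 2 → ℝ :=
  (symplecticForm n).transpose *ᵥ toRealVec z

lemma rotVec_apply {n : ℕ} (z : Fin n → ℂ) (i : Fin n × Fin 2) :
    rotVec z i = if i.2 = 0 then -(z i.1).im else (z i.1).re := by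
  obtain ⟨j, a⟩ := i
  simp only [rotVec, Matrix.mulVec, dotProduct, Matrix.transpose_apply, symplecticForm,
    Matrix.of_apply, Fintype.sum_prod_type, Fin.sum_univ_two, toRealVec]
  rw [Finset.sum_eq_single j]
  · fin_cases a <;> simp
  · intro b _ hb; simp [hb]
  · simp

lemma exists_rotVec_eq {n : ℕ} (x : Fin n × Fin 2 → ℝ) : ∃ z : Fin n → ℂ, rotVec z = x := by
  refine ⟨fun j => ⟨x (j, 1), -x (j, 0)⟩, ?_⟩
  ext ⟨j, a⟩
  rw [rotVec_apply]
  fin_cases a <;> simp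

lemma sum_norm_sq_eq_rotVec {n : ℕ} (z : Fin n → ℂ) :
    ∑ i, ‖z i‖ ^ 2 = rotVec z ⬝ᵥ rotVec z := by
  simp only [dotProduct, Fintype.sum_prod_type, Fin.sum_univ_two, rotVec_apply]
  refine Finset.sum_congr rfl fun i _ => ?_
  rw [Complex.sq_norm, Complex.normSq_apply]
  simp
  ring

lemma phasePairing_toComplexVec {n : ℕ} (z : Fin n → ℂ) (y : Fin n × Fin 2 → ℝ) :
    phasePairing z (toComplexVec y) = -2 * (rotVec z ⬝ᵥ y) := by
  simp only [phasePairing, dotProduct, Fintype.sum_prod_type, Fin.sum_univ_two, rotVec_apply,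
    Finset.mul_sum]
  refine Finset.sum_congr rfl fun i _ => ?_
  simp [toComplexVec]
  ring

lemma weylVariance_eq {n : ℕ} (ρ : FockSpace n →L[ℂ] FockSpace n) (z : Fin n → ℂ) :
    weylVariance ρ z = rotVec z ⬝ᵥ covMatrix ρ *ᵥ rotVec z := by
  rw [weylVariance, rotVec, ← Matrix.mulVec_mulVec, ← Matrix.mulVec_mulVec,
    Matrix.dotProduct_mulVec, Matrix.mulVec_transpose]

lemma weylVariance_sub {n : ℕ} (ρ : FockSpace n →L[ℂ] FockSpace n) (z : Fin n → ℂ) :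
    weylVariance ρ z - ∑ i, ‖z i‖ ^ 2 = rotVec z ⬝ᵥ (covMatrix ρ - 1) *ᵥ rotVec z := by
  rw [weylVariance_eq, sum_norm_sq_eq_rotVec, Matrix.sub_mulVec, dotProduct_sub, Matrix.one_mulVec]

lemma weylMean_eq {n : ℕ} (ρ : FockSpace n →L[ℂ] FockSpace n) (z : Fin n → ℂ) :
    weylMean ρ z = Real.sqrt 2 * (rotVec z ⬝ᵥ meanVec ρ) := by
  rw [weylMean, rotVec, Matrix.mulVec_transpose, ← Matrix.dotProduct_mulVec, dotProduct_comm]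

/-- Since every real linear functional is a phase pairing, a finite measure is determined by its
Fourier transform in this pairing. -/
lemma exists_phasePairing_eq {n : ℕ} (L : StrongDual ℝ (Fin n → ℂ)) :
    ∃ z : Fin n → ℂ, ∀ u, L u = phasePairing z u := by
  refine ⟨fun j => ⟨-L (Pi.single j Complex.I) / 2, L (Pi.single j 1) / 2⟩, fun u => ?_⟩
  have hu : u = ∑ j, ((u j).re • (Pi.single j 1 : Fin n → ℂ) +
      (u j).im • (Pi.single j Complex.I : Fin n → ℂ)) := by
    ext i
    simp only [Finset.sum_apply, Pi.add_apply, Pi.smul_apply, Complex.real_smul]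
    rw [Finset.sum_eq_single i]
    · simp [Complex.re_add_im]
    · intro b _ hb; simp [hb.symm]
    · simp
  conv_lhs => rw [hu]
  simp only [map_sum, map_add, map_smul, smul_eq_mul, phasePairing, Finset.mul_sum]
  refine Finset.sum_congr rfl fun j _ => ?_
  simp
  ring

/-- There is a probability measure on phase space with prescribed Gaussian Fourier transform. -/
lemma exists_gaussian_measure {n : ℕ} (S : Matrix (Fin n × Fin 2) (Fin n × Fin 2) ℝ)
    (hS : S.PosSemidef) (d : Fin n × Fin 2 → ℝ) :
    ∃ P : Measure (Fin n → ℂ), IsProbabilityMeasure P ∧ ∀ z,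
      ∫ w, Complex.exp (Complex.I * phasePairing z w) ∂P =
        Complex.exp (-((rotVec z ⬝ᵥ S *ᵥ rotVec z : ℝ) : ℂ) / 2 -
          Complex.I * ((Real.sqrt 2 * (rotVec z ⬝ᵥ d) : ℝ) : ℂ)) := by
  -- The mean supplies the linear term of the target exponent; the scaling by `-1/2` in `G` cancels
  -- the factor `-2` that relates `phasePairing` to the real dot product.
  set μ : EuclideanSpace ℝ (Fin n × Fin 2) := WithLp.toLp 2 (fun i => -Real.sqrt 2 * d i)
  set G : EuclideanSpace ℝ (Fin n × Fin 2) → Fin n → ℂ :=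
    fun y => toComplexVec (fun i => -(1 / 2) * y i) with hG
  have hGc : Continuous G := by
    refine continuous_pi fun j => ?_
    simp only [hG, toComplexVec]
    fun_prop
  refine ⟨(multivariateGaussian μ S).map G, Measure.isProbabilityMeasure_map hGc.aemeasurable,
    fun z => ?_⟩
  have hpp := continuous_phasePairing z
  rw [integral_map hGc.aemeasurable (by fun_prop)]
  have h := charFun_multivariateGaussian (μ := μ) hS (WithLp.toLp 2 (rotVec z))
  rw [charFun_apply] at h
  convert h using 1
  · congr 1; ext y
    rw [hG]
    simp only
    rw [phasePairing_toComplexVec, mul_comm Complex.I]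
    congr 3
    rw [EuclideanSpace.inner_eq_star_dotProduct]
    simp only [dotProduct, Finset.mul_sum, star_trivial]
    refine Finset.sum_congr rfl fun i _ => ?_
    ring
  · congr 1
    rw [EuclideanSpace.inner_eq_star_dotProduct]
    have : (μ.ofLp ⬝ᵥ star (WithLp.toLp 2 (rotVec z)).ofLp) =
        -(Real.sqrt 2 * (rotVec z ⬝ᵥ d)) := by
      simp only [μ, dotProduct, Finset.mul_sum, star_trivial, ← Finset.sum_neg_distrib]
      refine Finset.sum_congr rfl fun i _ => ?_
      ring
    rw [this]
    push_cast
    ring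

lemma norm_sq_inner_cohVec {n : ℕ} (u w : Fin n → ℂ) :
    ((‖inner ℂ (cohVec u) (cohVec w)‖ ^ 2 : ℝ) : ℂ) =
      Complex.exp (-(∑ i, (‖w i‖ : ℂ) ^ 2)) *
      Complex.exp (∑ i, conj (w i) * u i + ∑ i, w i * conj (u i) - ∑ i, (‖u i‖ : ℂ) ^ 2) := by
  have h : ((‖inner ℂ (cohVec u) (cohVec w)‖ ^ 2 : ℝ) : ℂ) =
      inner ℂ (cohVec w) (cohVec u) * inner ℂ (cohVec u) (cohVec w) := by
    rw [← inner_conj_symm (cohVec w), Complex.conj_mul']; push_cast; rfl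
  rw [h]
  simp only [cohVec, inner_smul_left, inner_smul_right, inner_expVec_expVec, Complex.conj_ofReal]
  simp only [Complex.ofReal_exp, ← Complex.exp_add]
  congr 1
  push_cast
  rw [Finset.sum_congr rfl fun i _ => mul_comm (w i) (conj (u i))]
  ring

/-- Gaussian integrals against the Husimi function of a coherent state. -/
lemma integral_norm_sq_inner_cohVec_mul_exp {n : ℕ} (w a b : Fin n → ℂ) :
    Integrable (fun u => ((‖inner ℂ (cohVec u) (cohVec w)‖ ^ 2 : ℝ) : ℂ) *
        Complex.exp (∑ i, a i * u i + ∑ i, b i * conj (u i))) (phaseMeasure n) ∧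
      ∫ u, ((‖inner ℂ (cohVec u) (cohVec w)‖ ^ 2 : ℝ) : ℂ) *
        Complex.exp (∑ i, a i * u i + ∑ i, b i * conj (u i)) ∂phaseMeasure n =
        Complex.exp (∑ i, a i * b i + ∑ i, a i * w i + ∑ i, b i * conj (w i)) := by
  have hg := gaussian_phase (fun i => conj (w i) + a i) (fun i => w i + b i)
  have h : ∀ u : Fin n → ℂ, ((‖inner ℂ (cohVec u) (cohVec w)‖ ^ 2 : ℝ) : ℂ) *
        Complex.exp (∑ i, a i * u i + ∑ i, b i * conj (u i)) =
      Complex.exp (-(∑ i, (‖w i‖ : ℂ) ^ 2)) * Complex.exp (∑ i, (conj (w i) + a i) * u i +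
        ∑ i, (w i + b i) * conj (u i) - ∑ i, (‖u i‖ : ℂ) ^ 2) := fun u => by
    rw [norm_sq_inner_cohVec, mul_assoc, ← Complex.exp_add]
    congr 2
    simp only [add_mul, Finset.sum_add_distrib]
    ring
  simp only [h]
  refine ⟨hg.1.const_mul _, ?_⟩
  rw [integral_const_mul, hg.2, ← Complex.exp_add]
  congr 1
  simp only [add_mul, mul_add, Finset.sum_add_distrib, Complex.conj_mul']
  rw [Finset.sum_congr rfl fun i _ => mul_comm (conj (w i)) (b i)]
  ring

/-- The mixture of coherent states with respect to a probability measure. -/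
lemma exists_mixture {n : ℕ} (P : Measure (Fin n → ℂ)) [IsProbabilityMeasure P] :
    ∃ τ : FockSpace n →L[ℂ] FockSpace n, ∀ φ ψ,
      inner ℂ φ (τ ψ) = ∫ w, inner ℂ φ (cohVec w) * inner ℂ (cohVec w) ψ ∂P := by
  have hm := (continuous_cohVec n).aestronglyMeasurable (μ := P)
  have hb := eLpNorm_inner_of_norm_le_one (ν := P) fun u : Fin n → ℂ => (norm_cohVec u).le
  obtain ⟨S, hS⟩ := exists_frameOperator hm hm hb hb
  exact ⟨S, fun φ ψ => (hS φ ψ).2⟩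

lemma husimi_mixture {n : ℕ} {P : Measure (Fin n → ℂ)} {τ : FockSpace n →L[ℂ] FockSpace n}
    (hτ : ∀ φ ψ, inner ℂ φ (τ ψ) = ∫ w, inner ℂ φ (cohVec w) * inner ℂ (cohVec w) ψ ∂P)
    (u : Fin n → ℂ) :
    inner ℂ (cohVec u) (τ (cohVec u)) = (husimi τ u : ℂ) ∧
      husimi τ u = ∫ w, ‖inner ℂ (cohVec u) (cohVec w)‖ ^ 2 ∂P := by
  have h : inner ℂ (cohVec u) (τ (cohVec u)) =
      ((∫ w, ‖inner ℂ (cohVec u) (cohVec w)‖ ^ 2 ∂P : ℝ) : ℂ) := by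
    rw [hτ, ← integral_complex_ofReal]
    congr 1; ext w
    rw [← inner_conj_symm (cohVec w), Complex.mul_conj']; push_cast; rfl
  constructor
  · rw [husimi, h, Complex.ofReal_re]
  · rw [husimi, h, Complex.ofReal_re]

lemma integrable_husimi_mixture_aux {n : ℕ} (P : Measure (Fin n → ℂ)) [IsProbabilityMeasure P]
    (z : Fin n → ℂ) :
    Integrable (fun p : (Fin n → ℂ) × (Fin n → ℂ) =>
      ((‖inner ℂ (cohVec p.1) (cohVec p.2)‖ ^ 2 : ℝ) : ℂ) *
        Complex.exp (Complex.I * phasePairing z p.1)) ((phaseMeasure n).prod P) := by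
  have hcoh := continuous_cohVec n
  have hpp := continuous_phasePairing z
  have hc : Continuous (fun p : (Fin n → ℂ) × (Fin n → ℂ) =>
      ((‖inner ℂ (cohVec p.1) (cohVec p.2)‖ ^ 2 : ℝ) : ℂ) *
        Complex.exp (Complex.I * phasePairing z p.1)) := by
    have h1 : Continuous fun p : (Fin n → ℂ) × (Fin n → ℂ) =>
        inner ℂ (cohVec p.1) (cohVec p.2) :=
      (hcoh.comp continuous_fst).inner (hcoh.comp continuous_snd)
    fun_prop
  have hn : ∀ u w : Fin n → ℂ, ‖((‖inner ℂ (cohVec u) (cohVec w)‖ ^ 2 : ℝ) : ℂ) *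
        Complex.exp (Complex.I * phasePairing z u)‖ = ‖inner ℂ (cohVec u) (cohVec w)‖ ^ 2 :=
    fun u w => by
      rw [norm_mul, mul_comm Complex.I, Complex.norm_exp_ofReal_mul_I, mul_one, Complex.norm_real,
        Real.norm_eq_abs, abs_of_nonneg (by positivity)]
  rw [integrable_prod_iff' hc.aestronglyMeasurable]
  refine ⟨Filter.Eventually.of_forall fun w => ?_, ?_⟩
  · refine ((integral_norm_inner_cohVec_sq (cohVec w)).1).mono'
      (hc.comp (continuous_id.prodMk continuous_const)).aestronglyMeasurable
      (Filter.Eventually.of_forall fun u => (hn u w).le)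
  · simp only [hn, (integral_norm_inner_cohVec_sq _).2, norm_cohVec]
    exact integrable_const _

/-- The Husimi function of a mixture is `P` smeared by the Gaussian `|⟨u|w⟩|²`, which multiplies the
Fourier transform by `exp (-|z|²)`. -/
lemma fourier_husimi_mixture {n : ℕ} {P : Measure (Fin n → ℂ)} [IsProbabilityMeasure P]
    {τ : FockSpace n →L[ℂ] FockSpace n}
    (hτ : ∀ φ ψ, inner ℂ φ (τ ψ) = ∫ w, inner ℂ φ (cohVec w) * inner ℂ (cohVec w) ψ ∂P)
    (z : Fin n → ℂ) :
    IsFiniteMeasure (husimiMeasure τ) ∧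
    ∫ u, Complex.exp (Complex.I * phasePairing z u) ∂husimiMeasure τ =
      Complex.exp (-∑ i, (‖z i‖ : ℂ) ^ 2) *
        ∫ w, Complex.exp (Complex.I * phasePairing z w) ∂P := by
  have hnn : ∀ u, 0 ≤ husimi τ u := fun u => by
    rw [(husimi_mixture hτ u).2]; exact integral_nonneg fun w => by positivity
  constructor
  · refine isFiniteMeasure_withDensity_ofReal ?_
    have h := (integrable_husimi_mixture_aux P 0).integral_prod_left
    have h0 : ∀ u : Fin n → ℂ, phasePairing 0 u = 0 := fun u => by simp [phasePairing]
    simp only [h0, Complex.ofReal_zero, mul_zero, Complex.exp_zero, mul_one,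
      integral_complex_ofReal, ← (husimi_mixture hτ _).2] at h
    exact (h.re.congr (Filter.Eventually.of_forall fun u => Complex.ofReal_re _)).2
  · rw [husimiMeasure, integral_withDensity_eq_integral_toReal_smul
      (continuous_husimi τ).measurable.ennreal_ofReal (Filter.Eventually.of_forall fun _ =>
        ENNReal.ofReal_lt_top)]
    have h1 : ∀ u, (ENNReal.ofReal (husimi τ u)).toReal •
        Complex.exp (Complex.I * phasePairing z u) =
          ∫ w, ((‖inner ℂ (cohVec u) (cohVec w)‖ ^ 2 : ℝ) : ℂ) *
            Complex.exp (Complex.I * phasePairing z u) ∂P := fun u => by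
      rw [ENNReal.toReal_ofReal (hnn u), Complex.real_smul, integral_mul_const,
        integral_complex_ofReal, (husimi_mixture hτ u).2]
    simp only [h1]
    rw [integral_integral_swap (integrable_husimi_mixture_aux P z), ← integral_const_mul]
    congr 1; ext w
    have h2 := (integral_norm_sq_inner_cohVec_mul_exp w (fun i => -conj (z i)) z).2
    have h3 : ∀ u : Fin n → ℂ, ∑ i, -conj (z i) * u i + ∑ i, z i * conj (u i) =
        Complex.I * phasePairing z u := fun u => by
      rw [I_mul_phasePairing]
      simp only [neg_mul, Finset.sum_neg_distrib]; ring
    simp only [h3] at h2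
    rw [h2, add_assoc, h3, ← Complex.exp_add]
    congr 2
    simp only [neg_mul, Complex.conj_mul', Finset.sum_neg_distrib]

/-- The Gaussian measure built from `V - 1` has exponent `-(weylVariance - |z|²)/2`; the smearing
adds `-|z|²`, giving exactly the exponent `-(weylVariance + |z|²)/2` of the Husimi measure of `ρ`,
with the same linear term. -/
lemma isClassical_of_posSemidef {n : ℕ} {ρ : FockSpace n →L[ℂ] FockSpace n}
    (h : IsGaussianState ρ) (hV : (covMatrix ρ - 1).PosSemidef) : IsClassical ρ := by
  obtain ⟨P, hP, hPf⟩ := exists_gaussian_measure _ hV (meanVec ρ)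
  obtain ⟨τ, hτ⟩ := exists_mixture P
  have := isProbabilityMeasure_husimiMeasure h.isState
  have := (fourier_husimi_mixture hτ 0).1
  have hmeas : husimiMeasure ρ = husimiMeasure τ := by
    refine Measure.ext_of_charFunDual (funext fun L => ?_)
    obtain ⟨z, hz⟩ := exists_phasePairing_eq L
    rw [charFunDual_apply, charFunDual_apply]
    simp only [hz, mul_comm _ Complex.I]
    rw [fourier_husimiMeasure h, (fourier_husimi_mixture hτ z).2, hPf, ← Complex.exp_add,
      ← weylVariance_sub, ← weylMean_eq, husimiVariance]
    congr 1
    push_cast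
    ring
  obtain ⟨B, hB, hρ, -⟩ := h.isState.exists_sqrt
  -- Equal measures have almost everywhere equal densities; continuity makes these equal everywhere,
  -- and coherent diagonal elements determine the operator.
  have hae := (withDensity_eq_iff_of_sigmaFinite
    (continuous_husimi ρ).measurable.ennreal_ofReal.aemeasurable
    (continuous_husimi τ).measurable.ennreal_ofReal.aemeasurable).1 hmeas
  have heq := ((ENNReal.continuous_ofReal.comp (continuous_husimi ρ)).ae_eq_iff_eq (phaseMeasure n)
    (ENNReal.continuous_ofReal.comp (continuous_husimi τ))).1 hae
  have hρτ : ρ = τ := by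
    refine ext_inner_cohVec_self fun u => ?_
    have h1 := congrFun heq u
    simp only [Function.comp_apply] at h1
    have h2 : 0 ≤ husimi ρ u := by rw [husimi_eq_norm_sq hB hρ]; positivity
    have h3 : 0 ≤ husimi τ u := by
      rw [(husimi_mixture hτ u).2]; exact integral_nonneg fun w => by positivity
    rw [ENNReal.ofReal_eq_ofReal_iff h2 h3] at h1
    rw [(husimi_mixture hτ u).1, ← h1, husimi_eq_norm_sq hB hρ, hρ, ← hB,
      inner_self_eq_norm_sq_to_K]
    push_cast; rfl
  refine ⟨P, hP, fun φ ψ => ?_⟩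
  simp only [coherent_eq_cohVec]
  rw [hρτ, hτ]

/-! ### Photon subtraction preserves classicality. -/

lemma inner_cohVec_aDag {n : ℕ} (c u : Fin n → ℂ) (φ : FiniteVectors n) :
    inner ℂ (cohVec u) (incl n (aDag c φ)) =
      (∑ i, c i * conj (u i)) * inner ℂ (cohVec u) (incl n φ) := by
  rw [cohVec, inner_smul_left, inner_smul_left, inner_expVec_aDag]
  ring

lemma isClassical_iff_mixture {n : ℕ} (ρ : FockSpace n →L[ℂ] FockSpace n) :
    IsClassical ρ ↔ ∃ P : Measure (Fin n → ℂ), IsProbabilityMeasure P ∧ ∀ φ ψ,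
      inner ℂ φ (ρ ψ) = ∫ w, inner ℂ φ (cohVec w) * inner ℂ (cohVec w) ψ ∂P := by
  simp only [IsClassical, coherent_eq_cohVec]

/-- Photon subtraction maps mixtures of coherent states to mixtures of coherent states. -/
lemma IsClassical.photonSubtracted {n : ℕ} {ρ σ : FockSpace n →L[ℂ] FockSpace n} {c : Fin n → ℂ}
    {N : ℝ} (hN : 0 < N) (htr : subtractedTrace c ρ = (N : ℂ)) (hσ : IsPhotonSubtracted c ρ σ)
    (hρ : IsClassical ρ) : IsClassical σ := by
  rw [isClassical_iff_mixture] at hρ ⊢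
  obtain ⟨P, hP, hρ⟩ := hρ
  have hcoh := continuous_cohVec n
  set g : (Fin n → ℂ) → ℂ := fun u => ∑ i, c i * conj (u i) with hg
  have hgc : Continuous g := by
    have := Complex.continuous_conj
    fun_prop
  have hdc : Continuous fun u => N⁻¹ * ‖g u‖ ^ 2 := by fun_prop
  have hd0 : ∀ u, 0 ≤ N⁻¹ * ‖g u‖ ^ 2 := fun u => by positivity
  have hel : ∀ k l : Fin n → ℕ, inner ℂ (fock k) (σ (fock l)) =
      ∫ w, ((N⁻¹ * ‖g w‖ ^ 2 : ℝ) : ℂ) *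
        (inner ℂ (fock k) (cohVec w) * inner ℂ (cohVec w) (fock l)) ∂P := fun k l => by
    have h1 := hσ.matrix_elements (basisVec k) (basisVec l)
    rw [incl_basisVec, incl_basisVec, htr, subtractedForm, hρ, ← integral_const_mul] at h1
    rw [h1]
    congr 1; ext w
    rw [← inner_conj_symm (incl n _) (cohVec w), inner_cohVec_aDag, inner_cohVec_aDag, map_mul,
      inner_conj_symm, incl_basisVec, incl_basisVec]
    have h2 : conj (g w) * g w = (‖g w‖ : ℂ) ^ 2 := Complex.conj_mul' _
    push_cast
    rw [← h2, hg]
    ring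
  -- The weight is the squared modulus of the eigenvalue of `a(c)` on the coherent state, normalized
  -- by the subtraction probability.
  set P' := P.withDensity fun u => ENNReal.ofReal (N⁻¹ * ‖g u‖ ^ 2) with hP'
  have hint : ∀ f : (Fin n → ℂ) → ℂ, ∫ w, f w ∂P' = ∫ w, ((N⁻¹ * ‖g w‖ ^ 2 : ℝ) : ℂ) * f w ∂P :=
    fun f => by
      rw [hP', integral_withDensity_eq_integral_toReal_smul hdc.measurable.ennreal_ofReal
        (Filter.Eventually.of_forall fun _ => ENNReal.ofReal_lt_top)]
      congr 1; ext w
      rw [ENNReal.toReal_ofReal (hd0 w), Complex.real_smul]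
  have hdiag : ∀ k : Fin n → ℕ, ∫⁻ w, ENNReal.ofReal (N⁻¹ * ‖g w‖ ^ 2 *
      ‖inner ℂ (cohVec w) (fock k)‖ ^ 2) ∂P =
        ENNReal.ofReal (inner ℂ (fock k) (σ (fock k))).re := fun k => by
    have h1 : ∀ w, N⁻¹ * ‖g w‖ ^ 2 * ‖inner ℂ (cohVec w) (fock k)‖ ^ 2 =
        N⁻¹ * ‖inner ℂ (cohVec w) (incl n (aDag c (basisVec k)))‖ ^ 2 := fun w => by
      rw [inner_cohVec_aDag, norm_mul, mul_pow, mul_assoc, incl_basisVec]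
    have hc : Continuous fun w : Fin n → ℂ => N⁻¹ * ‖g w‖ ^ 2 *
        ‖inner ℂ (cohVec w) (fock k)‖ ^ 2 :=
      hdc.mul ((hcoh.inner continuous_const).norm.pow 2)
    have hi : Integrable (fun w : Fin n → ℂ => N⁻¹ * ‖g w‖ ^ 2 *
        ‖inner ℂ (cohVec w) (fock k)‖ ^ 2) P := by
      refine Integrable.of_bound hc.aestronglyMeasurable
        (N⁻¹ * ‖incl n (aDag c (basisVec k))‖ ^ 2) (Filter.Eventually.of_forall fun w => ?_)
      rw [h1, Real.norm_eq_abs, abs_of_nonneg (by positivity)]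
      refine mul_le_mul_of_nonneg_left (pow_le_pow_left₀ (norm_nonneg _) ?_ 2) (by positivity)
      refine (norm_inner_le_norm _ _).trans ?_
      rw [norm_cohVec, one_mul]
    rw [← ofReal_integral_eq_lintegral_ofReal hi (Filter.Eventually.of_forall fun w =>
      mul_nonneg (hd0 w) (by positivity)), hel]
    congr 1
    rw [← Complex.ofReal_re (∫ w, _ ∂P), ← integral_complex_ofReal]
    congr 2; ext w
    rw [← inner_conj_symm (fock k) (cohVec w), Complex.conj_mul']
    push_cast; rfl
  -- Integrability of the weight is not known beforehand. Splitting it with `∑ k, |⟨w, k⟩|² = 1`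
  -- expresses its integral as the sum of the diagonal elements of `σ`, which is one.
  have hprob : IsProbabilityMeasure P' := by
    constructor
    rw [hP', withDensity_apply _ MeasurableSet.univ, Measure.restrict_univ]
    have h1 : ∀ w, ENNReal.ofReal (N⁻¹ * ‖g w‖ ^ 2) = ∑' k : Fin n → ℕ,
        ENNReal.ofReal (N⁻¹ * ‖g w‖ ^ 2 * ‖inner ℂ (cohVec w) (fock k)‖ ^ 2) := fun w => by
      have hs := (hasSum_norm_sq (cohVec w)).mul_left (N⁻¹ * ‖g w‖ ^ 2)
      rw [norm_cohVec, one_pow, mul_one] at hs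
      simp only [norm_inner_symm (fock _)] at hs
      rw [← ENNReal.ofReal_tsum_of_nonneg (fun k => mul_nonneg (hd0 w) (by positivity))
        hs.summable, hs.tsum_eq]
    simp only [h1]
    rw [lintegral_tsum]
    · simp only [hdiag]
      have h2 := Complex.hasSum_re hσ.isState.trace_eq_one
      have h3 : ∀ k : Fin n → ℕ, 0 ≤ (inner ℂ (fock k) (σ (fock k))).re := fun k =>
        hσ.isState.isPositive.re_inner_nonneg_right (fock k)
      rw [← ENNReal.ofReal_tsum_of_nonneg h3 h2.summable, h2.tsum_eq, Complex.one_re,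
        ENNReal.ofReal_one]
    · intro k
      have hc : Continuous fun w : Fin n → ℂ => N⁻¹ * ‖g w‖ ^ 2 *
          ‖inner ℂ (cohVec w) (fock k)‖ ^ 2 :=
        hdc.mul ((hcoh.inner continuous_const).norm.pow 2)
      exact hc.measurable.ennreal_ofReal.aemeasurable
  obtain ⟨τ, hτ⟩ := exists_mixture P'
  have hστ : σ = τ := ext_fock fun k l => by rw [hel, hτ, hint]
  exact ⟨P', hprob, fun φ ψ => by rw [hστ, hτ]⟩

/-! ### Cauchy estimates and the Laplace transform of the subtracted state. -/

/-- The normalized measure on angles. -/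
def angleMeasure : Measure ℝ :=
  ENNReal.ofReal (2 * Real.pi)⁻¹ • volume.restrict (Set.Ioc 0 (2 * Real.pi))

instance : IsProbabilityMeasure angleMeasure := ⟨by
  simp only [angleMeasure, Measure.smul_apply, Measure.restrict_apply MeasurableSet.univ,
    Set.univ_inter, Real.volume_Ioc, sub_zero, smul_eq_mul]
  rw [← ENNReal.ofReal_mul (by positivity), inv_mul_cancel₀ (by positivity), ENNReal.ofReal_one]⟩

lemma integral_angleMeasure (f : ℝ → ℝ) :
    ∫ θ, f θ ∂angleMeasure = (2 * Real.pi)⁻¹ * ∫ θ in (0 : ℝ)..2 * Real.pi, f θ := by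
  rw [angleMeasure, integral_smul_measure, intervalIntegral.integral_of_le (by positivity),
    ENNReal.toReal_ofReal (by positivity), smul_eq_mul]

lemma integrable_angleMeasure {f : ℝ → ℝ} (hf : Continuous f) : Integrable f angleMeasure :=
  ((hf.integrableOn_Icc (a := 0) (b := 2 * Real.pi)).mono_set
    Set.Ioc_subset_Icc_self).smul_measure ENNReal.ofReal_ne_top

/-- A mean value form of Cauchy's estimate. -/
lemma norm_deriv_sq_le {E : Type*} [NormedAddCommGroup E] [NormedSpace ℂ E] [CompleteSpace E]
    {f : ℂ → E} (hf : Differentiable ℂ f) :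
    ‖deriv f 0‖ ^ 2 ≤ ∫ θ, ‖f (circleMap 0 1 θ)‖ ^ 2 ∂angleMeasure := by
  have hc : Continuous fun θ : ℝ => ‖f (circleMap 0 1 θ)‖ :=
    (hf.continuous.comp (continuous_circleMap 0 1)).norm
  have h1 : ‖deriv f 0‖ ≤ ∫ θ, ‖f (circleMap 0 1 θ)‖ ∂angleMeasure := by
    have h2 := hf.differentiableOn (s := Metric.closedBall 0 1)
      |>.deriv_eq_smul_circleIntegral one_pos
    have h3 : ‖(2 * Real.pi * Complex.I : ℂ) • deriv f 0‖ = 2 * Real.pi * ‖deriv f 0‖ := by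
      rw [norm_smul]; simp [abs_of_pos Real.pi_pos]
    have h4 : ‖∮ z in C(0, 1), (1 / (z - 0) ^ 2) • f z‖ ≤
        ∫ θ in (0 : ℝ)..2 * Real.pi, ‖f (circleMap 0 1 θ)‖ := by
      refine (intervalIntegral.norm_integral_le_integral_norm (by positivity)).trans (le_of_eq ?_)
      refine intervalIntegral.integral_congr fun θ _ => ?_
      simp [norm_smul]
    rw [h2, h3] at h4
    rw [integral_angleMeasure, ← div_eq_inv_mul, le_div_iff₀ (by positivity)]
    linarith
  -- Integrating `xy ≤ x²/2 + y²/2` with `x = ‖deriv f 0‖` turns the first-power Cauchy estimate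
  -- into one for squares.
  have h2 : ∫ θ, ‖deriv f 0‖ * ‖f (circleMap 0 1 θ)‖ ∂angleMeasure ≤
      ∫ θ, (1 / 2 * ‖deriv f 0‖ ^ 2 + 1 / 2 * ‖f (circleMap 0 1 θ)‖ ^ 2) ∂angleMeasure := by
    refine integral_mono (integrable_angleMeasure (by fun_prop))
      (integrable_angleMeasure (by fun_prop)) fun θ => ?_
    nlinarith [sq_nonneg (‖deriv f 0‖ - ‖f (circleMap 0 1 θ)‖)]
  rw [integral_const_mul, integral_add (integrable_const _)
    (integrable_angleMeasure (by fun_prop)), integral_const_mul, integral_const] at h2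
  rw [integral_const_mul] at h2
  simp only [probReal_univ, one_smul] at h2
  nlinarith [mul_le_mul_of_nonneg_left h1 (norm_nonneg (deriv f 0))]

lemma normSq_expVec_mul_husimi {n : ℕ} {ρ B : FockSpace n →L[ℂ] FockSpace n}
    (hB : ∀ φ ψ, inner ℂ (B φ) ψ = inner ℂ φ (B ψ)) (hρ : ∀ φ, ρ φ = B (B φ)) (u : Fin n → ℂ) :
    ‖B (expVec u)‖ ^ 2 = Real.exp (∑ i, ‖u i‖ ^ 2) * husimi ρ u := by
  rw [husimi_eq_norm_sq hB hρ, cohVec, map_smul, norm_smul, mul_pow, Complex.norm_real,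
    Real.norm_eq_abs, sq_abs, ← mul_assoc, ← Real.exp_nat_mul, ← Real.exp_add]
  have : ∑ i, ‖u i‖ ^ 2 + ((2 : ℕ) : ℝ) * (-(∑ i, ‖u i‖ ^ 2) / 2) = 0 := by push_cast; ring
  rw [this, Real.exp_zero, one_mul]

/-- The Husimi function of a photon-subtracted state. -/
lemma husimi_photonSubtracted {n : ℕ} {ρ B σ : FockSpace n →L[ℂ] FockSpace n} {c : Fin n → ℂ}
    (hB : ∀ φ ψ, inner ℂ (B φ) ψ = inner ℂ φ (B ψ)) (hρ : ∀ φ, ρ φ = B (B φ))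
    {N : ℝ} (hN : 0 < N) (htr : subtractedTrace c ρ = (N : ℂ)) (hσ : IsPhotonSubtracted c ρ σ)
    (u : Fin n → ℂ) :
    N * husimi σ u = Real.exp (-∑ i, ‖u i‖ ^ 2) * ‖B (expVecDeriv u c)‖ ^ 2 := by
  -- The matrix elements of `σ` are prescribed only on finite vectors, so the exponential vector is
  -- approached through its partial expansions.
  set φ : Finset (Fin n → ℕ) → FiniteVectors n := fun s => ∑ k ∈ s, mono k u • basisVec k
  have h1 : Filter.Tendsto (fun s => incl n (φ s)) Filter.atTop (nhds (expVec u)) := by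
    have h := hasSum_mono_smul_fock u
    refine (congrArg (fun f => Filter.Tendsto f _ _) (funext fun s => ?_)).mp h
    simp only [φ, map_sum, map_smul, incl_basisVec]
  have h2 : Filter.Tendsto (fun s => incl n (aDag c (φ s))) Filter.atTop
      (nhds (expVecDeriv u c)) := by
    have h := hasSum_mono_smul_aDag c u
    refine (congrArg (fun f => Filter.Tendsto f _ _) (funext fun s => ?_)).mp h
    simp only [φ, map_sum, map_smul]
  have h3 : ∀ s, (N : ℂ) * inner ℂ (incl n (φ s)) (σ (incl n (φ s))) =
      ((‖B (incl n (aDag c (φ s)))‖ ^ 2 : ℝ) : ℂ) := fun s => by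
    rw [hσ.matrix_elements, htr, subtractedForm_eq hB hρ, inner_self_eq_norm_sq_to_K, ← mul_assoc,
      mul_inv_cancel₀ (by exact_mod_cast hN.ne'), one_mul]
    push_cast; rfl
  have h4 : Filter.Tendsto (fun s => (N : ℂ) * inner ℂ (incl n (φ s)) (σ (incl n (φ s))))
      Filter.atTop (nhds ((N : ℂ) * inner ℂ (expVec u) (σ (expVec u)))) :=
    (h1.inner ((σ.continuous.tendsto _).comp h1)).const_mul _
  have h5 : Filter.Tendsto (fun s => ((‖B (incl n (aDag c (φ s)))‖ ^ 2 : ℝ) : ℂ)) Filter.atTop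
      (nhds ((‖B (expVecDeriv u c)‖ ^ 2 : ℝ) : ℂ)) :=
    (Complex.continuous_ofReal.tendsto _).comp ((((B.continuous.tendsto _).comp h2).norm).pow 2)
  simp only [h3] at h4
  have h6 := tendsto_nhds_unique h4 h5
  have h7 : (inner ℂ (cohVec u) (σ (cohVec u)) : ℂ) =
      ((Real.exp (-∑ i, ‖u i‖ ^ 2) : ℝ) : ℂ) * inner ℂ (expVec u) (σ (expVec u)) := by
    rw [cohVec, map_smul, inner_smul_left, inner_smul_right, Complex.conj_ofReal, ← mul_assoc,
      ← Complex.ofReal_mul, ← Real.exp_add]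
    congr 3; ring
  have h8 : (N : ℂ) * inner ℂ (cohVec u) (σ (cohVec u)) =
      ((Real.exp (-∑ i, ‖u i‖ ^ 2) * ‖B (expVecDeriv u c)‖ ^ 2 : ℝ) : ℂ) := by
    rw [h7, mul_left_comm, h6]; push_cast; rfl
  have h9 := congrArg Complex.re h8
  rw [Complex.re_ofReal_mul, Complex.ofReal_re] at h9
  exact h9

/-- Cauchy's estimate on the unit circle for the entire function `s ↦ B (expVec (u + s • c))`
replaces the derivative by translates, so that only the Husimi function of `ρ` itself remains. -/
lemma husimi_photonSubtracted_le {n : ℕ} {ρ B σ : FockSpace n →L[ℂ] FockSpace n} {c : Fin n → ℂ}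
    (hB : ∀ φ ψ, inner ℂ (B φ) ψ = inner ℂ φ (B ψ)) (hρ : ∀ φ, ρ φ = B (B φ))
    {N : ℝ} (hN : 0 < N) (htr : subtractedTrace c ρ = (N : ℂ)) (hσ : IsPhotonSubtracted c ρ σ)
    (u : Fin n → ℂ) :
    ENNReal.ofReal (N * husimi σ u) ≤ ∫⁻ θ, ENNReal.ofReal
      (Real.exp (∑ i, ‖(u + circleMap 0 1 θ • c) i‖ ^ 2 - ∑ i, ‖u i‖ ^ 2) *
        husimi ρ (u + circleMap 0 1 θ • c)) ∂angleMeasure := by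
  have hd : Differentiable ℂ fun s : ℂ => B (expVec (u + s • c)) :=
    B.differentiable.comp (differentiable_expVec u c)
  have hderiv : deriv (fun s : ℂ => B (expVec (u + s • c))) 0 = B (expVecDeriv u c) :=
    (B.hasFDerivAt.comp_hasDerivAt (0 : ℂ) ((differentiable_expVec u c) 0).hasDerivAt).deriv
  have h1 := norm_deriv_sq_le hd
  rw [hderiv] at h1
  have hc : Continuous fun θ : ℝ => ‖B (expVec (u + circleMap 0 1 θ • c))‖ ^ 2 :=
    ((hd.continuous.comp (continuous_circleMap 0 1)).norm).pow 2
  rw [husimi_photonSubtracted hB hρ hN htr hσ]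
  have h2 : Real.exp (-∑ i, ‖u i‖ ^ 2) * ‖B (expVecDeriv u c)‖ ^ 2 ≤
      ∫ θ, Real.exp (-∑ i, ‖u i‖ ^ 2) * ‖B (expVec (u + circleMap 0 1 θ • c))‖ ^ 2
        ∂angleMeasure := by
    rw [integral_const_mul]
    exact mul_le_mul_of_nonneg_left h1 (Real.exp_pos _).le
  refine (ENNReal.ofReal_le_ofReal h2).trans (le_of_eq ?_)
  rw [ofReal_integral_eq_lintegral_ofReal (integrable_angleMeasure (hc.const_mul _))
    (Filter.Eventually.of_forall fun θ => by positivity)]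
  refine lintegral_congr fun θ => ?_
  rw [normSq_expVec_mul_husimi hB hρ, ← mul_assoc, ← Real.exp_add]
  congr 3; ring

/-- The quadratic terms in `v` cancel, so the weight created by a translation is the exponential of
an affine function. The factor `i` converts the real part `2 Re ⟨v, w⟩` into `phasePairing`. -/
lemma sum_norm_sq_sub {n : ℕ} (v w : Fin n → ℂ) :
    ∑ i, ‖v i‖ ^ 2 - ∑ i, ‖(v - w) i‖ ^ 2 =
      phasePairing (Complex.I • w) v - ∑ i, ‖w i‖ ^ 2 := by
  rw [phasePairing, Finset.mul_sum, ← Finset.sum_sub_distrib, ← Finset.sum_sub_distrib]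
  refine Finset.sum_congr rfl fun i _ => ?_
  simp only [Complex.sq_norm, Complex.normSq_apply, Pi.sub_apply, Pi.smul_apply, smul_eq_mul]
  simp
  ring

/-- Laplace transform of the Husimi function of a photon-subtracted Gaussian state. -/
lemma lintegral_exp_phasePairing_photonSubtracted_le {n : ℕ}
    {ρ B σ : FockSpace n →L[ℂ] FockSpace n} {c : Fin n → ℂ} (h : IsGaussianState ρ)
    (hB : ∀ φ ψ, inner ℂ (B φ) ψ = inner ℂ φ (B ψ)) (hρ : ∀ φ, ρ φ = B (B φ))
    {N : ℝ} (hN : 0 < N) (htr : subtractedTrace c ρ = (N : ℂ)) (hσ : IsPhotonSubtracted c ρ σ)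
    (z : Fin n → ℂ) :
    ∫⁻ u, ENNReal.ofReal (N * husimi σ u) * ENNReal.ofReal (Real.exp (phasePairing z u))
        ∂phaseMeasure n ≤
      ∫⁻ θ, ENNReal.ofReal (Real.exp (-∑ i, ‖(circleMap 0 1 θ • c) i‖ ^ 2
        - phasePairing z (circleMap 0 1 θ • c)
        - weylMean ρ (z + Complex.I • circleMap 0 1 θ • c)
        + husimiVariance ρ (z + Complex.I • circleMap 0 1 θ • c) / 2)) ∂angleMeasure := by
  have hpp := continuous_phasePairing z
  have hhus := continuous_husimi ρ
  have hhn : ∀ u, 0 ≤ husimi ρ u := fun u => by rw [husimi_eq_norm_sq hB hρ]; positivity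
  have hcm : Continuous fun p : (Fin n → ℂ) × ℝ => p.1 + circleMap 0 1 p.2 • c :=
    continuous_fst.add (((continuous_circleMap 0 1).comp continuous_snd).smul continuous_const)
  calc ∫⁻ u, ENNReal.ofReal (N * husimi σ u) * ENNReal.ofReal (Real.exp (phasePairing z u))
        ∂phaseMeasure n
      ≤ ∫⁻ u, ∫⁻ θ, ENNReal.ofReal
          (Real.exp (∑ i, ‖(u + circleMap 0 1 θ • c) i‖ ^ 2 - ∑ i, ‖u i‖ ^ 2) *
            husimi ρ (u + circleMap 0 1 θ • c) * Real.exp (phasePairing z u)) ∂angleMeasure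
          ∂phaseMeasure n := by
        refine lintegral_mono fun u => ?_
        have hm : Continuous fun θ : ℝ =>
            Real.exp (∑ i, ‖(u + circleMap 0 1 θ • c) i‖ ^ 2 - ∑ i, ‖u i‖ ^ 2) *
              husimi ρ (u + circleMap 0 1 θ • c) := by
          have h1 : Continuous fun θ : ℝ => u + circleMap 0 1 θ • c :=
            hcm.comp (Continuous.prodMk continuous_const continuous_id)
          have h2 : ∀ i, Continuous fun θ : ℝ => (u + circleMap 0 1 θ • c) i := fun i =>
            (continuous_apply i).comp h1
          exact (Real.continuous_exp.comp ((continuous_finsetSum _ fun i _ =>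
            (h2 i).norm.pow 2).sub continuous_const)).mul (hhus.comp h1)
        have hpull : ∀ θ : ℝ, ENNReal.ofReal
            (Real.exp (∑ i, ‖(u + circleMap 0 1 θ • c) i‖ ^ 2 - ∑ i, ‖u i‖ ^ 2) *
              husimi ρ (u + circleMap 0 1 θ • c) * Real.exp (phasePairing z u)) =
            ENNReal.ofReal
            (Real.exp (∑ i, ‖(u + circleMap 0 1 θ • c) i‖ ^ 2 - ∑ i, ‖u i‖ ^ 2) *
              husimi ρ (u + circleMap 0 1 θ • c)) *
              ENNReal.ofReal (Real.exp (phasePairing z u)) := fun θ =>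
          ENNReal.ofReal_mul (mul_nonneg (Real.exp_pos _).le (hhn _))
        simp only [hpull]
        rw [lintegral_mul_const _ hm.measurable.ennreal_ofReal]
        exact mul_le_mul_left (husimi_photonSubtracted_le hB hρ hN htr hσ u) _
    _ = ∫⁻ θ, ∫⁻ u, ENNReal.ofReal
          (Real.exp (∑ i, ‖(u + circleMap 0 1 θ • c) i‖ ^ 2 - ∑ i, ‖u i‖ ^ 2) *
            husimi ρ (u + circleMap 0 1 θ • c) * Real.exp (phasePairing z u)) ∂phaseMeasure n
          ∂angleMeasure := by
        refine lintegral_lintegral_swap ?_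
        have h2 : ∀ i, Continuous fun p : (Fin n → ℂ) × ℝ => (p.1 + circleMap 0 1 p.2 • c) i :=
          fun i => (continuous_apply i).comp hcm
        have h3 : ∀ i, Continuous fun p : (Fin n → ℂ) × ℝ => p.1 i := fun i =>
          (continuous_apply i).comp continuous_fst
        have hm : Continuous fun p : (Fin n → ℂ) × ℝ =>
            Real.exp (∑ i, ‖(p.1 + circleMap 0 1 p.2 • c) i‖ ^ 2 - ∑ i, ‖p.1 i‖ ^ 2) *
              husimi ρ (p.1 + circleMap 0 1 p.2 • c) * Real.exp (phasePairing z p.1) :=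
          ((Real.continuous_exp.comp ((continuous_finsetSum _ fun i _ =>
            (h2 i).norm.pow 2).sub (continuous_finsetSum _ fun i _ => (h3 i).norm.pow 2))).mul
              (hhus.comp hcm)).mul (Real.continuous_exp.comp (hpp.comp continuous_fst))
        exact hm.measurable.ennreal_ofReal.aemeasurable
    _ = _ := by
        refine lintegral_congr fun θ => ?_
        set w := circleMap 0 1 θ • c
        -- Translation by `w` centres the Husimi function of `ρ`; the leftover weight merely shifts
        -- the Laplace variable from `z` to `z + i w`.
        have h1 := lintegral_add_right_eq_self (μ := phaseMeasure n) (fun v => ENNReal.ofReal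
          (Real.exp (∑ i, ‖v i‖ ^ 2 - ∑ i, ‖(v - w) i‖ ^ 2) *
            husimi ρ v * Real.exp (phasePairing z (v - w)))) w
        simp only [add_sub_cancel_right] at h1
        rw [h1]
        have h2 : ∀ v, ENNReal.ofReal
          (Real.exp (∑ i, ‖v i‖ ^ 2 - ∑ i, ‖(v - w) i‖ ^ 2) *
            husimi ρ v * Real.exp (phasePairing z (v - w))) =
            ENNReal.ofReal (husimi ρ v) *
              ENNReal.ofReal (Real.exp (phasePairing (z + Complex.I • w) v)) *
              ENNReal.ofReal (Real.exp (-∑ i, ‖w i‖ ^ 2 - phasePairing z w)) := fun v => by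
          rw [← ENNReal.ofReal_mul (hhn v), ← ENNReal.ofReal_mul
            (mul_nonneg (hhn v) (Real.exp_pos _).le), sum_norm_sq_sub, phasePairing_add]
          congr 1
          have h3 : phasePairing z (v - w) = phasePairing z v - phasePairing z w := by
            have := phasePairing_add_right z (v - w) w
            rw [sub_add_cancel] at this; linarith
          rw [h3, mul_assoc, mul_assoc, ← Real.exp_add, mul_left_comm, ← Real.exp_add]
          congr 2; ring
        have hm1 : Measurable fun v => ENNReal.ofReal (husimi ρ v) :=
          hhus.measurable.ennreal_ofReal
        have hm2 : Measurable fun v =>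
            ENNReal.ofReal (Real.exp (phasePairing (z + Complex.I • w) v)) :=
          (Real.continuous_exp.comp (continuous_phasePairing _)).measurable.ennreal_ofReal
        have hm12 : Measurable fun v => ENNReal.ofReal (husimi ρ v) *
            ENNReal.ofReal (Real.exp (phasePairing (z + Complex.I • w) v)) := hm1.mul hm2
        simp only [h2]
        rw [lintegral_mul_const _ hm12]
        have h4 := lintegral_exp_phasePairing h (z + Complex.I • w)
        rw [husimiMeasure, lintegral_withDensity_eq_lintegral_mul _ hm1 hm2] at h4
        simp only [Pi.mul_apply] at h4
        rw [h4, ← ENNReal.ofReal_mul (Real.exp_pos _).le, ← Real.exp_add]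
        congr 2; ring

/-! ### Laplace transforms of mixtures and comparison of growth rates. -/

/-- Laplace transform of the Husimi function of a coherent state. -/
lemma lintegral_exp_phasePairing_cohVec {n : ℕ} (z w : Fin n → ℂ) :
    ∫⁻ u, ENNReal.ofReal (‖(inner ℂ (cohVec u) (cohVec w) : ℂ)‖ ^ 2) *
        ENNReal.ofReal (Real.exp (phasePairing z u)) ∂phaseMeasure n =
      ENNReal.ofReal (Real.exp (∑ i, ‖z i‖ ^ 2 + phasePairing z w)) := by
  have hpp : ∀ u : Fin n → ℂ, ∑ i, Complex.I * conj (z i) * u i +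
      ∑ i, -Complex.I * z i * conj (u i) = (phasePairing z u : ℂ) := fun u => by
    have h1 := I_mul_phasePairing z u
    have h2 : (phasePairing z u : ℂ) = -Complex.I * (Complex.I * phasePairing z u) := by
      rw [← mul_assoc, neg_mul, Complex.I_mul_I, neg_neg, one_mul]
    rw [h2, h1, mul_sub, Finset.mul_sum, Finset.mul_sum]
    simp only [neg_mul, mul_assoc, Finset.sum_neg_distrib]
    ring
  have hzz : ∑ i, Complex.I * conj (z i) * (-Complex.I * z i) = ((∑ i, ‖z i‖ ^ 2 : ℝ) : ℂ) := by
    push_cast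
    refine Finset.sum_congr rfl fun i _ => ?_
    rw [← Complex.conj_mul']
    linear_combination (-(conj (z i) * z i)) * Complex.I_mul_I
  -- These coefficients make the complex exponent equal to the real pairing, and their product
  -- contributes `|z|²`.
  obtain ⟨h1, h2⟩ := integral_norm_sq_inner_cohVec_mul_exp w (fun i => Complex.I * conj (z i))
    (fun i => -Complex.I * z i)
  simp only [hpp, hzz, add_assoc] at h1 h2
  have h3 : ∀ u : Fin n → ℂ, ((‖(inner ℂ (cohVec u) (cohVec w) : ℂ)‖ ^ 2 : ℝ) : ℂ) *
      Complex.exp (phasePairing z u) =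
        ((‖(inner ℂ (cohVec u) (cohVec w) : ℂ)‖ ^ 2 * Real.exp (phasePairing z u) : ℝ) : ℂ) :=
    fun u => by push_cast; rfl
  simp only [h3] at h1 h2
  rw [integral_complex_ofReal, ← Complex.ofReal_add, ← Complex.ofReal_exp,
    Complex.ofReal_inj] at h2
  have h4 := h1.re
  simp only [RCLike.re_eq_complex_re, Complex.ofReal_re] at h4
  rw [← h2, ofReal_integral_eq_lintegral_ofReal h4
    (Filter.Eventually.of_forall fun u => by positivity)]
  exact lintegral_congr fun u => (ENNReal.ofReal_mul (by positivity)).symm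

/-- Laplace transform of the Husimi function of a mixture of coherent states. -/
lemma lintegral_exp_phasePairing_mixture {n : ℕ} {P : Measure (Fin n → ℂ)}
    [IsProbabilityMeasure P] {σ : FockSpace n →L[ℂ] FockSpace n}
    (hσ : ∀ φ ψ, inner ℂ φ (σ ψ) = ∫ w, inner ℂ φ (cohVec w) * inner ℂ (cohVec w) ψ ∂P)
    (z : Fin n → ℂ) :
    ∫⁻ u, ENNReal.ofReal (husimi σ u) * ENNReal.ofReal (Real.exp (phasePairing z u))
        ∂phaseMeasure n =
      ∫⁻ w, ENNReal.ofReal (Real.exp (∑ i, ‖z i‖ ^ 2 + phasePairing z w)) ∂P := by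
  have hcoh := continuous_cohVec n
  have hpp := continuous_phasePairing z
  have hc : Continuous fun p : (Fin n → ℂ) × (Fin n → ℂ) =>
      ‖(inner ℂ (cohVec p.1) (cohVec p.2) : ℂ)‖ ^ 2 :=
    (((hcoh.comp continuous_fst).inner (hcoh.comp continuous_snd)).norm).pow 2
  have h1 : ∀ u, ENNReal.ofReal (husimi σ u) =
      ∫⁻ w, ENNReal.ofReal (‖(inner ℂ (cohVec u) (cohVec w) : ℂ)‖ ^ 2) ∂P := fun u => by
    have hcu : Continuous fun w => ‖(inner ℂ (cohVec u) (cohVec w) : ℂ)‖ ^ 2 :=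
      ((continuous_const.inner hcoh).norm).pow 2
    rw [(husimi_mixture hσ u).2, ofReal_integral_eq_lintegral_ofReal _
      (Filter.Eventually.of_forall fun w => by positivity)]
    refine Integrable.of_bound hcu.aestronglyMeasurable 1 (Filter.Eventually.of_forall fun w => ?_)
    rw [Real.norm_of_nonneg (by positivity)]
    have := norm_inner_le_norm (𝕜 := ℂ) (cohVec u) (cohVec w)
    rw [norm_cohVec, norm_cohVec, one_mul] at this
    exact pow_le_one₀ (norm_nonneg _) this
  have h2 : ∀ u, ENNReal.ofReal (husimi σ u) * ENNReal.ofReal (Real.exp (phasePairing z u)) =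
      ∫⁻ w, ENNReal.ofReal (‖(inner ℂ (cohVec u) (cohVec w) : ℂ)‖ ^ 2) *
        ENNReal.ofReal (Real.exp (phasePairing z u)) ∂P := fun u => by
    have hcu : Continuous fun w => ‖(inner ℂ (cohVec u) (cohVec w) : ℂ)‖ ^ 2 :=
      ((continuous_const.inner hcoh).norm).pow 2
    rw [h1, lintegral_mul_const _ hcu.measurable.ennreal_ofReal]
  simp only [h2]
  rw [lintegral_lintegral_swap]
  · exact lintegral_congr fun w => lintegral_exp_phasePairing_cohVec z w
  · exact (hc.measurable.ennreal_ofReal.mul (Real.continuous_exp.comp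
      (hpp.comp continuous_fst)).measurable.ennreal_ofReal).aemeasurable

lemma rotVec_add {n : ℕ} (z w : Fin n → ℂ) : rotVec (z + w) = rotVec z + rotVec w := by
  rw [rotVec, toRealVec_add, Matrix.mulVec_add]; rfl

lemma rotVec_smul {n : ℕ} (t : ℝ) (z : Fin n → ℂ) : rotVec (t • z) = t • rotVec z := by
  rw [rotVec, toRealVec_smul, Matrix.mulVec_smul]; rfl

lemma continuous_rotVec {n : ℕ} : Continuous (rotVec (n := n)) := by
  refine continuous_pi fun i => ?_
  simp only [rotVec_apply]
  split_ifs
  · exact (Complex.continuous_im.comp (continuous_apply _)).neg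
  · exact Complex.continuous_re.comp (continuous_apply _)

lemma husimiVariance_eq {n : ℕ} (ρ : FockSpace n →L[ℂ] FockSpace n) (z : Fin n → ℂ) :
    husimiVariance ρ z = rotVec z ⬝ᵥ (covMatrix ρ + 1) *ᵥ rotVec z := by
  rw [husimiVariance, weylVariance_eq, sum_norm_sq_eq_rotVec, Matrix.add_mulVec, dotProduct_add,
    Matrix.one_mulVec]

lemma continuous_husimiVariance {n : ℕ} (ρ : FockSpace n →L[ℂ] FockSpace n) :
    Continuous (husimiVariance ρ) := by
  have h := continuous_rotVec (n := n)
  simp only [funext (husimiVariance_eq ρ)]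
  exact h.dotProduct (continuous_const.matrix_mulVec h)

lemma continuous_weylMean {n : ℕ} (ρ : FockSpace n →L[ℂ] FockSpace n) :
    Continuous (weylMean ρ) := by
  have h := continuous_rotVec (n := n)
  simp only [funext (weylMean_eq ρ)]
  exact (h.dotProduct continuous_const).const_mul _

lemma weylMean_add {n : ℕ} (ρ : FockSpace n →L[ℂ] FockSpace n) (z w : Fin n → ℂ) :
    weylMean ρ (z + w) = weylMean ρ z + weylMean ρ w := by
  simp only [weylMean_eq, rotVec_add, add_dotProduct, mul_add]

lemma husimiVariance_smul_add {n : ℕ} (ρ : FockSpace n →L[ℂ] FockSpace n) (t : ℝ)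
    (z w : Fin n → ℂ) :
    husimiVariance ρ (t • z + w) = t ^ 2 * husimiVariance ρ z +
      t * (husimiVariance ρ (z + w) - husimiVariance ρ z - husimiVariance ρ w) +
      husimiVariance ρ w := by
  simp only [husimiVariance_eq, rotVec_add, rotVec_smul, Matrix.mulVec_add, Matrix.mulVec_smul,
    dotProduct_add, add_dotProduct, dotProduct_smul, smul_dotProduct, smul_eq_mul]
  ring

/-- Growth of the bound for the Laplace transform of a photon-subtracted Gaussian state along a
ray. -/
lemma exists_lintegral_angle_le {n : ℕ} (ρ : FockSpace n →L[ℂ] FockSpace n) (c z : Fin n → ℂ) :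
    ∃ C : ℝ, ∀ t : ℝ, 0 ≤ t →
      ∫⁻ θ, ENNReal.ofReal (Real.exp (-∑ i, ‖(circleMap 0 1 θ • c) i‖ ^ 2
        - phasePairing (t • z) (circleMap 0 1 θ • c)
        - weylMean ρ (t • z + Complex.I • circleMap 0 1 θ • c)
        + husimiVariance ρ (t • z + Complex.I • circleMap 0 1 θ • c) / 2)) ∂angleMeasure ≤
      ENNReal.ofReal (Real.exp (t ^ 2 * husimiVariance ρ z / 2 + t * C + C)) := by
  have hq := continuous_husimiVariance ρ
  have hm := continuous_weylMean ρ
  have hpp := continuous_phasePairing z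
  -- As a polynomial in `t` the exponent is `t² husimiVariance / 2 + t A + D`. Only `A` and `D` see
  -- the point of the circle, and continuity bounds them on the unit disc, uniformly in the angle.
  set A : ℂ → ℝ := fun s => -phasePairing z (s • c) - weylMean ρ z +
    (husimiVariance ρ (z + Complex.I • s • c) - husimiVariance ρ z -
      husimiVariance ρ (Complex.I • s • c)) / 2 with hA
  set D : ℂ → ℝ := fun s => -∑ i, ‖(s • c) i‖ ^ 2 - weylMean ρ (Complex.I • s • c) +
    husimiVariance ρ (Complex.I • s • c) / 2 with hD
  have hAc : Continuous A := by fun_prop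
  have hDc : Continuous D := by
    simp only [hD, Pi.smul_apply]
    fun_prop
  obtain ⟨C₁, hC₁⟩ := (isCompact_closedBall (0 : ℂ) 1).exists_bound_of_continuousOn hAc.continuousOn
  obtain ⟨C₂, hC₂⟩ := (isCompact_closedBall (0 : ℂ) 1).exists_bound_of_continuousOn hDc.continuousOn
  refine ⟨max C₁ C₂, fun t ht => ?_⟩
  have hb : ∀ θ : ℝ, -∑ i, ‖(circleMap 0 1 θ • c) i‖ ^ 2
        - phasePairing (t • z) (circleMap 0 1 θ • c)
        - weylMean ρ (t • z + Complex.I • circleMap 0 1 θ • c)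
        + husimiVariance ρ (t • z + Complex.I • circleMap 0 1 θ • c) / 2 ≤
      t ^ 2 * husimiVariance ρ z / 2 + t * max C₁ C₂ + max C₁ C₂ := fun θ => by
    have hs : circleMap 0 1 θ ∈ Metric.closedBall (0 : ℂ) 1 :=
      circleMap_mem_closedBall 0 zero_le_one θ
    generalize circleMap 0 1 θ = s at hs ⊢
    have h1 : A s ≤ max C₁ C₂ :=
      ((Real.le_norm_self _).trans (hC₁ s hs)).trans (le_max_left _ _)
    have h2 : D s ≤ max C₁ C₂ :=
      ((Real.le_norm_self _).trans (hC₂ s hs)).trans (le_max_right _ _)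
    have h3 := mul_le_mul_of_nonneg_left h1 ht
    rw [husimiVariance_smul_add, weylMean_add, weylMean_smul, phasePairing_smul]
    simp only [hA, hD] at h2 h3
    linarith
  refine (lintegral_mono fun θ =>
    ENNReal.ofReal_le_ofReal (Real.exp_le_exp.mpr (hb θ))).trans (le_of_eq ?_)
  rw [lintegral_const, measure_univ, mul_one]

lemma nonpos_of_forall_sq_mul_le {δ a b : ℝ} (h : ∀ t : ℝ, 0 ≤ t → t ^ 2 * δ ≤ t * a + b) :
    δ ≤ 0 := by
  by_contra! hδ
  -- At this `t ≥ 1` one has `t δ > |a| + |b|`, so the quadratic term beats the right side.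
  have h1 := h ((|a| + |b|) / δ + 1) (by positivity)
  set t := (|a| + |b|) / δ + 1 with ht
  have h2 : t * δ = |a| + |b| + δ := by rw [ht]; field_simp
  have h3 : 1 ≤ t := by rw [ht, le_add_iff_nonneg_left]; positivity
  have h4 : t ^ 2 * δ = t * |a| + t * |b| + t * δ := by linear_combination t * h2
  have h5 : t * a ≤ t * |a| := mul_le_mul_of_nonneg_left (le_abs_self a) (by linarith)
  have h6 : |b| ≤ t * |b| := le_mul_of_one_le_left (abs_nonneg b) h3
  have h7 : 0 < t * δ := by positivity
  linarith [le_abs_self b]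

/-- The Laplace transform of the Husimi function of `σ` along the ray `t z` is bounded below because
`σ` is a mixture and above by Cauchy's estimate; the coefficients of `t²` must then be ordered. -/
lemma sum_norm_sq_le_weylVariance {n : ℕ} {ρ σ : FockSpace n →L[ℂ] FockSpace n} {c : Fin n → ℂ}
    (h : IsGaussianState ρ) {N : ℝ} (hN : 0 < N) (htr : subtractedTrace c ρ = (N : ℂ))
    (hσ : IsPhotonSubtracted c ρ σ) (hcl : IsClassical σ) (z : Fin n → ℂ) :
    ∑ i, ‖z i‖ ^ 2 ≤ weylVariance ρ z := by
  obtain ⟨B, hB, hρ, -⟩ := h.isState.exists_sqrt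
  obtain ⟨P, hP, hmix⟩ := (isClassical_iff_mixture σ).mp hcl
  obtain ⟨C, hC⟩ := exists_lintegral_angle_le ρ c z
  -- No moments of `P` are available. A half-space of positive mass on which the pairing is at least
  -- `-R` costs only `t R + O(1)` in the exponent.
  obtain ⟨R, hR⟩ : ∃ R : ℕ, 0 < P {w | -(R : ℝ) ≤ phasePairing z w} := by
    refine exists_measure_pos_of_not_measure_iUnion_null ?_
    have : ⋃ R : ℕ, {w | -(R : ℝ) ≤ phasePairing z w} = Set.univ :=
      Set.eq_univ_of_forall fun w => by
        obtain ⟨R, hR⟩ := exists_nat_ge (-phasePairing z w)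
        exact Set.mem_iUnion.mpr ⟨R, by simp only [Set.mem_ofPred_eq]; linarith⟩
    rw [this, measure_univ]
    exact one_ne_zero
  set p := P.real {w | -(R : ℝ) ≤ phasePairing z w} with hp
  have hp0 : 0 < p := ENNReal.toReal_pos hR.ne' (measure_ne_top _ _)
  have key : ∀ t : ℝ, 0 ≤ t →
      t ^ 2 * (∑ i, ‖z i‖ ^ 2 - husimiVariance ρ z / 2) ≤
        t * (C + R) + (C - Real.log N - Real.log p) := fun t ht => by
    have h1 := (lintegral_exp_phasePairing_photonSubtracted_le h hB hρ hN htr hσ (t • z)).trans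
      (hC t ht)
    have h2 : ∫⁻ u, ENNReal.ofReal (N * husimi σ u) *
        ENNReal.ofReal (Real.exp (phasePairing (t • z) u)) ∂phaseMeasure n =
        ENNReal.ofReal N * ∫⁻ w, ENNReal.ofReal
          (Real.exp (∑ i, ‖(t • z) i‖ ^ 2 + phasePairing (t • z) w)) ∂P := by
      rw [← lintegral_exp_phasePairing_mixture hmix, ← lintegral_const_mul' _ _ ENNReal.ofReal_ne_top]
      exact lintegral_congr fun u => by rw [ENNReal.ofReal_mul hN.le, mul_assoc]
    have h3 : ENNReal.ofReal (Real.exp (t ^ 2 * ∑ i, ‖z i‖ ^ 2 - t * R)) * ENNReal.ofReal p ≤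
        ∫⁻ w, ENNReal.ofReal
          (Real.exp (∑ i, ‖(t • z) i‖ ^ 2 + phasePairing (t • z) w)) ∂P := by
      refine le_trans ?_ (mul_meas_ge_le_lintegral₀ ?_
        (ENNReal.ofReal (Real.exp (t ^ 2 * ∑ i, ‖z i‖ ^ 2 - t * R))))
      · rw [hp, ofReal_measureReal]
        refine mul_le_mul_right (measure_mono fun w hw => ?_) _
        refine ENNReal.ofReal_le_ofReal (Real.exp_le_exp.mpr ?_)
        have h4 := mul_le_mul_of_nonneg_left (Set.mem_ofPred_eq ▸ hw) ht
        simp only [Pi.smul_apply, norm_smul, mul_pow, Real.norm_eq_abs, sq_abs,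
          ← Finset.mul_sum, phasePairing_smul]
        linarith
      · exact (Real.continuous_exp.comp (continuous_const.add
          (continuous_phasePairing _))).measurable.ennreal_ofReal.aemeasurable
    have h5 := (mul_le_mul_right h3 (ENNReal.ofReal N)).trans (h2.symm.le.trans h1)
    rw [← ENNReal.ofReal_mul (Real.exp_pos _).le, ← ENNReal.ofReal_mul hN.le,
      ENNReal.ofReal_le_ofReal_iff (Real.exp_pos _).le, ← Real.log_le_log_iff (by positivity)
      (Real.exp_pos _), Real.log_mul hN.ne' (by positivity), Real.log_mul (by positivity) hp0.ne',
      Real.log_exp, Real.log_exp] at h5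
    linarith
  -- Yields `|z|² ≤ (weylVariance + |z|²) / 2`, which rearranges to the claim.
  have := nonpos_of_forall_sq_mul_le key
  rw [husimiVariance] at this
  linarith

lemma covMatrix_isHermitian {n : ℕ} (ρ : FockSpace n →L[ℂ] FockSpace n) :
    (covMatrix ρ).IsHermitian := by
  refine Matrix.IsHermitian.ext fun i j => ?_
  simp only [covMatrix, Matrix.of_apply, star_trivial]
  rw [add_comm, mul_right_comm]

lemma posSemidef_of_isClassical {n : ℕ} {ρ σ : FockSpace n →L[ℂ] FockSpace n} {c : Fin n → ℂ}
    (h : IsGaussianState ρ) {N : ℝ} (hN : 0 < N) (htr : subtractedTrace c ρ = (N : ℂ))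
    (hσ : IsPhotonSubtracted c ρ σ) (hcl : IsClassical σ) : (covMatrix ρ - 1).PosSemidef := by
  refine Matrix.PosSemidef.of_dotProduct_mulVec_nonneg
    ((covMatrix_isHermitian ρ).sub Matrix.isHermitian_one) fun x => ?_
  obtain ⟨z, rfl⟩ := exists_rotVec_eq x
  rw [star_trivial, ← weylVariance_sub, sub_nonneg]
  exact sum_norm_sq_le_weylVariance h hN htr hσ hcl z

end QuantumOptics

end

theorem proposition1 (n : ℕ)
    (ρ : QuantumOptics.FockSpace n →L[ℂ] QuantumOptics.FockSpace n)
    (hρ : QuantumOptics.IsGaussianState ρ) (c : Fin n → ℂ)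
    (hc : QuantumOptics.subtractedForm c ρ ≠ 0) :
    (∃! σ : QuantumOptics.FockSpace n →L[ℂ] QuantumOptics.FockSpace n,
      QuantumOptics.IsPhotonSubtracted c ρ σ) ∧
    ∀ σ : QuantumOptics.FockSpace n →L[ℂ] QuantumOptics.FockSpace n,
      QuantumOptics.IsPhotonSubtracted c ρ σ →
        (QuantumOptics.IsClassical σ ↔ QuantumOptics.IsClassical ρ) ∧
        (QuantumOptics.IsNonclassical σ ↔ QuantumOptics.IsNonclassical ρ) ∧
        (QuantumOptics.IsClassical σ ↔ (QuantumOptics.covMatrix ρ - 1).PosSemidef) := by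
  refine ⟨?_, fun σ hσ => ?_⟩
  · obtain ⟨σ, hσ⟩ := QuantumOptics.exists_isPhotonSubtracted hρ hc
    exact ⟨σ, hσ, fun τ hτ => hτ.unique hσ⟩
  obtain ⟨B, hB, hBρ, -⟩ := hρ.isState.exists_sqrt
  have hN := QuantumOptics.subtractedTrace_pos hρ hB hBρ hc
  have htr := (QuantumOptics.hasSum_subtractedTrace hρ hB hBρ c).tsum_eq
  -- Together with `h2` and `h3` this closes the cycle `V - 1 ≥ 0`, `ρ` classical, `σ` classical, so
  -- no direct argument from `ρ` classical to `V - 1 ≥ 0` is needed.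
  have h1 : QuantumOptics.IsClassical σ → (QuantumOptics.covMatrix ρ - 1).PosSemidef :=
    QuantumOptics.posSemidef_of_isClassical hρ hN htr hσ
  have h2 := QuantumOptics.isClassical_of_posSemidef hρ
  have h3 : QuantumOptics.IsClassical ρ → QuantumOptics.IsClassical σ :=
    QuantumOptics.IsClassical.photonSubtracted hN htr hσ
  have h4 : QuantumOptics.IsClassical σ ↔ QuantumOptics.IsClassical ρ := ⟨fun h => h2 (h1 h), h3⟩
  exact ⟨h4, not_congr h4, h1, fun h => h3 (h2 h)⟩
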